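/- Tense formulae are $A ::= p \mid \overline{p} \mid A\wedge A \mid A\vee A \mid \Box A \mid \Diamond A \mid \blacksquare A \mid \blacklozenge A$. A path axiom is a scheme $\Pi A \to \langle ?\rangle A$ with $\Pi = \langle ?\rangle_1\cdots\langle ?\rangle_n$ a possibly empty string over $\{\Diamond,\blacklozenge\}$ and $\langle ?\rangle\in\{\Diamond,\blacklozenge\}$. A labeled sequent $\mathcal R,\Gamma$ consists of a finite set $\mathcal R$ of atoms $Rxy$ and a finite multiset $\Gamma$ of labeled formulae $x:A$. The rules of $\mathsf{LKt}+\mathit{LabSt}(P)$ are, written premises $/$ conclusion: - $(\mathsf{id})$ axiom $\mathcal R, x:p, x:\overline p,\Gamma$; - $(\vee)$ $\mathcal R, x:A, x:B,\Gamma \,/\, \mathcal R, x:A\vee B,\Gamma$; - $(\wedge)$ $\mathcal R, x:A,\Gamma$ and $\mathcal R, x:B,\Gamma \,/\, \mathcal R, x:A\wedge B,\Gamma$; - $(\Box)$ $\mathcal R,Rxy,y:A,\Gamma \,/\, \mathcal R,x:\Box A,\Gamma$ and $(\blacksquare)$ $\mathcal R,Ryx,y:A,\Gamma \,/\, \mathcal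 R,x:\blacksquare A,\Gamma$, with $y$ not in the conclusion; - $(\Diamond)$ $\mathcal R,Rxy,y:A,x:\Diamond A,\Gamma \,/\, \mathcal R,Rxy,x:\Diamond A,\Gamma$ and $(\blacklozenge)$ $\mathcal R,Ryx,y:A,x:\blacklozenge A,\Gamma \,/\, \mathcal R,Ryx,x:\blacklozenge A,\Gamma$; - for each $\Pi A\to\langle ?\rangle A\in P$, $(\mathsf{Path})$ $\mathcal R,\mathcal R_\Pi xy,R_{\langle ?\rangle}xy,\Gamma \,/\, \mathcal R,\mathcal R_\Pi xy,\Gamma$, where $R_\Diamond xy=Rxy$, $R_\blacklozenge xy=Ryx$, and $\mathcal R_\Pi xy$ is a chain $R_{\langle ?\rangle_1}xy_1,\dots,R_{\langle ?\rangle_n}y_{n-1}y$ (if $\Pi$ is empty, it is empty and $x=y$). A nested sequent is $X ::= \varepsilon \mid A \mid X,X \mid \circ\{X\}\mid\bullet\{X\}$, where comma is associative and commutative with unit $\varepsilon$. The rules of $\mathsf{SKT}+\mathit{NestSt}(P)$ are: - $(\mathsf{id})$ axiom $X,p,\overline p$; $(\vee)$ $X,A,B \,/\, X,A\vee B$; $(\wedge)$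 $X,A$ and $X,B \,/\, X,A\wedge B$; - contraction $X,Y,Y \,/\, X,Y$; weakening $X \,/\, X,Y$; - display rules $(\mathsf{rf})$ $X,\circ\{Y\} \,/\, \bullet\{X\},Y$ and $(\mathsf{rp})$ $X,\bullet\{Y\} \,/\, \circ\{X\},Y$; - $(\Box)$ $X,\circ\{A\} \,/\, X,\Box A$; $(\blacksquare)$ $X,\bullet\{A\} \,/\, X,\blacksquare A$; - $(\Diamond)$ $X,\circ\{Y,A\},\Diamond A \,/\, X,\circ\{Y\},\Diamond A$; $(\blacklozenge)$ $X,\bullet\{Y,A\},\blacklozenge A \,/\, X,\bullet\{Y\},\blacklozenge A$; - for each $\langle ?\rangle_1\cdots\langle ?\rangle_n A\to\langle ?\rangle A\in P$, $(\mathsf{Path})$ $X,\star\{Y\} \,/\, X,\star_1\{\cdots\star_n\{Y\}\cdots\}$, with $\star=\circ$ for $\Diamond$ and $\star=\bullet$ for $\blacklozenge$. Derivations are finite trees of sequents whose inferences carry the name of the rule (for $(\mathsf{Path})$: together with the path axiom). A labeled polytree sequent is a labeled sequent whose directed graph (vertices: the occurring labels; edges: $(x,y)$ for $Rxy\in\mathcal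 R$) is an orientation of a tree. For a vertex $x$, $\mathfrak N_x(\mathcal R,\Gamma)$ is the nested sequent of the formulae labeled $x$, a component $\circ\{\cdot\}$ for every edge $(x,y)$ and a component $\bullet\{\cdot\}$ for every edge $(z,x)$, filled recursively with the translation, started at the other end of the edge, of the part of the polytree that lies beyond that edge. **Theorem.** Every derivation in $\mathsf{LKt}+\mathit{LabSt}(P)$ of a labeled polytree sequent $\mathcal R,\Gamma$ can be effectively transformed into a derivation of $\mathfrak N(\mathcal R,\Gamma)$ in $\mathsf{SKT}+\mathit{NestSt}(P)$, for every set $P$ of path axioms. Precisely: there is a primitive recursive function (on Gödel numbers of derivations, and not depending on $P$) that, for every set $P$ of path axioms, every derivation $\mathcal D$ in $\mathsf{LKt}+\mathit{LabSt}(P)$ of a labeled polytree sequent $\mathcal R,\Gamma$, and every label $x$ of that sequent, sends $(\mathcal D,x)$ to a derivation of $\mathfrak N_x(\mathcal R,\Gamma)$ in $\mathsf{SKT}+\mathit{NestSt}(P)$. -/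

import Mathlib

namespace Tense

/-! ### Language -/

/-- Tense formulae in negation normal form; propositional variables are natural numbers. -/
inductive Fml : Type
  | pos (p : ℕ)
  | neg (p : ℕ)
  | and (A B : Fml)
  | or (A B : Fml)
  | box (A : Fml)
  | dia (A : Fml)
  | bbox (A : Fml)
  | bdia (A : Fml)

/-- The two diamonds: `white` looks to the future, `black` to the past. -/
inductive Dia : Type
  | white
  | black

/-- The path axiom (scheme) `⟨?⟩₁ … ⟨?⟩ₙ A → ⟨?⟩ A`, with `ant = [⟨?⟩₁, …, ⟨?⟩ₙ]`
(possibly empty) and `con = ⟨?⟩`. -/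
structure PathAxiom : Type where
  ant : List Dia
  con : Dia

/-! ### Derivation trees

All rules have at most two premises. A node carries the name of the rule and the conclusion. -/

inductive Deriv (ρ σ : Type) : Type
  | node₀ (r : ρ) (s : σ)
  | node₁ (r : ρ) (s : σ) (d : Deriv ρ σ)
  | node₂ (r : ρ) (s : σ) (d e : Deriv ρ σ)

namespace Deriv

variable {ρ σ : Type}

/-- The end sequent. -/
def concl : Deriv ρ σ → σ
  | node₀ _ s => s
  | node₁ _ s _ => s
  | node₂ _ s _ _ => s

/-- An inference is correct if, after rewriting its sequents along the identification `eqv` of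
sequents, it is an instance of the rule. -/
def Step (eqv : σ → σ → Prop) (inst : ρ → List σ → σ → Prop) (r : ρ) (ps : List σ) (s : σ) :
    Prop :=
  ∃ ps' s', List.Forall₂ eqv ps ps' ∧ eqv s s' ∧ inst r ps' s'

/-- Every inference of the tree is correct. -/
def Valid (eqv : σ → σ → Prop) (inst : ρ → List σ → σ → Prop) : Deriv ρ σ → Prop
  | node₀ r s => Step eqv inst r [] s
  | node₁ r s d => Step eqv inst r [d.concl] s ∧ Valid eqv inst d
  | node₂ r s d e =>
      Step eqv inst r [d.concl, e.concl] s ∧ Valid eqv inst d ∧ Valid eqv inst e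

/-- `d` is a derivation of (the sequent identified with) `s`. -/
def Derives (eqv : σ → σ → Prop) (inst : ρ → List σ → σ → Prop) (d : Deriv ρ σ) (s : σ) : Prop :=
  Valid eqv inst d ∧ eqv d.concl s

end Deriv

/-! ### Labeled sequents and the labeled calculus -/

/-- A labeled sequent `R, Γ` as it is written down: a list of relational atoms `Rxy`, given as
`(x, y)`, and a list of labeled formulae `x : A`, given as `(x, A)`. Labels are natural numbers. -/
structure LSeq : Type where
  rel : List (ℕ × ℕ)
  fml : List (ℕ × Fml)

namespace LSeq

/-- Identification of labeled sequents: `R` is a set and `Γ` is a multiset. -/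
def Eqv (S T : LSeq) : Prop :=
  (∀ e, e ∈ S.rel ↔ e ∈ T.rel) ∧ S.fml.Perm T.fml

/-- The set of labels occurring in the sequent. -/
def labels (S : LSeq) : Set ℕ :=
  {x | (∃ y, (x, y) ∈ S.rel ∨ (y, x) ∈ S.rel) ∨ ∃ A, (x, A) ∈ S.fml}

/-- The underlying undirected graph. -/
def graph (S : LSeq) : SimpleGraph S.labels where
  Adj x y := x ≠ y ∧ ((x.1, y.1) ∈ S.rel ∨ (y.1, x.1) ∈ S.rel)
  symm := ⟨fun _ _ h => ⟨h.1.symm, h.2.symm⟩⟩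
  loopless := ⟨fun _ h => h.1 rfl⟩

/-- A labeled polytree sequent: its directed graph is an orientation of a tree, that is, there are
no loops `Rxx`, no pairs `Rxy, Ryx`, and the underlying undirected graph is a tree. -/
def IsPolytree (S : LSeq) : Prop :=
  (∀ x y, (x, y) ∈ S.rel → (y, x) ∉ S.rel) ∧ S.graph.IsTree

end LSeq

/-- `R_⟨?⟩ x y`, which is `Rxy` for the white and `Ryx` for the black diamond. -/
def relAtom : Dia → ℕ → ℕ → ℕ × ℕ
  | .white, x, y => (x, y)
  | .black, x, y => (y, x)

/-- `IsRelPath Π x y Q`: `Q` is the list of relational atoms `R_Π x y`, for some choice of the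
intermediate labels. For the empty string, `x = y` and `Q` is empty. -/
inductive IsRelPath : List Dia → ℕ → ℕ → List (ℕ × ℕ) → Prop
  | nil (x : ℕ) : IsRelPath [] x x []
  | cons {d : Dia} {ds : List Dia} {x z y : ℕ} {Q : List (ℕ × ℕ)} :
      IsRelPath ds z y Q → IsRelPath (d :: ds) x y (relAtom d x z :: Q)

/-- Names of the rules of the labeled calculi. -/
inductive LRule : Type
  | id | or | and | box | dia | bbox | bdia
  | path (F : PathAxiom)

/-- Instances (premises and conclusion) of the rules of the labeled calculus for `Kt` extended with
the labeled structural rules of the path axioms in `P`. -/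
inductive LInst (P : Set PathAxiom) : LRule → List LSeq → LSeq → Prop
  | id (R : List (ℕ × ℕ)) (Γ : List (ℕ × Fml)) (x p : ℕ) :
      LInst P .id [] ⟨R, (x, .pos p) :: (x, .neg p) :: Γ⟩
  | or (R : List (ℕ × ℕ)) (Γ : List (ℕ × Fml)) (x : ℕ) (A B : Fml) :
      LInst P .or [⟨R, (x, A) :: (x, B) :: Γ⟩] ⟨R, (x, .or A B) :: Γ⟩
  | and (R : List (ℕ × ℕ)) (Γ : List (ℕ × Fml)) (x : ℕ) (A B : Fml) :
      LInst P .and [⟨R, (x, A) :: Γ⟩, ⟨R, (x, B) :: Γ⟩] ⟨R, (x, .and A B) :: Γ⟩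
  | box (R : List (ℕ × ℕ)) (Γ : List (ℕ × Fml)) (x y : ℕ) (A : Fml)
      (hy : y ∉ LSeq.labels ⟨R, (x, .box A) :: Γ⟩) :
      LInst P .box [⟨(x, y) :: R, (y, A) :: Γ⟩] ⟨R, (x, .box A) :: Γ⟩
  | dia (R : List (ℕ × ℕ)) (Γ : List (ℕ × Fml)) (x y : ℕ) (A : Fml) :
      LInst P .dia [⟨(x, y) :: R, (y, A) :: (x, .dia A) :: Γ⟩] ⟨(x, y) :: R, (x, .dia A) :: Γ⟩
  | bbox (R : List (ℕ × ℕ)) (Γ : List (ℕ × Fml)) (x y : ℕ) (A : Fml)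
      (hy : y ∉ LSeq.labels ⟨R, (x, .bbox A) :: Γ⟩) :
      LInst P .bbox [⟨(y, x) :: R, (y, A) :: Γ⟩] ⟨R, (x, .bbox A) :: Γ⟩
  | bdia (R : List (ℕ × ℕ)) (Γ : List (ℕ × Fml)) (x y : ℕ) (A : Fml) :
      LInst P .bdia [⟨(y, x) :: R, (y, A) :: (x, .bdia A) :: Γ⟩] ⟨(y, x) :: R, (x, .bdia A) :: Γ⟩
  | path (F : PathAxiom) (hF : F ∈ P) (R Q : List (ℕ × ℕ)) (Γ : List (ℕ × Fml)) (x y : ℕ)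
      (hQ : IsRelPath F.ant x y Q) :
      LInst P (.path F) [⟨relAtom F.con x y :: (Q ++ R), Γ⟩] ⟨Q ++ R, Γ⟩

/-- `D` is a derivation of `S` in `LKt + LabSt(P)`. -/
def LDerives (P : Set PathAxiom) (D : Deriv LRule LSeq) (S : LSeq) : Prop :=
  D.Derives LSeq.Eqv (LInst P) S

/-! ### Nested sequents and the shallow nested (display) calculus -/

/-- Nested sequents as they are written down. -/
inductive NSeq : Type
  | empty
  | fml (A : Fml)
  | comma (X Y : NSeq)
  | circ (X : NSeq)
  | bull (X : NSeq)

namespace NSeq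

/-- Identification of nested sequents: comma is associative and commutative with unit `ε`, also
inside of nestings. -/
inductive Eqv : NSeq → NSeq → Prop
  | refl (X : NSeq) : Eqv X X
  | symm {X Y : NSeq} : Eqv X Y → Eqv Y X
  | trans {X Y Z : NSeq} : Eqv X Y → Eqv Y Z → Eqv X Z
  | comma_empty (X : NSeq) : Eqv (comma X empty) X
  | comma_comm (X Y : NSeq) : Eqv (comma X Y) (comma Y X)
  | comma_assoc (X Y Z : NSeq) : Eqv (comma (comma X Y) Z) (comma X (comma Y Z))
  | comma_congr {X X' Y Y' : NSeq} : Eqv X X' → Eqv Y Y' → Eqv (comma X Y) (comma X' Y')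
  | circ_congr {X X' : NSeq} : Eqv X X' → Eqv (circ X) (circ X')
  | bull_congr {X X' : NSeq} : Eqv X X' → Eqv (bull X) (bull X')

/-- The nesting `⋆{X}` that belongs to a diamond. -/
def nest : Dia → NSeq → NSeq
  | .white, X => circ X
  | .black, X => bull X

/-- `⋆₁{ … ⋆ₙ{X} … }`, which is `X` for the empty string. -/
def nests (ds : List Dia) (X : NSeq) : NSeq := ds.foldr nest X

/-- `X₁, …, Xₙ`. -/
def ofList (Xs : List NSeq) : NSeq := Xs.foldr comma empty

end NSeq

/-- Names of the rules of the shallow nested calculi. -/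
inductive NRule : Type
  | id | or | and | ctr | wk | rf | rp | bbox | box | bdia | dia
  | path (F : PathAxiom)

open NSeq in
/-- Instances (premises and conclusion) of the rules of the shallow nested calculus for `Kt`
extended with the nested structural rules of the path axioms in `P`. -/
inductive NInst (P : Set PathAxiom) : NRule → List NSeq → NSeq → Prop
  | id (X : NSeq) (p : ℕ) :
      NInst P .id [] (comma X (comma (fml (.pos p)) (fml (.neg p))))
  | or (X : NSeq) (A B : Fml) :
      NInst P .or [comma X (comma (fml A) (fml B))] (comma X (fml (.or A B)))
  | and (X : NSeq) (A B : Fml) :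
      NInst P .and [comma X (fml A), comma X (fml B)] (comma X (fml (.and A B)))
  | ctr (X Y : NSeq) : NInst P .ctr [comma X (comma Y Y)] (comma X Y)
  | wk (X Y : NSeq) : NInst P .wk [X] (comma X Y)
  | rf (X Y : NSeq) : NInst P .rf [comma X (circ Y)] (comma (bull X) Y)
  | rp (X Y : NSeq) : NInst P .rp [comma X (bull Y)] (comma (circ X) Y)
  | bbox (X : NSeq) (A : Fml) :
      NInst P .bbox [comma X (bull (fml A))] (comma X (fml (.bbox A)))
  | box (X : NSeq) (A : Fml) :
      NInst P .box [comma X (circ (fml A))] (comma X (fml (.box A)))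
  | bdia (X Y : NSeq) (A : Fml) :
      NInst P .bdia [comma X (comma (bull (comma Y (fml A))) (fml (.bdia A)))]
        (comma X (comma (bull Y) (fml (.bdia A))))
  | dia (X Y : NSeq) (A : Fml) :
      NInst P .dia [comma X (comma (circ (comma Y (fml A))) (fml (.dia A)))]
        (comma X (comma (circ Y) (fml (.dia A))))
  | path (F : PathAxiom) (hF : F ∈ P) (X Y : NSeq) :
      NInst P (.path F) [comma X (nest F.con Y)] (comma X (nests F.ant Y))

/-- `D` is a derivation of `X` in `SKT + NestSt(P)`. -/
def NDerives (P : Set PathAxiom) (D : Deriv NRule NSeq) (X : NSeq) : Prop :=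
  D.Derives NSeq.Eqv (NInst P) X

/-! ### From labeled polytree sequents to nested sequents -/

/-- The nested sequent read off from the vertex `x`: first the formulae at `x`; then `∘{…}` for every
edge `(x, y)` and `•{…}` for every edge `(z, x)`, filled with what is read off from the other end
after `x` has been taken away with its edges. The first argument bounds the depth of the recursion;
the number of edges suffices, since every round removes an edge. -/
def toNestedAux (Γ : List (ℕ × Fml)) : ℕ → List (ℕ × ℕ) → ℕ → NSeq
  | 0, _, x => .ofList ((Γ.filter fun a => a.1 = x).map fun a => .fml a.2)
  | n + 1, E, x =>
      .comma (.ofList ((Γ.filter fun a => a.1 = x).map fun a => .fml a.2))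
        (.comma
          (.ofList ((E.filter fun e => e.1 = x).map fun e =>
            .circ (toNestedAux Γ n (E.filter fun a => a.1 ≠ x ∧ a.2 ≠ x) e.2)))
          (.ofList ((E.filter fun e => e.2 = x).map fun e =>
            .bull (toNestedAux Γ n (E.filter fun a => a.1 ≠ x ∧ a.2 ≠ x) e.1))))

/-- The translation `𝔑ₓ(R, Γ)` of a labeled polytree sequent, started at its vertex `x`. (Repeated
relational atoms are removed first, since `R` is a set.) -/
def LSeq.toNested (S : LSeq) (x : ℕ) : NSeq :=
  toNestedAux S.fml S.rel.length S.rel.dedup x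

/-! ### Gödel numbers -/

def Fml.code : Fml → ℕ
  | .pos p => Nat.pair 0 p
  | .neg p => Nat.pair 1 p
  | .and A B => Nat.pair 2 (Nat.pair A.code B.code)
  | .or A B => Nat.pair 3 (Nat.pair A.code B.code)
  | .box A => Nat.pair 4 A.code
  | .dia A => Nat.pair 5 A.code
  | .bbox A => Nat.pair 6 A.code
  | .bdia A => Nat.pair 7 A.code

def Dia.code : Dia → ℕ
  | .white => 0
  | .black => 1

def PathAxiom.code (F : PathAxiom) : ℕ :=
  Nat.pair (Encodable.encode (F.ant.map Dia.code)) F.con.code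

def LSeq.code (S : LSeq) : ℕ :=
  Nat.pair (Encodable.encode S.rel)
    (Encodable.encode (S.fml.map fun a => (a.1, a.2.code)))

def LRule.code : LRule → ℕ
  | .id => Nat.pair 0 0
  | .or => Nat.pair 1 0
  | .and => Nat.pair 2 0
  | .box => Nat.pair 3 0
  | .dia => Nat.pair 4 0
  | .bbox => Nat.pair 5 0
  | .bdia => Nat.pair 6 0
  | .path F => Nat.pair 7 F.code

def NSeq.code : NSeq → ℕ
  | .empty => Nat.pair 0 0
  | .fml A => Nat.pair 1 A.code
  | .comma X Y => Nat.pair 2 (Nat.pair X.code Y.code)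
  | .circ X => Nat.pair 3 X.code
  | .bull X => Nat.pair 4 X.code

def NRule.code : NRule → ℕ
  | .id => Nat.pair 0 0
  | .or => Nat.pair 1 0
  | .and => Nat.pair 2 0
  | .ctr => Nat.pair 3 0
  | .wk => Nat.pair 4 0
  | .rf => Nat.pair 5 0
  | .rp => Nat.pair 6 0
  | .bbox => Nat.pair 7 0
  | .box => Nat.pair 8 0
  | .bdia => Nat.pair 9 0
  | .dia => Nat.pair 10 0
  | .path F => Nat.pair 11 F.code

def Deriv.codeWith {ρ σ : Type} (cr : ρ → ℕ) (cs : σ → ℕ) : Deriv ρ σ → ℕ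
  | .node₀ r s => Nat.pair 0 (Nat.pair (cr r) (cs s))
  | .node₁ r s d => Nat.pair 1 (Nat.pair (Nat.pair (cr r) (cs s)) (codeWith cr cs d))
  | .node₂ r s d e =>
      Nat.pair 2 (Nat.pair (Nat.pair (cr r) (cs s))
        (Nat.pair (codeWith cr cs d) (codeWith cr cs e)))

/-- Gödel number of a labeled derivation. -/
def lcode (D : Deriv LRule LSeq) : ℕ := D.codeWith LRule.code LSeq.code

/-- Gödel number of a nested derivation. -/
def ncode (D : Deriv NRule NSeq) : ℕ := D.codeWith NRule.code NSeq.code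

/-! The numberings are injective: a derivation can be recovered from its number. -/

theorem Fml.code_injective : Function.Injective Fml.code := by
  intro A
  induction A with
  | pos p => intro B h; cases B <;> simp_all [Fml.code]
  | neg p => intro B h; cases B <;> simp_all [Fml.code]
  | and A₁ A₂ h₁ h₂ =>
      intro B h; cases B <;> simp [Fml.code] at h ⊢; exact ⟨h₁ h.1, h₂ h.2⟩
  | or A₁ A₂ h₁ h₂ =>
      intro B h; cases B <;> simp [Fml.code] at h ⊢; exact ⟨h₁ h.1, h₂ h.2⟩
  | box A ih => intro B h; cases B <;> simp [Fml.code] at h ⊢; exact ih h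
  | dia A ih => intro B h; cases B <;> simp [Fml.code] at h ⊢; exact ih h
  | bbox A ih => intro B h; cases B <;> simp [Fml.code] at h ⊢; exact ih h
  | bdia A ih => intro B h; cases B <;> simp [Fml.code] at h ⊢; exact ih h

theorem Dia.code_injective : Function.Injective Dia.code := by
  intro a b h
  cases a <;> cases b <;> simp_all [Dia.code]

theorem PathAxiom.code_injective : Function.Injective PathAxiom.code := by
  rintro ⟨a, c⟩ ⟨b, d⟩ h
  simp only [PathAxiom.code, Nat.pair_eq_pair] at h
  rw [List.map_injective_iff.2 Dia.code_injective (Encodable.encode_injective h.1),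
    Dia.code_injective h.2]

theorem LSeq.code_injective : Function.Injective LSeq.code := by
  rintro ⟨R, Γ⟩ ⟨Q, Δ⟩ h
  simp only [LSeq.code, Nat.pair_eq_pair] at h
  have hi : Function.Injective fun a : ℕ × Fml => (a.1, a.2.code) := by
    rintro ⟨x, A⟩ ⟨y, B⟩ h
    simp only [Prod.mk.injEq] at h
    rw [h.1, Fml.code_injective h.2]
  rw [Encodable.encode_injective h.1,
    List.map_injective_iff.2 hi (Encodable.encode_injective h.2)]

theorem LRule.code_injective : Function.Injective LRule.code := by
  intro a b h
  cases a <;> cases b <;> simp [LRule.code] at h ⊢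
  exact PathAxiom.code_injective h

theorem NSeq.code_injective : Function.Injective NSeq.code := by
  intro X
  induction X with
  | empty => intro Y h; cases Y <;> simp_all [NSeq.code]
  | fml A => intro Y h; cases Y <;> simp [NSeq.code] at h ⊢; exact Fml.code_injective h
  | comma X₁ X₂ h₁ h₂ =>
      intro Y h; cases Y <;> simp [NSeq.code] at h ⊢; exact ⟨h₁ h.1, h₂ h.2⟩
  | circ X ih => intro Y h; cases Y <;> simp [NSeq.code] at h ⊢; exact ih h
  | bull X ih => intro Y h; cases Y <;> simp [NSeq.code] at h ⊢; exact ih h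

theorem NRule.code_injective : Function.Injective NRule.code := by
  intro a b h
  cases a <;> cases b <;> simp [NRule.code] at h ⊢
  exact PathAxiom.code_injective h

theorem Deriv.codeWith_injective {ρ σ : Type} {cr : ρ → ℕ} {cs : σ → ℕ}
    (hr : Function.Injective cr) (hs : Function.Injective cs) :
    Function.Injective (Deriv.codeWith cr cs) := by
  intro D
  induction D with
  | node₀ r s =>
      intro E h; cases E <;> simp [Deriv.codeWith] at h ⊢
      exact ⟨hr h.1, hs h.2⟩
  | node₁ r s d ih =>
      intro E h; cases E <;> simp [Deriv.codeWith] at h ⊢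
      exact ⟨hr h.1.1, hs h.1.2, ih h.2⟩
  | node₂ r s d e ihd ihe =>
      intro E h; cases E <;> simp [Deriv.codeWith] at h ⊢
      exact ⟨hr h.1.1, hs h.1.2, ihd h.2.1, ihe h.2.2⟩

theorem lcode_injective : Function.Injective lcode :=
  Deriv.codeWith_injective LRule.code_injective LSeq.code_injective

theorem ncode_injective : Function.Injective ncode :=
  Deriv.codeWith_injective NRule.code_injective NSeq.code_injective

end Tense

/-!
The given labeled derivation is traversed from its root to its leaves. Along the way an environment
`Env` is kept: a tree `E.tree` (initially the polytree of the end sequent), a list of labeled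
formulae, and for relational atoms `Ruv` between vertices of the tree a *script*. Only the rules for
`□` and `■` enlarge the tree, by a leaf. The atoms that path rules add do not: in place of a nested
inference for `(Path)` they give new scripts. Nested sequents are always read off from the tree, so
they stay tree shaped although the labeled sequents in the derivation need not be polytrees.

A script for the atom with diamond `d` from `u` to `v` consists of nested inferences that lead from
`N_u, ⋆{Y}` to `N_v, Y` for every `Y` (`Leads`), where `N_u` is the nested sequent read off at `u`
and `⋆` belongs to `d`. For an edge of the tree, where `N_u = M, ⋆{K}` and `N_v = K, ⋆'{M}`, the
script weakens both nestings to `⋆{Y, K}`, contracts them and moves the root by a display rule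
(`Der.mergeLines`). Scripts compose along chains (`Leads.append`); if the atoms of a chain that
spells `Π` have scripts, then the nested path rule, which turns `⋆{Y}` into `⋆₁{ … ⋆ₙ{Y} … }`,
followed by the composed script, is a script for the new atom (`Leads.pathForth`). Its converse
direction is obtained by display rules (`Leads.pathBack`).

The logical rules are applied after the root has been moved to the label of the active formula, and
the principal formula is contracted with its copy in the environment. For `◇` on the atom `Rxy`,
the formula `y : A` in `N_y` is turned into `•{◇A}` next to `N_y`, and the script for `Rxy`,
traversed from `y` to `x`, turns this into `◇A` next to `N_x`. So the nested derivation is correct as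
long as the environment describes the labeled sequent (`Inv`, `der_paramRec`).

The traversal is primitive recursive (`Deriv.primrec_paramRec`), since the environments can be
listed in preorder with a stack, and the results are then computed from the end of this list with a
second stack. The inferences do not record their active formulae; these are found by bounded search.
Everything else is a matter of closure properties of primitive recursive functions on lists, for
which the Gödel numberings are made into `Primcodable` instances. Nested sequents up to the
identification `NSeq.Eqv` form a commutative monoid `NQuot`, in which the identities between nested
sequents are verified; in particular reading off along a tree list (`nestedAt`) agrees with
`toNestedAux` (`readOff_eq_nestedAt`).
-/

namespace Tense

/-! ### Primitive recursion: closure properties for `fun_prop` -/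

attribute [fun_prop] Primrec PrimrecPred

attribute [fun_prop] Primrec.id Primrec.const Primrec.comp Primrec.fst Primrec.snd Primrec.pair
  Primrec.list_reverse Primrec.unpair Primrec.ite Primrec.list_head? Primrec.list_headI
  Primrec.list_tail Primrec.list_length Primrec.list_range
  Primrec.option_some Primrec.encode Primrec.decode Primrec.succ
  PrimrecPred.and PrimrecPred.or PrimrecPred.not

section Closure

variable {α β γ σ : Type} [Primcodable α] [Primcodable β] [Primcodable γ] [Primcodable σ]

@[fun_prop]
theorem primrecPred_eq {f g : α → β} (hf : Primrec f) (hg : Primrec g) :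
    PrimrecPred fun a => f a = g a :=
  Primrec.eq.comp hf hg

@[fun_prop]
theorem primrecPred_lt {f g : α → ℕ} (hf : Primrec f) (hg : Primrec g) :
    PrimrecPred fun a => f a < g a :=
  Primrec.nat_lt.comp hf hg

@[fun_prop]
theorem primrec_cons {f : α → β} {g : α → List β} (hf : Primrec f) (hg : Primrec g) :
    Primrec fun a => f a :: g a :=
  Primrec.list_cons.comp hf hg

@[fun_prop]
theorem primrec_append {f g : α → List β} (hf : Primrec f) (hg : Primrec g) :
    Primrec fun a => f a ++ g a :=
  Primrec.list_append.comp hf hg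

@[fun_prop]
theorem primrec_take {f : α → ℕ} {g : α → List β} (hf : Primrec f) (hg : Primrec g) :
    Primrec fun a => (g a).take (f a) :=
  Primrec.list_take.comp hf hg

@[fun_prop]
theorem primrec_drop {f : α → ℕ} {g : α → List β} (hf : Primrec f) (hg : Primrec g) :
    Primrec fun a => (g a).drop (f a) :=
  Primrec.list_drop.comp hf hg

@[fun_prop]
theorem primrec_getD_list {f : α → List β} {g : α → ℕ} {d : α → β} (hf : Primrec f)
    (hg : Primrec g) (hd : Primrec d) : Primrec fun a => (f a).getD (g a) (d a) := by
  refine (Primrec.option_getD.comp (Primrec.list_getElem?.comp hf hg) hd).of_eq fun a => ?_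
  simp

@[fun_prop]
theorem primrec_getD {f : α → Option β} {d : α → β} (hf : Primrec f) (hd : Primrec d) :
    Primrec fun a => (f a).getD (d a) :=
  Primrec.option_getD.comp hf hd

@[fun_prop]
theorem primrec_natPair {f g : α → ℕ} (hf : Primrec f) (hg : Primrec g) :
    Primrec fun a => Nat.pair (f a) (g a) :=
  Primrec₂.natPair.comp hf hg

@[fun_prop]
theorem primrec_map {f : α → List β} {g : α → β → σ} (hf : Primrec f)
    (hg : Primrec fun p : α × β => g p.1 p.2) : Primrec fun a => (f a).map (g a) :=
  Primrec.list_map hf hg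

@[fun_prop]
theorem primrec_flatMap {f : α → List β} {g : α → β → List σ} (hf : Primrec f)
    (hg : Primrec fun p : α × β => g p.1 p.2) : Primrec fun a => (f a).flatMap (g a) :=
  Primrec.list_flatMap hf hg

@[fun_prop]
theorem primrec_foldl {f : α → List β} {g : α → σ} {h : α → σ → β → σ} (hf : Primrec f)
    (hg : Primrec g) (hh : Primrec fun p : (α × σ) × β => h p.1.1 p.1.2 p.2) :
    Primrec fun a => (f a).foldl (h a) (g a) :=
  Primrec.list_foldl (h := fun a p => h a p.1 p.2) hf hg
    (Primrec.comp hh (g := fun p : α × σ × β => ((p.1, p.2.1), p.2.2)) (by fun_prop))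

@[fun_prop]
theorem primrec_foldr {f : α → List β} {g : α → σ} {h : α → β → σ → σ} (hf : Primrec f)
    (hg : Primrec g) (hh : Primrec fun p : (α × β) × σ => h p.1.1 p.1.2 p.2) :
    Primrec fun a => (f a).foldr (h a) (g a) :=
  Primrec.list_foldr (h := fun a p => h a p.1 p.2) hf hg
    (Primrec.comp hh (g := fun p : α × β × σ => ((p.1, p.2.1), p.2.2)) (by fun_prop))

@[fun_prop]
theorem primrec_filter {f : α → List β} {p : α → β → Prop} [∀ a, DecidablePred (p a)]
    (hf : Primrec f) (hp : PrimrecPred fun q : α × β => p q.1 q.2) :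
    Primrec fun a => (f a).filter (fun b => p a b) := by
  classical
  have : Primrec fun a => (f a).flatMap fun b => if p a b then [b] else [] := by fun_prop
  refine this.of_eq fun a => ?_
  induction f a with
  | nil => rfl
  | cons b l ih => by_cases h : p a b <;> simp [h, ih]

@[fun_prop]
theorem primrecPred_mem {f : α → β} {g : α → List β} (hf : Primrec f) (hg : Primrec g) :
    PrimrecPred fun a => f a ∈ g a := by
  have h : PrimrecRel fun (L : List β) (b : β) => ∃ a ∈ L, a = b :=
    PrimrecRel.exists_mem_list (R := fun a b : β => a = b) Primrec.eq
  exact (h.comp hg hf).of_eq fun a => by simp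

@[fun_prop]
theorem primrecPred_subset {f g : α → List β} (hf : Primrec f) (hg : Primrec g) :
    PrimrecPred fun a => f a ⊆ g a := by
  have h : PrimrecRel fun (L : List β) (l : List β) => ∀ b ∈ L, b ∈ l :=
    PrimrecRel.forall_mem_list (R := fun (b : β) (l : List β) => b ∈ l)
      (primrecPred_mem (f := fun p : β × List β => p.1) (by fun_prop) (by fun_prop))
  exact h.comp hf hg

theorem primrec_iterate {n : α → ℕ} {f : α → β} {g : α → β → β} (hn : Primrec n) (hf : Primrec f)
    (hg : Primrec fun p : α × β => g p.1 p.2) : Primrec fun a => (g a)^[n a] (f a) :=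
  Primrec.nat_iterate hn hf hg

/-- Course-of-values recursion for a predicate on the natural numbers. -/
theorem primrecPred_of_strong_rec {p : ℕ → Prop} (G : ℕ × List Bool → Prop) (hG : PrimrecPred G)
    (H : ∀ (n : ℕ) (l : List Bool), (∀ m, l.getD m false = true ↔ m < n ∧ p m) → (p n ↔ G (n, l))) :
    PrimrecPred p := by
  classical
  have h : Primrec₂ fun (_ : Unit) (n : ℕ) => decide (p n) := by
    refine Primrec.nat_strong_rec _ (g := fun _ l => some (decide (G (l.length, l)))) ?_ ?_
    · have h1 : Primrec fun a => decide (G a) := hG.decide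
      refine Primrec.option_some.comp (h1.comp (?_ : Primrec fun q : Unit × List Bool =>
        (q.2.length, q.2)))
      fun_prop
    · intro _ n
      simp only [List.length_map, List.length_range, Option.some.injEq, decide_eq_decide]
      refine (H n _ fun m => ?_).symm
      by_cases hm : m < n <;> simp [List.getD, hm]
  exact Primrec.primrecPred (h.comp (Primrec.const ()) Primrec.id)

end Closure

/-! ### The Gödel numberings as `Primcodable` instances -/

open Classical in
/-- An injective numbering with primitive recursive range, as a `Primcodable` structure. -/
@[reducible]
noncomputable def primcodableOfCode {α : Type} (code : α → ℕ) (hinj : Function.Injective code)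
    (h : PrimrecPred fun n => ∃ a, code a = n) : Primcodable α where
  encode := code
  decode n := if h : ∃ a, code a = n then some h.choose else none
  encodek a := by
    have h : ∃ b, code b = code a := ⟨a, rfl⟩
    rw [dif_pos h]
    exact congrArg some (hinj h.choose_spec)
  prim := by
    have h2 : Primrec fun n => if (∃ a, code a = n) then n + 1 else 0 :=
      Primrec.ite h Primrec.succ (Primrec.const 0)
    refine (Primrec.nat_iff.1 h2).of_eq fun n => ?_
    by_cases hn : ∃ a, code a = n
    · rw [dif_pos hn, if_pos hn]
      exact congrArg Nat.succ hn.choose_spec.symm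
    · rw [dif_neg hn, if_neg hn]
      rfl

theorem lt_pair_of_pos {a b : ℕ} (h : 0 < a) : b < Nat.pair a b := by
  have h1 := Nat.add_le_pair a b
  omega

theorem exists_pair (n : ℕ) : ∃ a b, n = Nat.pair a b := ⟨_, _, (Nat.pair_unpair n).symm⟩

theorem encode_map {α β : Type} [Encodable α] [Encodable β] {f : α → β}
    (hf : ∀ a, Encodable.encode (f a) = Encodable.encode a) (l : List α) :
    Encodable.encode (l.map f) = Encodable.encode l := by
  induction l with
  | nil => rfl
  | cons a l ih => simp [Encodable.encode_list_cons, hf, ih]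

noncomputable instance : Primcodable Dia :=
  primcodableOfCode Dia.code Dia.code_injective <| by
    have h : PrimrecPred fun n : ℕ => n < 2 := by fun_prop
    refine h.of_eq fun n => ⟨fun h => ?_, ?_⟩
    · interval_cases n
      exacts [⟨.white, rfl⟩, ⟨.black, rfl⟩]
    · rintro ⟨_ | _, rfl⟩ <;> decide

theorem Dia.encode_eq (d : Dia) : Encodable.encode d.code = Encodable.encode d := rfl

instance : DecidableEq Dia := Dia.code_injective.decidableEq

instance : DecidableEq Fml := Fml.code_injective.decidableEq

instance : Inhabited Dia := ⟨.white⟩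

instance : Finite Dia :=
  Finite.of_surjective (fun b : Bool => bif b then Dia.white else Dia.black) fun d => by
    cases d
    exacts [⟨true, rfl⟩, ⟨false, rfl⟩]

theorem PathAxiom.code_eq (F : PathAxiom) :
    F.code = Nat.pair (Encodable.encode F.ant) (Encodable.encode F.con) := by
  rw [PathAxiom.code, encode_map Dia.encode_eq]
  rfl

noncomputable instance : Primcodable PathAxiom :=
  primcodableOfCode PathAxiom.code PathAxiom.code_injective <| by
    have h : PrimrecPred fun n : ℕ =>
        n.unpair.1 ∈ Set.range (Encodable.encode : List Dia → ℕ) ∧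
          n.unpair.2 ∈ Set.range (Encodable.encode : Dia → ℕ) :=
      (Primcodable.mem_range_encode.comp (f := fun n : ℕ => n.unpair.1) (by fun_prop)).and
        (Primcodable.mem_range_encode.comp (f := fun n : ℕ => n.unpair.2) (by fun_prop))
    refine h.of_eq fun n => ⟨?_, ?_⟩
    · rintro ⟨⟨a, ha⟩, c, hc⟩
      exact ⟨⟨a, c⟩, by rw [PathAxiom.code_eq, ha, hc, Nat.pair_unpair]⟩
    · rintro ⟨F, rfl⟩
      simp [PathAxiom.code_eq]

instance : Inhabited PathAxiom := ⟨⟨[], .white⟩⟩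

noncomputable instance : Primcodable Fml :=
  primcodableOfCode Fml.code Fml.code_injective <| by
    refine primrecPred_of_strong_rec (fun q =>
      q.1.unpair.1 < 2 ∨
      (¬ q.1.unpair.1 < 2 ∧ q.1.unpair.1 < 4 ∧ q.2.getD q.1.unpair.2.unpair.1 false = true ∧
        q.2.getD q.1.unpair.2.unpair.2 false = true) ∨
      (¬ q.1.unpair.1 < 4 ∧ q.1.unpair.1 < 8 ∧ q.2.getD q.1.unpair.2 false = true))
      (by fun_prop) fun n l hl => ?_
    obtain ⟨t, b, rfl⟩ := exists_pair n
    simp only [hl, Nat.unpair_pair]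
    constructor
    · rintro ⟨A, hA⟩
      cases A <;> simp only [Fml.code, Nat.pair_eq_pair] at hA <;> obtain ⟨rfl, rfl⟩ := hA <;>
        simp [lt_pair_of_pos]
      all_goals
        exact ⟨(Nat.left_le_pair _ _).trans_lt (lt_pair_of_pos (by decide)),
          (Nat.right_le_pair _ _).trans_lt (lt_pair_of_pos (by decide))⟩
    · rintro (h | ⟨h₂, h, ⟨-, A, hA⟩, -, B, hB⟩ | ⟨h, h', -, A, hA⟩)
      · interval_cases t
        exacts [⟨.pos b, rfl⟩, ⟨.neg b, rfl⟩]
      · have hb : Nat.pair A.code B.code = b := by rw [hA, hB, Nat.pair_unpair]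
        interval_cases t
        · exact ⟨.and A B, by rw [Fml.code, hb]⟩
        · exact ⟨.or A B, by rw [Fml.code, hb]⟩
      · subst hA
        interval_cases t
        exacts [⟨.box A, rfl⟩, ⟨.dia A, rfl⟩, ⟨.bbox A, rfl⟩, ⟨.bdia A, rfl⟩]

theorem Fml.encode_eq (A : Fml) : Encodable.encode A = A.code := rfl

noncomputable instance : Primcodable NSeq :=
  primcodableOfCode NSeq.code NSeq.code_injective <| by
    refine primrecPred_of_strong_rec (fun q =>
      q.1 = 0 ∨
      (q.1.unpair.1 = 1 ∧ q.1.unpair.2 ∈ Set.range (Encodable.encode : Fml → ℕ)) ∨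
      (q.1.unpair.1 = 2 ∧ q.2.getD q.1.unpair.2.unpair.1 false = true ∧
        q.2.getD q.1.unpair.2.unpair.2 false = true) ∨
      (2 < q.1.unpair.1 ∧ q.1.unpair.1 < 5 ∧ q.2.getD q.1.unpair.2 false = true))
      ?_ fun n l hl => ?_
    · have h : PrimrecPred fun q : ℕ × List Bool =>
          q.1.unpair.2 ∈ Set.range (Encodable.encode : Fml → ℕ) :=
        Primcodable.mem_range_encode.comp (f := fun q : ℕ × List Bool => q.1.unpair.2)
          (by fun_prop)
      fun_prop
    obtain ⟨t, b, rfl⟩ := exists_pair n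
    simp only [hl, Nat.unpair_pair]
    constructor
    · rintro ⟨X, hX⟩
      cases X <;> simp only [NSeq.code, Nat.pair_eq_pair] at hX <;> obtain ⟨rfl, rfl⟩ := hX <;>
        simp [lt_pair_of_pos, ← Fml.encode_eq]
      · rfl
      · exact .inr ⟨(Nat.left_le_pair _ _).trans_lt (lt_pair_of_pos (by decide)),
          (Nat.right_le_pair _ _).trans_lt (lt_pair_of_pos (by decide))⟩
    · rintro (h | ⟨rfl, A, rfl⟩ | ⟨rfl, ⟨-, X, hX⟩, -, Y, hY⟩ | ⟨h, h', -, X, hX⟩)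
      · exact ⟨.empty, h.symm⟩
      · exact ⟨.fml A, rfl⟩
      · exact ⟨.comma X Y, by rw [NSeq.code, hX, hY, Nat.pair_unpair]⟩
      · subst hX
        interval_cases t
        exacts [⟨.circ X, rfl⟩, ⟨.bull X, rfl⟩]

theorem LSeq.code_eq (S : LSeq) :
    S.code = Nat.pair (Encodable.encode S.rel) (Encodable.encode S.fml) := by
  rw [LSeq.code, encode_map (f := fun a : ℕ × Fml => (a.1, a.2.code)) fun _ => rfl]

noncomputable instance : Primcodable LSeq :=
  primcodableOfCode LSeq.code LSeq.code_injective <| by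
    have h : PrimrecPred fun n : ℕ =>
        n.unpair.1 ∈ Set.range (Encodable.encode : List (ℕ × ℕ) → ℕ) ∧
          n.unpair.2 ∈ Set.range (Encodable.encode : List (ℕ × Fml) → ℕ) :=
      (Primcodable.mem_range_encode.comp (f := fun n : ℕ => n.unpair.1) (by fun_prop)).and
        (Primcodable.mem_range_encode.comp (f := fun n : ℕ => n.unpair.2) (by fun_prop))
    refine h.of_eq fun n => ⟨?_, ?_⟩
    · rintro ⟨⟨a, ha⟩, c, hc⟩
      exact ⟨⟨a, c⟩, by rw [LSeq.code_eq, ha, hc, Nat.pair_unpair]⟩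
    · rintro ⟨S, rfl⟩
      simp [LSeq.code_eq]

theorem primrecPred_rule_code (k : ℕ) : PrimrecPred fun n : ℕ =>
    (n.unpair.1 < k ∧ n.unpair.2 = 0) ∨
      (n.unpair.1 = k ∧ n.unpair.2 ∈ Set.range (Encodable.encode : PathAxiom → ℕ)) := by
  have h : PrimrecPred fun n : ℕ =>
      n.unpair.2 ∈ Set.range (Encodable.encode : PathAxiom → ℕ) :=
    Primcodable.mem_range_encode.comp (f := fun n : ℕ => n.unpair.2) (by fun_prop)
  fun_prop

noncomputable instance : Primcodable LRule :=
  primcodableOfCode LRule.code LRule.code_injective <| by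
    refine (primrecPred_rule_code 7).of_eq fun n => ?_
    obtain ⟨t, b, rfl⟩ := exists_pair n
    simp only [Nat.unpair_pair]
    constructor
    · rintro (⟨h, rfl⟩ | ⟨rfl, F, rfl⟩)
      · interval_cases t
        exacts [⟨.id, rfl⟩, ⟨.or, rfl⟩, ⟨.and, rfl⟩, ⟨.box, rfl⟩, ⟨.dia, rfl⟩, ⟨.bbox, rfl⟩,
          ⟨.bdia, rfl⟩]
      · exact ⟨.path F, rfl⟩
    · rintro ⟨r, hr⟩
      cases r <;> simp only [LRule.code, Nat.pair_eq_pair] at hr <;> obtain ⟨rfl, rfl⟩ := hr <;>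
        simp
      exact ⟨_, rfl⟩

noncomputable instance : Primcodable NRule :=
  primcodableOfCode NRule.code NRule.code_injective <| by
    refine (primrecPred_rule_code 11).of_eq fun n => ?_
    obtain ⟨t, b, rfl⟩ := exists_pair n
    simp only [Nat.unpair_pair]
    constructor
    · rintro (⟨h, rfl⟩ | ⟨rfl, F, rfl⟩)
      · interval_cases t
        exacts [⟨.id, rfl⟩, ⟨.or, rfl⟩, ⟨.and, rfl⟩, ⟨.ctr, rfl⟩, ⟨.wk, rfl⟩, ⟨.rf, rfl⟩, ⟨.rp, rfl⟩,
          ⟨.bbox, rfl⟩, ⟨.box, rfl⟩, ⟨.bdia, rfl⟩, ⟨.dia, rfl⟩]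
      · exact ⟨.path F, rfl⟩
    · rintro ⟨r, hr⟩
      cases r <;> simp only [NRule.code, Nat.pair_eq_pair] at hr <;> obtain ⟨rfl, rfl⟩ := hr <;>
        simp
      exact ⟨_, rfl⟩

noncomputable instance {ρ σ : Type} [Primcodable ρ] [Primcodable σ] : Primcodable (Deriv ρ σ) :=
  primcodableOfCode (Deriv.codeWith Encodable.encode Encodable.encode)
    (Deriv.codeWith_injective Encodable.encode_injective Encodable.encode_injective) <| by
    have hr : PrimrecPred fun n : ℕ => n ∈ Set.range (Encodable.encode : ρ → ℕ) :=
      Primcodable.mem_range_encode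
    have hs : PrimrecPred fun n : ℕ => n ∈ Set.range (Encodable.encode : σ → ℕ) :=
      Primcodable.mem_range_encode
    refine primrecPred_of_strong_rec (fun q =>
      (q.1.unpair.1 = 0 ∧ q.1.unpair.2.unpair.1 ∈ Set.range (Encodable.encode : ρ → ℕ) ∧
        q.1.unpair.2.unpair.2 ∈ Set.range (Encodable.encode : σ → ℕ)) ∨
      (q.1.unpair.1 = 1 ∧ q.1.unpair.2.unpair.1.unpair.1 ∈ Set.range (Encodable.encode : ρ → ℕ) ∧
        q.1.unpair.2.unpair.1.unpair.2 ∈ Set.range (Encodable.encode : σ → ℕ) ∧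
        q.2.getD q.1.unpair.2.unpair.2 false = true) ∨
      (q.1.unpair.1 = 2 ∧ q.1.unpair.2.unpair.1.unpair.1 ∈ Set.range (Encodable.encode : ρ → ℕ) ∧
        q.1.unpair.2.unpair.1.unpair.2 ∈ Set.range (Encodable.encode : σ → ℕ) ∧
        q.2.getD q.1.unpair.2.unpair.2.unpair.1 false = true ∧
        q.2.getD q.1.unpair.2.unpair.2.unpair.2 false = true))
      ?_ fun n l hl => ?_
    · have hr' {f : ℕ × List Bool → ℕ} (hf : Primrec f) :
          PrimrecPred fun q => f q ∈ Set.range (Encodable.encode : ρ → ℕ) := hr.comp hf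
      have hs' {f : ℕ × List Bool → ℕ} (hf : Primrec f) :
          PrimrecPred fun q => f q ∈ Set.range (Encodable.encode : σ → ℕ) := hs.comp hf
      fun_prop (disch := assumption)
    obtain ⟨t, b, rfl⟩ := exists_pair n
    simp only [hl, Nat.unpair_pair]
    constructor
    · rintro ⟨D, hD⟩
      cases D <;> simp only [Deriv.codeWith, Nat.pair_eq_pair] at hD <;>
        obtain ⟨rfl, rfl⟩ := hD <;> simp [-Set.mem_range, Set.mem_range_self]
      · exact (Nat.right_le_pair _ _).trans_lt (lt_pair_of_pos (by decide))
      · exact ⟨((Nat.left_le_pair _ _).trans (Nat.right_le_pair _ _)).trans_lt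
          (lt_pair_of_pos (by decide)),
          ((Nat.right_le_pair _ _).trans (Nat.right_le_pair _ _)).trans_lt
          (lt_pair_of_pos (by decide))⟩
    · rintro (⟨rfl, ⟨r, hr⟩, s, hs⟩ | ⟨rfl, ⟨r, hr⟩, ⟨s, hs⟩, -, D, hD⟩ |
        ⟨rfl, ⟨r, hr⟩, ⟨s, hs⟩, ⟨-, D, hD⟩, -, E, hE⟩)
      · exact ⟨.node₀ r s, by simp only [Deriv.codeWith, hr, hs, Nat.pair_unpair]⟩
      · exact ⟨.node₁ r s D, by simp only [Deriv.codeWith, hr, hs, hD, Nat.pair_unpair]⟩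
      · exact ⟨.node₂ r s D E, by simp only [Deriv.codeWith, hr, hs, hD, hE, Nat.pair_unpair]⟩

theorem lcode_eq (D : Deriv LRule LSeq) : lcode D = Encodable.encode D := rfl

theorem ncode_eq (D : Deriv NRule NSeq) : ncode D = Encodable.encode D := rfl

/-! ### Primitive recursive constructors and destructors -/

section Operations

variable {α : Type} [Primcodable α]

/-- Functions between numbered types may be computed on Gödel numbers. -/
theorem primrec_of_encode {α β : Type} [Primcodable α] [Primcodable β] {f : α → β} (g : α → ℕ)
    (hg : Primrec g) (h : ∀ a, Encodable.encode (f a) = g a) : Primrec f :=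
  Primrec.encode_iff.1 (hg.of_eq fun a => (h a).symm)

@[fun_prop]
theorem primrec_ant : Primrec PathAxiom.ant :=
  primrec_of_encode (fun F => (Encodable.encode F).unpair.1) (by fun_prop) fun F => by
    change _ = F.code.unpair.1
    rw [PathAxiom.code_eq, Nat.unpair_pair]

@[fun_prop]
theorem primrec_con : Primrec PathAxiom.con :=
  primrec_of_encode (fun F => (Encodable.encode F).unpair.2) (by fun_prop) fun F => by
    change _ = F.code.unpair.2
    rw [PathAxiom.code_eq, Nat.unpair_pair]

@[fun_prop]
theorem primrec_rel : Primrec LSeq.rel :=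
  primrec_of_encode (fun S => (Encodable.encode S).unpair.1) (by fun_prop) fun S => by
    change _ = S.code.unpair.1
    rw [LSeq.code_eq, Nat.unpair_pair]

@[fun_prop]
theorem primrec_fml : Primrec LSeq.fml :=
  primrec_of_encode (fun S => (Encodable.encode S).unpair.2) (by fun_prop) fun S => by
    change _ = S.code.unpair.2
    rw [LSeq.code_eq, Nat.unpair_pair]

/-- The converse diamond. -/
def Dia.dual : Dia → Dia
  | .white => .black
  | .black => .white

@[fun_prop]
theorem primrec_dual {f : α → Dia} (hf : Primrec f) : Primrec fun a => (f a).dual :=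
  (Primrec.dom_finite Dia.dual).comp hf

/-- A number that tells which connective is outermost. -/
def Fml.tag : Fml → ℕ
  | .pos _ => 0
  | .neg _ => 1
  | .and _ _ => 2
  | .or _ _ => 3
  | .box _ => 4
  | .dia _ => 5
  | .bbox _ => 6
  | .bdia _ => 7

/-- The first immediate subformula (a literal is returned unchanged). -/
def Fml.left : Fml → Fml
  | .and A _ | .or A _ | .box A | .dia A | .bbox A | .bdia A => A
  | A => A

/-- The second immediate subformula (the formula itself if there is only one or none). -/
def Fml.right : Fml → Fml
  | .and _ B | .or _ B => B
  | A => A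

/-- Turns `p` into its complement (all other formulae are returned unchanged). -/
def Fml.compl : Fml → Fml
  | .pos p => .neg p
  | A => A

@[fun_prop]
theorem primrec_tag : Primrec Fml.tag :=
  primrec_of_encode (fun A => (Encodable.encode A).unpair.1) (by fun_prop) fun A => by
    change A.tag = A.code.unpair.1
    cases A <;> simp [Fml.tag, Fml.code]

@[fun_prop]
theorem primrec_left : Primrec Fml.left :=
  primrec_of_encode (fun A => if A.tag < 2 then Encodable.encode A else if A.tag < 4 then
    (Encodable.encode A).unpair.2.unpair.1 else (Encodable.encode A).unpair.2)
    (by fun_prop) fun A => by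
    simp only [Fml.encode_eq]
    cases A <;> simp [Fml.left, Fml.tag, Fml.code]

@[fun_prop]
theorem primrec_right : Primrec Fml.right :=
  primrec_of_encode (fun A => if A.tag = 2 ∨ A.tag = 3 then
    (Encodable.encode A).unpair.2.unpair.2 else Encodable.encode A)
    (by fun_prop) fun A => by
    simp only [Fml.encode_eq]
    cases A <;> simp [Fml.right, Fml.tag, Fml.code]

@[fun_prop]
theorem primrec_compl : Primrec Fml.compl :=
  primrec_of_encode (fun A => if A.tag = 0 then Nat.pair 1 (Encodable.encode A).unpair.2
    else Encodable.encode A)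
    (by fun_prop) fun A => by
    simp only [Fml.encode_eq]
    cases A <;> simp [Fml.compl, Fml.tag, Fml.code]

/-- A number that tells the rule, except for the path axiom. -/
def LRule.tag : LRule → ℕ
  | .id => 0
  | .or => 1
  | .and => 2
  | .box => 3
  | .dia => 4
  | .bbox => 5
  | .bdia => 6
  | .path _ => 7

/-- The path axiom that a path rule belongs to. -/
def LRule.scheme : LRule → PathAxiom
  | .path F => F
  | _ => default

@[fun_prop]
theorem primrec_ltag : Primrec LRule.tag :=
  primrec_of_encode (fun r => (Encodable.encode r).unpair.1) (by fun_prop) fun r => by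
    change r.tag = r.code.unpair.1
    cases r <;> simp [LRule.tag, LRule.code]

@[fun_prop]
theorem primrec_lrule_scheme : Primrec LRule.scheme := by
  have h : Primrec fun r : LRule => if r.tag = 7 then
      ((Encodable.decode (Encodable.encode r).unpair.2 : Option PathAxiom).getD default)
      else default := by fun_prop
  refine h.of_eq fun r => ?_
  cases r <;> simp [LRule.tag, LRule.scheme]
  rename_i F
  have : (Encodable.encode (LRule.path F)).unpair.2 = Encodable.encode F :=
    congrArg Prod.snd (Nat.unpair_pair 7 F.code)
  rw [this, Encodable.encodek, Option.getD_some]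

@[fun_prop]
theorem primrec_nrule_path : Primrec NRule.path :=
  primrec_of_encode (fun F => Nat.pair 11 (Encodable.encode F)) (by fun_prop) fun _ => rfl

@[fun_prop]
theorem primrec_nseq_fml : Primrec NSeq.fml :=
  primrec_of_encode (fun A => Nat.pair 1 (Encodable.encode A)) (by fun_prop) fun _ => rfl

@[fun_prop]
theorem primrec_comma {f g : α → NSeq} (hf : Primrec f) (hg : Primrec g) :
    Primrec fun a => NSeq.comma (f a) (g a) :=
  primrec_of_encode (fun a => Nat.pair 2 (Nat.pair (Encodable.encode (f a))
    (Encodable.encode (g a)))) (by fun_prop) fun _ => rfl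

@[fun_prop]
theorem primrec_nest {d : α → Dia} {f : α → NSeq} (hd : Primrec d) (hf : Primrec f) :
    Primrec fun a => NSeq.nest (d a) (f a) :=
  primrec_of_encode (fun a => if d a = .white then Nat.pair 3 (Encodable.encode (f a))
    else Nat.pair 4 (Encodable.encode (f a))) (by fun_prop) fun a => by
    cases d a <;> rfl

@[fun_prop]
theorem primrec_nests {w : α → List Dia} {f : α → NSeq} (hw : Primrec w) (hf : Primrec f) :
    Primrec fun a => NSeq.nests (w a) (f a) := by
  unfold NSeq.nests
  fun_prop

@[fun_prop]
theorem primrec_ofList {f : α → List NSeq} (hf : Primrec f) :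
    Primrec fun a => NSeq.ofList (f a) := by
  unfold NSeq.ofList
  fun_prop

end Operations

/-! ### Recursion on derivations with a changing parameter -/

namespace Deriv

variable {ρ σ ε τ : Type}

/-- The name of the last rule. -/
def rule : Deriv ρ σ → ρ
  | node₀ r _ | node₁ r _ _ | node₂ r _ _ _ => r

/-- The immediate subderivations. -/
def prems : Deriv ρ σ → List (Deriv ρ σ)
  | node₀ _ _ => []
  | node₁ _ _ d => [d]
  | node₂ _ _ d e => [d, e]

/-- The last inference: name of the rule, conclusion, premises. -/
def last (D : Deriv ρ σ) : ρ × σ × List σ := (D.rule, D.concl, D.prems.map concl)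

/-- Recursion on derivations that hands a parameter from the root to the leaves: `h i e k` is the
parameter for the `k`-th immediate subderivation of a derivation with last inference `i` and
parameter `e`, and `g i e` combines the results for the immediate subderivations. -/
def paramRec (h : (ρ × σ × List σ) → ε → ℕ → ε) (g : (ρ × σ × List σ) → ε → List τ → τ) :
    Deriv ρ σ → ε → τ
  | node₀ r s, e => g (r, s, []) e []
  | node₁ r s d, e => g (r, s, [d.concl]) e [paramRec h g d (h (r, s, [d.concl]) e 0)]
  | node₂ r s d d', e => g (r, s, [d.concl, d'.concl]) e
      [paramRec h g d (h (r, s, [d.concl, d'.concl]) e 0),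
        paramRec h g d' (h (r, s, [d.concl, d'.concl]) e 1)]

/-- The inferences of a derivation with their parameters, in preorder. -/
def visit (h : (ρ × σ × List σ) → ε → ℕ → ε) :
    Deriv ρ σ → ε → List ((ρ × σ × List σ) × ε)
  | node₀ r s, e => [((r, s, []), e)]
  | node₁ r s d, e => ((r, s, [d.concl]), e) :: visit h d (h (r, s, [d.concl]) e 0)
  | node₂ r s d d', e => ((r, s, [d.concl, d'.concl]), e) ::
      (visit h d (h (r, s, [d.concl, d'.concl]) e 0) ++
        visit h d' (h (r, s, [d.concl, d'.concl]) e 1))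

/-- One step of the traversal with an explicit stack of subderivations to be visited and an output
in reverse order. (The fold over at most one stack entry is a case distinction on whether the stack is
empty.) -/
def visitStep (h : (ρ × σ × List σ) → ε → ℕ → ε)
    (s : List (Deriv ρ σ × ε) × List ((ρ × σ × List σ) × ε)) :
    List (Deriv ρ σ × ε) × List ((ρ × σ × List σ) × ε) :=
  (s.1.take 1).foldl (fun _ p =>
    ((List.range p.1.prems.length).map (fun i => (p.1.prems.getD i p.1, h p.1.last p.2 i)) ++
      s.1.tail, (p.1.last, p.2) :: s.2)) s

theorem iterate_visitStep (h : (ρ × σ × List σ) → ε → ℕ → ε) (D : Deriv ρ σ) :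
    ∀ e w out, (visitStep h)^[(visit h D e).length] ((D, e) :: w, out) =
      (w, (visit h D e).reverse ++ out) := by
  induction D with
  | node₀ r s => intro e w out; rfl
  | node₁ r s d ih =>
    intro e w out
    have h1 : visitStep h ((node₁ r s d, e) :: w, out) =
        ((d, h (r, s, [d.concl]) e 0) :: w, ((r, s, [d.concl]), e) :: out) := rfl
    simp only [visit, List.length_cons, Function.iterate_succ, Function.comp_apply]
    rw [h1, ih]
    simp
  | node₂ r s d d' ih ih' =>
    intro e w out
    have h1 : visitStep h ((node₂ r s d d', e) :: w, out) =
        ((d, h (r, s, [d.concl, d'.concl]) e 0) :: (d', h (r, s, [d.concl, d'.concl]) e 1) :: w,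
          ((r, s, [d.concl, d'.concl]), e) :: out) := rfl
    simp only [visit, List.length_cons, List.length_append, Function.iterate_succ,
      Function.comp_apply]
    rw [h1, Nat.add_comm, Function.iterate_add_apply, ih, ih']
    simp

theorem foldr_visit (h : (ρ × σ × List σ) → ε → ℕ → ε) (g : (ρ × σ × List σ) → ε → List τ → τ)
    (D : Deriv ρ σ) : ∀ e st,
      (visit h D e).foldr (fun p st => g p.1 p.2 (st.take p.1.2.2.length) ::
        st.drop p.1.2.2.length) st = paramRec h g D e :: st := by
  induction D with
  | node₀ r s => intro e st; simp [visit, paramRec]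
  | node₁ r s d ih => intro e st; simp [visit, paramRec, ih]
  | node₂ r s d d' ih ih' => intro e st; simp [visit, paramRec, ih, ih']

variable [Primcodable ρ] [Primcodable σ]

theorem length_visit_le (h : (ρ × σ × List σ) → ε → ℕ → ε) (D : Deriv ρ σ) :
    ∀ e, (visit h D e).length ≤ Encodable.encode D + 1 := by
  change ∀ e, (visit h D e).length ≤ D.codeWith Encodable.encode Encodable.encode + 1
  induction D with
  | node₀ r s => intro e; simp [visit]
  | node₁ r s d ih =>
    intro e
    simp only [visit, codeWith, List.length_cons, Nat.add_le_add_iff_right]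
    exact (ih _).trans (lt_pair_of_pos (by decide) |>.trans_le' (Nat.right_le_pair _ _))
  | node₂ r s d d' ih ih' =>
    intro e
    simp only [visit, codeWith, List.length_cons, List.length_append, Nat.add_le_add_iff_right]
    have h1 := ih (h (r, s, [d.concl, d'.concl]) e 0)
    have h2 := ih' (h (r, s, [d.concl, d'.concl]) e 1)
    have h3 := Nat.add_le_pair (codeWith Encodable.encode Encodable.encode d)
      (codeWith Encodable.encode Encodable.encode d')
    have h4 := Nat.right_le_pair (Nat.pair (Encodable.encode r) (Encodable.encode s))
      (Nat.pair (codeWith Encodable.encode Encodable.encode d)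
        (codeWith Encodable.encode Encodable.encode d'))
    have h5 := Nat.add_le_pair 2 (Nat.pair (Nat.pair (Encodable.encode r) (Encodable.encode s))
      (Nat.pair (codeWith Encodable.encode Encodable.encode d)
        (codeWith Encodable.encode Encodable.encode d')))
    omega

@[fun_prop]
theorem primrec_node₀ {α : Type} [Primcodable α] {r : α → ρ} {s : α → σ} (hr : Primrec r)
    (hs : Primrec s) : Primrec fun a => node₀ (r a) (s a) :=
  primrec_of_encode (fun a => Nat.pair 0 (Nat.pair (Encodable.encode (r a))
    (Encodable.encode (s a)))) (by fun_prop) fun _ => rfl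

@[fun_prop]
theorem primrec_node₁ {α : Type} [Primcodable α] {r : α → ρ} {s : α → σ} {d : α → Deriv ρ σ}
    (hr : Primrec r) (hs : Primrec s) (hd : Primrec d) :
    Primrec fun a => node₁ (r a) (s a) (d a) :=
  primrec_of_encode (fun a => Nat.pair 1 (Nat.pair (Nat.pair (Encodable.encode (r a))
    (Encodable.encode (s a))) (Encodable.encode (d a)))) (by fun_prop) fun _ => rfl

@[fun_prop]
theorem primrec_node₂ {α : Type} [Primcodable α] {r : α → ρ} {s : α → σ} {d e : α → Deriv ρ σ}
    (hr : Primrec r) (hs : Primrec s) (hd : Primrec d) (he : Primrec e) :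
    Primrec fun a => node₂ (r a) (s a) (d a) (e a) :=
  primrec_of_encode (fun a => Nat.pair 2 (Nat.pair (Nat.pair (Encodable.encode (r a))
    (Encodable.encode (s a))) (Nat.pair (Encodable.encode (d a)) (Encodable.encode (e a)))))
    (by fun_prop) fun _ => rfl

theorem encode_eq (D : Deriv ρ σ) :
    Encodable.encode D = D.codeWith Encodable.encode Encodable.encode := rfl

@[fun_prop]
theorem primrec_rule : Primrec (rule : Deriv ρ σ → ρ) :=
  primrec_of_encode (fun D => if (Encodable.encode D).unpair.1 = 0 then
    (Encodable.encode D).unpair.2.unpair.1 else (Encodable.encode D).unpair.2.unpair.1.unpair.1)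
    (by fun_prop) fun D => by cases D <;> simp [encode_eq, codeWith, rule]

@[fun_prop]
theorem primrec_concl : Primrec (concl : Deriv ρ σ → σ) :=
  primrec_of_encode (fun D => if (Encodable.encode D).unpair.1 = 0 then
    (Encodable.encode D).unpair.2.unpair.2 else (Encodable.encode D).unpair.2.unpair.1.unpair.2)
    (by fun_prop) fun D => by cases D <;> simp [encode_eq, codeWith, concl]

@[fun_prop]
theorem primrec_prems : Primrec (prems : Deriv ρ σ → List (Deriv ρ σ)) := by
  have h : Primrec fun D : Deriv ρ σ =>
      (if (Encodable.encode D).unpair.1 = 0 then []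
        else if (Encodable.encode D).unpair.1 = 1 then [(Encodable.encode D).unpair.2.unpair.2]
        else [(Encodable.encode D).unpair.2.unpair.2.unpair.1,
          (Encodable.encode D).unpair.2.unpair.2.unpair.2]).map
      fun n => (Encodable.decode n : Option (Deriv ρ σ)).getD D := by fun_prop
  refine h.of_eq fun D => ?_
  cases D <;> simp only [encode_eq, codeWith, prems, Nat.unpair_pair] <;>
    simp [← encode_eq]

@[fun_prop]
theorem primrec_last : Primrec (last : Deriv ρ σ → ρ × σ × List σ) := by
  unfold last
  fun_prop

variable [Primcodable ε] [Primcodable τ]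

/-- The recursion `Deriv.paramRec` is primitive recursive: the inferences are listed together with
their parameters in preorder, and the results are then computed from the end of the list with a
stack. -/
theorem primrec_paramRec {h : (ρ × σ × List σ) → ε → ℕ → ε} {g : (ρ × σ × List σ) → ε → List τ → τ}
    (hh : Primrec fun p : ((ρ × σ × List σ) × ε) × ℕ => h p.1.1 p.1.2 p.2)
    (hg : Primrec fun p : ((ρ × σ × List σ) × ε) × List τ => g p.1.1 p.1.2 p.2) :
    Primrec₂ (paramRec h g) := by
  have hh' {α : Type} [Primcodable α] {i : α → (ρ × σ × List σ)} {e : α → ε} {n : α → ℕ}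
      (hi : Primrec i) (he : Primrec e) (hn : Primrec n) :
      Primrec fun a => h (i a) (e a) (n a) :=
    hh.comp (f := fun p : ((ρ × σ × List σ) × ε) × ℕ => h p.1.1 p.1.2 p.2)
      (g := fun a => ((i a, e a), n a)) (by fun_prop)
  have hg' {α : Type} [Primcodable α] {i : α → (ρ × σ × List σ)} {e : α → ε} {l : α → List τ}
      (hi : Primrec i) (he : Primrec e) (hl : Primrec l) :
      Primrec fun a => g (i a) (e a) (l a) :=
    hg.comp (f := fun p : ((ρ × σ × List σ) × ε) × List τ => g p.1.1 p.1.2 p.2)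
      (g := fun a => ((i a, e a), l a)) (by fun_prop)
  have hstep : Primrec fun p : (List (Deriv ρ σ × ε) × List ((ρ × σ × List σ) × ε)) =>
      visitStep h p := by
    unfold visitStep
    fun_prop (disch := assumption)
  have hvisit : Primrec fun p : Deriv ρ σ × ε =>
      ((visitStep h)^[Encodable.encode p.1 + 1] ([p], [])).2 :=
    Primrec.snd.comp (primrec_iterate (g := fun _ => visitStep h)
      (Primrec.succ.comp (by fun_prop)) (by fun_prop) (hstep.comp Primrec.snd))
  have hmain : Primrec fun p : Deriv ρ σ × ε =>
      ((((visitStep h)^[Encodable.encode p.1 + 1] ([p], [])).2).foldl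
        (fun st q => g q.1 q.2 (st.take q.1.2.2.length) :: st.drop q.1.2.2.length) []).head? := by
    fun_prop (disch := assumption)
  refine Primrec.option_some_iff.1 (hmain.of_eq fun p => ?_)
  obtain ⟨D, e⟩ := p
  have hfix : ∀ (m : ℕ) out, (visitStep h)^[m] ([], out) = ([], out) := fun m out => by
    induction m with
    | zero => rfl
    | succ m ih => rw [Function.iterate_succ_apply]; exact ih
  obtain ⟨m, hm⟩ := Nat.exists_eq_add_of_le' (length_visit_le h D e)
  have hrun : (visitStep h)^[Encodable.encode D + 1] ([(D, e)], []) =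
      ([], (visit h D e).reverse) := by
    rw [hm, Function.iterate_add_apply, iterate_visitStep, hfix, List.append_nil]
  simp only [hrun, List.foldl_reverse, foldr_visit, List.head?_cons]

end Deriv

instance : Inhabited Fml := ⟨.pos 0⟩

instance : Inhabited LSeq := ⟨⟨[], []⟩⟩

instance : Inhabited (Deriv NRule NSeq) := ⟨.node₀ .id .empty⟩

/-! ### Trees and the nested sequents read off from them -/

/-- An edge with a direction of travel: `(d, u, v)` stands for the relational atom `relAtom d u v`,
traversed from `u` to `v`. -/
abbrev Edge : Type := Dia × ℕ × ℕ

/-- The same atom, traversed in the other direction. -/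
def Edge.flip (e : Edge) : Edge := (e.1.dual, e.2.2, e.2.1)

/-- The nested sequents attached to the label `u`. -/
def itemsAt (Δ : List (ℕ × NSeq)) (u : ℕ) : NSeq :=
  .ofList ((Δ.filter fun a => a.1 = u).map fun a => a.2)

/-- The items attached to labels other than `u`. -/
def itemsAway (Δ : List (ℕ × NSeq)) (u : ℕ) : List (ℕ × NSeq) := Δ.filter fun a => a.1 ≠ u

/-- The nested sequent read off at `u` from a tree whose vertices carry nested sequents. The tree is
the list of its edges `(d, parent, child)`, such that every child is a leaf of the tree that the rest
of the list describes together with this edge. Leaves are absorbed into their parents one by one,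
except for a leaf at which the sequent is to be read off: there the rest of the tree, read off at the
parent, becomes a nesting. -/
def nestedAt : List Edge → ℕ → List (ℕ × NSeq) → NSeq
  | [], u, Δ => itemsAt Δ u
  | e :: R, u, Δ =>
      if u = e.2.2 then
        .comma (itemsAt Δ e.2.2) (.nest e.1.dual (nestedAt R e.2.1 (itemsAway Δ e.2.2)))
      else nestedAt R u (itemsAway Δ e.2.2 ++ [(e.2.1, .nest e.1 (itemsAt Δ e.2.2))])

/-- The nested sequent read off at `u` from a tree with labeled formulae. -/
def view (R : List Edge) (Γ : List (ℕ × Fml)) (u : ℕ) : NSeq :=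
  nestedAt R u (Γ.map fun a => (a.1, .fml a.2))

section Primrec

variable {α : Type} [Primcodable α]

@[fun_prop]
theorem primrec_flip {e : α → Edge} (he : Primrec e) : Primrec fun a => (e a).flip := by
  unfold Edge.flip
  fun_prop

@[fun_prop]
theorem primrec_itemsAt {Δ : α → List (ℕ × NSeq)} {u : α → ℕ} (hΔ : Primrec Δ) (hu : Primrec u) :
    Primrec fun a => itemsAt (Δ a) (u a) := by
  unfold itemsAt
  fun_prop

@[fun_prop]
theorem primrec_itemsAway {Δ : α → List (ℕ × NSeq)} {u : α → ℕ} (hΔ : Primrec Δ)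
    (hu : Primrec u) : Primrec fun a => itemsAway (Δ a) (u a) := by
  unfold itemsAway
  fun_prop

/-- `nestedAt` as an iteration: the third component of the state collects the surroundings of the
part that is still to be read off. -/
theorem nestedAt_eq_foldl (R : List Edge) : ∀ (u : ℕ) (Δ : List (ℕ × NSeq)) (C : List (Dia × NSeq)),
    C.foldl (fun Z f => .comma f.2 (.nest f.1 Z)) (nestedAt R u Δ) =
      (fun s : ℕ × List (ℕ × NSeq) × List (Dia × NSeq) =>
        s.2.2.foldl (fun Z f => .comma f.2 (.nest f.1 Z)) (itemsAt s.2.1 s.1))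
      (R.foldl (fun s e =>
        if s.1 = e.2.2 then
          (e.2.1, itemsAway s.2.1 e.2.2, (e.1.dual, itemsAt s.2.1 e.2.2) :: s.2.2)
        else (s.1, itemsAway s.2.1 e.2.2 ++ [(e.2.1, .nest e.1 (itemsAt s.2.1 e.2.2))], s.2.2))
        (u, Δ, C)) := by
  induction R with
  | nil => intro u Δ C; rfl
  | cons e R ih =>
    intro u Δ C
    by_cases h : u = e.2.2
    · simp only [nestedAt, List.foldl_cons, if_pos h]
      exact ih _ _ ((e.1.dual, itemsAt Δ e.2.2) :: C)
    · simp only [nestedAt, List.foldl_cons, if_neg h]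
      exact ih _ _ C

@[fun_prop]
theorem primrec_nestedAt {R : α → List Edge} {u : α → ℕ} {Δ : α → List (ℕ × NSeq)}
    (hR : Primrec R) (hu : Primrec u) (hΔ : Primrec Δ) :
    Primrec fun a => nestedAt (R a) (u a) (Δ a) := by
  have h : ∀ a, nestedAt (R a) (u a) (Δ a) = _ := fun a => nestedAt_eq_foldl (R a) (u a) (Δ a) []
  simp only [h]
  fun_prop

@[fun_prop]
theorem primrec_view {R : α → List Edge} {Γ : α → List (ℕ × Fml)} {u : α → ℕ}
    (hR : Primrec R) (hΓ : Primrec Γ) (hu : Primrec u) :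
    Primrec fun a => view (R a) (Γ a) (u a) := by
  unfold view
  fun_prop

end Primrec

/-! ### Moving the root by display rules -/

/-- A unary inference to be put below a derivation: name of the rule and conclusion. -/
abbrev Line : Type := NRule × NSeq

/-- Puts unary inferences below a derivation. -/
def extend (D : Deriv NRule NSeq) (l : List Line) : Deriv NRule NSeq :=
  l.foldl (fun D a => .node₁ a.1 a.2 D) D

/-- The display rule from `X, ⋆{Y}` to `⋆'{X}, Y` with `⋆` the nesting of the given diamond and `⋆'`
that of its converse. -/
def disp : Dia → NRule
  | .white => .rf
  | .black => .rp

/-- The edges on the way from the root down to `u`. -/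
def pathTo (R : List Edge) (u : ℕ) : List Edge :=
  (R.foldl (fun s e => if s.1 = e.2.2 then (e.2.1, e :: s.2) else s)
    ((u, []) : ℕ × List Edge)).2

/-- The display inferences that move the root along a sequence of edges. -/
def walk (R : List Edge) (Γ : List (ℕ × Fml)) (es : List Edge) : List Line :=
  es.map fun e => (disp e.1, view R Γ e.2.2)

/-- The display inferences that move the root down to `u`. -/
def descend (R : List Edge) (Γ : List (ℕ × Fml)) (u : ℕ) : List Line := walk R Γ (pathTo R u)

/-- The display inferences that move the root back from `u`. -/
def ascend (R : List Edge) (Γ : List (ℕ × Fml)) (u : ℕ) : List Line :=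
  walk R Γ ((pathTo R u).reverse.map Edge.flip)

section Primrec

variable {α : Type} [Primcodable α]

@[fun_prop]
theorem primrec_extend {D : α → Deriv NRule NSeq} {l : α → List Line} (hD : Primrec D)
    (hl : Primrec l) : Primrec fun a => extend (D a) (l a) := by
  unfold extend
  fun_prop

@[fun_prop]
theorem primrec_disp {d : α → Dia} (hd : Primrec d) : Primrec fun a => disp (d a) :=
  (Primrec.dom_finite disp).comp hd

@[fun_prop]
theorem primrec_pathTo {R : α → List Edge} {u : α → ℕ} (hR : Primrec R) (hu : Primrec u) :
    Primrec fun a => pathTo (R a) (u a) := by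
  unfold pathTo
  fun_prop

@[fun_prop]
theorem primrec_walk {R : α → List Edge} {Γ : α → List (ℕ × Fml)} {es : α → List Edge}
    (hR : Primrec R) (hΓ : Primrec Γ) (hes : Primrec es) :
    Primrec fun a => walk (R a) (Γ a) (es a) := by
  unfold walk
  fun_prop

@[fun_prop]
theorem primrec_descend {R : α → List Edge} {Γ : α → List (ℕ × Fml)} {u : α → ℕ}
    (hR : Primrec R) (hΓ : Primrec Γ) (hu : Primrec u) :
    Primrec fun a => descend (R a) (Γ a) (u a) := by
  unfold descend
  fun_prop

@[fun_prop]
theorem primrec_ascend {R : α → List Edge} {Γ : α → List (ℕ × Fml)} {u : α → ℕ}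
    (hR : Primrec R) (hΓ : Primrec Γ) (hu : Primrec u) :
    Primrec fun a => ascend (R a) (Γ a) (u a) := by
  unfold ascend
  fun_prop

end Primrec

/-! ### Scripts: inferences that move a sequent along a relational atom -/

/-- An instruction of a script; `N_u` is the nested sequent read off at `u` and `Y` any nested sequent.
`.inl (r, u, a, b)` is one inference, by the rule `r`, with conclusion `a{Y}, b{N_u}`.
`.inr ((d, u, v), a)` absorbs the nesting in `N_u, ⋆{a{Y}}` into the tree, which gives
`N_v, a{Y}`; here `⋆` belongs to `d`. -/
abbrev Instr : Type := (NRule × ℕ × List Dia × List Dia) ⊕ (Edge × List Dia)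

/-- The same instruction for the nested sequent `w{Y}` in the place of `Y`. -/
def Instr.weave (w : List Dia) (i : Instr) : Instr :=
  Sum.elim (fun l => .inl (l.1, l.2.1, l.2.2.1 ++ w, l.2.2.2)) (fun m => .inr (m.1, m.2 ++ w)) i

/-- The tree without an edge. -/
def cut (R : List Edge) (e : Edge) : List Edge := R.filter fun f => f ≠ e ∧ f ≠ e.flip

/-- The inferences from `N_u, ⋆{Y}` to `N_v, Y` for an edge `(d, u, v)` of the tree, where
`N_u = M, ⋆{K}` and `N_v = K, ⋆'{M}`: the two nestings `⋆{K}` and `⋆{Y}` of `M` are weakened to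
`⋆{Y, K}` and contracted. -/
def mergeLines (R : List Edge) (Δ : List (ℕ × NSeq)) (e : Edge) (Y : NSeq) : List Line :=
  let N := nestedAt R e.2.1 Δ
  let M := nestedAt (cut R e) e.2.1 Δ
  let K := nestedAt (cut R e) e.2.2 Δ
  let Z := NSeq.nest e.1 (.comma Y K)
  [(disp e.1, .comma (.nest e.1.dual N) Y),
    (.wk, .comma (.comma (.nest e.1.dual N) Y) K),
    (disp e.1.dual, .comma Z N),
    (disp e.1, .comma (.nest e.1.dual (.comma M Z)) K),
    (.wk, .comma (.comma (.nest e.1.dual (.comma M Z)) K) Y),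
    (disp e.1.dual, .comma Z (.comma M Z)),
    (.ctr, .comma M Z),
    (disp e.1, .comma (.nest e.1.dual M) (.comma Y K))]

/-- The inferences that an instruction stands for. -/
def Instr.lines (R : List Edge) (Δ : List (ℕ × NSeq)) (Y : NSeq) (i : Instr) : List Line :=
  Sum.elim
    (fun l => [(l.1, NSeq.comma (.nests l.2.2.1 Y) (.nests l.2.2.2 (nestedAt R l.2.1 Δ)))])
    (fun m => mergeLines R Δ m.1 (.nests m.2 Y)) i

/-- A directed relational atom with a script that leads from `N_u, ⋆{Y}` to `N_v, Y`. -/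
abbrev Entry : Type := Edge × List Instr

/-- An edge of the tree in both directions, with its scripts. -/
def edgeEntries (e : Edge) : List Entry := [(e, [.inr (e, [])]), (e.flip, [.inr (e.flip, [])])]

/-- The chains of entries that spell the word `w`, from the vertices in `V`, as triples of the first
vertex `u`, the last vertex `v`, and a script that leads from `N_u, w{Y}` to `N_v, Y`. -/
def chains (T : List Entry) (V : List ℕ) (w : List Dia) : List (ℕ × ℕ × List Instr) :=
  w.foldl (fun cs d => cs.flatMap fun c =>
      (T.filter fun t => t.1.1 = d ∧ t.1.2.1 = c.2.1).map fun t =>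
        (c.1, t.1.2.2, c.2.2.map (Instr.weave [d]) ++ t.2))
    (V.map fun x => (x, x, []))

/-- The word of a chain that is read backwards. -/
def revWord (w : List Dia) : List Dia := (w.map Dia.dual).reverse

/-- Display inferences that turn `Y, w{N_u}` into `w'{Y}, N_u` for the reversed word `w'`. -/
def shift (u : ℕ) (w : List Dia) : List Instr :=
  (w.foldl (fun s d => (d.dual :: s.1, s.2.1.tail,
      s.2.2 ++ [.inl (disp d, u, d.dual :: s.1, s.2.1.tail)]))
    (([], w, []) : List Dia × List Dia × List Instr)).2.2

/-- The path rule for `F`, from `N_u, ⋆{Y}` to `N_u, w{Y}`. -/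
def pathForth (F : PathAxiom) (u : ℕ) : List Instr := [.inl (.path F, u, F.ant, [])]

/-- The path rule for `F`, applied from the other end: from `N_u, ⋆'{Y}` to `N_u, w'{Y}`. -/
def pathBack (F : PathAxiom) (u : ℕ) : List Instr :=
  .inl (disp F.con.dual, u, [], [F.con]) :: .inl (.path F, u, [], F.ant) :: shift u F.ant

/-- The entries for the atoms that the labeled path rule for `F` can add, in both directions. -/
def pathEntries (F : PathAxiom) (T : List Entry) (V : List ℕ) : List Entry :=
  (chains T V F.ant).map (fun c => ((F.con, c.1, c.2.1), pathForth F c.1 ++ c.2.2)) ++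
    (chains T V (revWord F.ant)).map fun c =>
      ((F.con.dual, c.1, c.2.1), pathBack F c.1 ++ c.2.2)

section Primrec

variable {α : Type} [Primcodable α]

@[fun_prop]
theorem primrec_inl {β γ : Type} [Primcodable β] [Primcodable γ] {f : α → β} (hf : Primrec f) :
    Primrec fun a => (.inl (f a) : β ⊕ γ) :=
  Primrec.sumInl.comp hf

@[fun_prop]
theorem primrec_inr {β γ : Type} [Primcodable β] [Primcodable γ] {f : α → γ} (hf : Primrec f) :
    Primrec fun a => (.inr (f a) : β ⊕ γ) :=
  Primrec.sumInr.comp hf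

@[fun_prop]
theorem primrec_sumElim {β γ σ : Type} [Primcodable β] [Primcodable γ] [Primcodable σ]
    {f : α → β ⊕ γ} {g : α → β → σ} {h : α → γ → σ} (hf : Primrec f)
    (hg : Primrec fun p : α × β => g p.1 p.2) (hh : Primrec fun p : α × γ => h p.1 p.2) :
    Primrec fun a => Sum.elim (g a) (h a) (f a) :=
  (Primrec.sumCasesOn hf hg hh).of_eq fun a => by cases f a <;> rfl

@[fun_prop]
theorem primrec_weave {w : α → List Dia} {i : α → Instr} (hw : Primrec w) (hi : Primrec i) :
    Primrec fun a => (i a).weave (w a) := by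
  unfold Instr.weave
  fun_prop

@[fun_prop]
theorem primrec_cut {R : α → List Edge} {e : α → Edge} (hR : Primrec R) (he : Primrec e) :
    Primrec fun a => cut (R a) (e a) := by
  unfold cut
  fun_prop

@[fun_prop]
theorem primrec_lines {R : α → List Edge} {Δ : α → List (ℕ × NSeq)} {Y : α → NSeq} {i : α → Instr}
    (hR : Primrec R) (hΔ : Primrec Δ) (hY : Primrec Y) (hi : Primrec i) :
    Primrec fun a => (i a).lines (R a) (Δ a) (Y a) := by
  unfold Instr.lines mergeLines
  fun_prop

@[fun_prop]
theorem primrec_edgeEntries {e : α → Edge} (he : Primrec e) :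
    Primrec fun a => edgeEntries (e a) := by
  unfold edgeEntries
  fun_prop

@[fun_prop]
theorem primrec_chains {T : α → List Entry} {V : α → List ℕ} {w : α → List Dia} (hT : Primrec T)
    (hV : Primrec V) (hw : Primrec w) : Primrec fun a => chains (T a) (V a) (w a) := by
  unfold chains
  fun_prop

@[fun_prop]
theorem primrec_pathEntries {F : α → PathAxiom} {T : α → List Entry} {V : α → List ℕ}
    (hF : Primrec F) (hT : Primrec T) (hV : Primrec V) :
    Primrec fun a => pathEntries (F a) (T a) (V a) := by
  unfold pathEntries pathForth pathBack shift revWord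
  fun_prop

end Primrec

/-! ### The transformation -/

/-- What is known about the labeled sequent in a branch of the given derivation, seen from the root
of the derivation: the vertex `root` at which nested sequents are read off, a tree, labeled formulae,
and scripts for the relational atoms. -/
structure Env : Type where
  root : ℕ
  tree : List Edge
  fmls : List (ℕ × Fml)
  paths : List Entry

namespace Env

/-- Environments as tuples. -/
def equiv : Env ≃ ℕ × List Edge × List (ℕ × Fml) × List Entry where
  toFun E := (E.root, E.tree, E.fmls, E.paths)
  invFun p := ⟨p.1, p.2.1, p.2.2.1, p.2.2.2⟩
  left_inv _ := rfl
  right_inv _ := rfl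

noncomputable instance : Primcodable Env := Primcodable.ofEquiv _ equiv

theorem primrec_equiv : Primrec equiv := Primrec.of_equiv

@[fun_prop]
theorem primrec_root : Primrec Env.root := Primrec.fst.comp primrec_equiv

@[fun_prop]
theorem primrec_tree : Primrec Env.tree :=
  (by fun_prop : Primrec fun p : ℕ × List Edge × List (ℕ × Fml) × List Entry => p.2.1).comp
    primrec_equiv

@[fun_prop]
theorem primrec_fmls : Primrec Env.fmls :=
  (by fun_prop : Primrec fun p : ℕ × List Edge × List (ℕ × Fml) × List Entry => p.2.2.1).comp
    primrec_equiv

@[fun_prop]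
theorem primrec_paths : Primrec Env.paths :=
  (by fun_prop : Primrec fun p : ℕ × List Edge × List (ℕ × Fml) × List Entry => p.2.2.2).comp
    primrec_equiv

@[fun_prop]
theorem primrec_mk {α : Type} [Primcodable α] {r : α → ℕ} {R : α → List Edge}
    {Γ : α → List (ℕ × Fml)} {T : α → List Entry} (hr : Primrec r) (hR : Primrec R)
    (hΓ : Primrec Γ) (hT : Primrec T) : Primrec fun a => Env.mk (r a) (R a) (Γ a) (T a) :=
  (Primrec.of_equiv_symm (e := equiv)).comp (f := equiv.symm)
    (g := fun a => (r a, R a, Γ a, T a)) (by fun_prop)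

end Env

/-- The vertices of a tree. -/
def verts (r : ℕ) (R : List Edge) : List ℕ := r :: R.map fun e => e.2.2

/-- The nested sequent that belongs to an environment. -/
def Env.seq (E : Env) : NSeq := view E.tree E.fmls E.root

/-- The box that belongs to a diamond. -/
def boxTag (d : Dia) : ℕ := if d = .white then 4 else 6

/-- The tag of the formulae with the given diamond outermost. -/
def diaTag (d : Dia) : ℕ := if d = .white then 5 else 7

/-- The rule that introduces the box of a diamond. -/
def boxRule (d : Dia) : NRule := if d = .white then .box else .bbox

/-- The rule that introduces a diamond. -/
def diaRule (d : Dia) : NRule := if d = .white then .dia else .bdia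

/-! Below, `s` is the conclusion and `t` (or `t₁` and `t₂`) the premise of an inference of the given
derivation, and `E` is the environment at its conclusion. A function `...Pick` recovers the active
parts of the inference, `...Env` is the environment at the premise, and `...Lines` are the inferences
that lead from the nested sequent of the latter to that of the former. An inference does not record
which formula is principal, and several choices may fit its sequents; every choice that passes the
tests of the search serves, since the environment may contain more formulae and scripts than the
labeled sequent requires. -/

/-- A propositional variable at a label at which its complement occurs as well. -/
def idPick (E : Env) : ℕ × Fml :=
  (E.fmls.filter fun a => a.2.tag = 0 ∧ (a.1, a.2.compl) ∈ E.fmls).headI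

/-- The axiom, followed by contractions with the formulae in the environment. -/
def idDeriv (E : Env) : Deriv NRule NSeq :=
  let a := idPick E
  let N := view E.tree E.fmls a.1
  extend (.node₀ .id (.comma N (.comma (.fml a.2) (.fml a.2.compl))))
    ((.ctr, .comma N (.fml a.2)) :: (.ctr, N) :: ascend E.tree E.fmls a.1)

/-- The principal formula. -/
def orPick (t : LSeq) (E : Env) : ℕ × Fml :=
  (E.fmls.filter fun a => a.2.tag = 3 ∧
    t.fml ⊆ (a.1, a.2.left) :: (a.1, a.2.right) :: E.fmls).headI

def orEnv (t : LSeq) (E : Env) : Env :=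
  let a := orPick t E
  ⟨E.root, E.tree, (a.1, a.2.left) :: (a.1, a.2.right) :: E.fmls, E.paths⟩

def orLines (t : LSeq) (E : Env) : List Line :=
  let a := orPick t E
  descend E.tree (orEnv t E).fmls a.1 ++ (.or, .comma (view E.tree E.fmls a.1) (.fml a.2)) ::
    (.ctr, view E.tree E.fmls a.1) :: ascend E.tree E.fmls a.1

/-- The principal formula. -/
def andPick (t₁ t₂ : LSeq) (E : Env) : ℕ × Fml :=
  (E.fmls.filter fun a => a.2.tag = 2 ∧ t₁.fml ⊆ (a.1, a.2.left) :: E.fmls ∧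
    t₂.fml ⊆ (a.1, a.2.right) :: E.fmls).headI

def andEnv₁ (t₁ t₂ : LSeq) (E : Env) : Env :=
  let a := andPick t₁ t₂ E
  ⟨E.root, E.tree, (a.1, a.2.left) :: E.fmls, E.paths⟩

def andEnv₂ (t₁ t₂ : LSeq) (E : Env) : Env :=
  let a := andPick t₁ t₂ E
  ⟨E.root, E.tree, (a.1, a.2.right) :: E.fmls, E.paths⟩

/-- The combination of derivations for the two premises. -/
def andDeriv (t₁ t₂ : LSeq) (E : Env) (D₁ D₂ : Deriv NRule NSeq) : Deriv NRule NSeq :=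
  let a := andPick t₁ t₂ E
  let N := view E.tree E.fmls a.1
  extend (.node₂ .and (.comma N (.fml a.2))
      (extend D₁ (descend E.tree (andEnv₁ t₁ t₂ E).fmls a.1))
      (extend D₂ (descend E.tree (andEnv₂ t₁ t₂ E).fmls a.1)))
    ((.ctr, N) :: ascend E.tree E.fmls a.1)

/-- The principal formula together with the eigenvariable. -/
def boxPick (d : Dia) (s t : LSeq) (E : Env) : (ℕ × Fml) × ℕ :=
  (E.fmls.flatMap fun a => ((t.rel.map fun e => if d = .white then e.2 else e.1).filter fun y =>
      a.2.tag = boxTag d ∧ t.fml ⊆ (y, a.2.left) :: E.fmls ∧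
        t.rel ⊆ (if d = .white then (a.1, y) else (y, a.1)) :: s.rel ∧
        y ∉ verts E.root E.tree ∧ y ∉ s.rel.map (fun e => e.1) ∧ y ∉ s.rel.map (fun e => e.2)).map
    fun y => (a, y)).headI

def boxEnv (d : Dia) (s t : LSeq) (E : Env) : Env :=
  let p := boxPick d s t E
  ⟨E.root, (d, p.1.1, p.2) :: E.tree, (p.2, p.1.2.left) :: E.fmls,
    E.paths ++ edgeEntries (d, p.1.1, p.2)⟩

def boxLines (d : Dia) (s t : LSeq) (E : Env) : List Line :=
  let a := (boxPick d s t E).1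
  descend (boxEnv d s t E).tree (boxEnv d s t E).fmls a.1 ++
    (boxRule d, .comma (view E.tree E.fmls a.1) (.fml a.2)) ::
    (.ctr, view E.tree E.fmls a.1) :: ascend E.tree E.fmls a.1

/-- The principal formula together with a script for the relational atom, from the label of the
active formula to that of the principal formula. -/
def diaPick (d : Dia) (t : LSeq) (E : Env) : (ℕ × Fml) × Entry :=
  (E.fmls.flatMap fun a => (E.paths.filter fun p => a.2.tag = diaTag d ∧ p.1.1 = d.dual ∧
      p.1.2.2 = a.1 ∧ t.fml ⊆ (p.1.2.1, a.2.left) :: E.fmls).map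
    fun p => (a, p)).headI

def diaEnv (d : Dia) (t : LSeq) (E : Env) : Env :=
  let p := diaPick d t E
  ⟨E.root, E.tree, (p.2.1.2.1, p.1.2.left) :: E.fmls, E.paths⟩

/-- The active formula is replaced by a nesting of the principal formula, which the script carries to
the right place. -/
def diaLines (d : Dia) (t : LSeq) (E : Env) : List Line :=
  let p := diaPick d t E
  let y := p.2.1.2.1
  let N := view E.tree (diaEnv d t E).fmls y
  let Z := view E.tree E.fmls y
  let C := NSeq.fml p.1.2
  descend E.tree (diaEnv d t E).fmls y ++
    ([(.wk, .comma N (.nest d.dual C)),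
      (disp d.dual, .comma (.nest d N) C),
      (diaRule d, .comma (.nest d Z) C),
      (disp d, .comma (.nest d.dual C) Z)] ++
    (p.2.2.flatMap (Instr.lines E.tree (E.fmls.map fun a => (a.1, .fml a.2)) C) ++
      (.ctr, view E.tree E.fmls p.1.1) :: ascend E.tree E.fmls p.1.1))

def pathEnv (F : PathAxiom) (E : Env) : Env :=
  ⟨E.root, E.tree, E.fmls, E.paths ++ pathEntries F E.paths (verts E.root E.tree)⟩

/-- The environment at the `k`-th premise of an inference. -/
def next (i : LRule × LSeq × List LSeq) (E : Env) (k : ℕ) : Env :=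
  if i.1.tag = 1 then orEnv i.2.2.headI E
  else if i.1.tag = 2 then
    if k = 0 then andEnv₁ (i.2.2.getD 0 default) (i.2.2.getD 1 default) E
    else andEnv₂ (i.2.2.getD 0 default) (i.2.2.getD 1 default) E
  else if i.1.tag = 3 then boxEnv .white i.2.1 i.2.2.headI E
  else if i.1.tag = 4 then diaEnv .white i.2.2.headI E
  else if i.1.tag = 5 then boxEnv .black i.2.1 i.2.2.headI E
  else if i.1.tag = 6 then diaEnv .black i.2.2.headI E
  else pathEnv i.1.scheme E

/-- The nested derivation for the conclusion of an inference, from those for its premises. -/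
def build (i : LRule × LSeq × List LSeq) (E : Env) (Ds : List (Deriv NRule NSeq)) :
    Deriv NRule NSeq :=
  if i.1.tag = 0 then idDeriv E
  else if i.1.tag = 1 then extend Ds.headI (orLines i.2.2.headI E)
  else if i.1.tag = 2 then
    andDeriv (i.2.2.getD 0 default) (i.2.2.getD 1 default) E (Ds.getD 0 default) (Ds.getD 1 default)
  else if i.1.tag = 3 then extend Ds.headI (boxLines .white i.2.1 i.2.2.headI E)
  else if i.1.tag = 4 then extend Ds.headI (diaLines .white i.2.2.headI E)
  else if i.1.tag = 5 then extend Ds.headI (boxLines .black i.2.1 i.2.2.headI E)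
  else if i.1.tag = 6 then extend Ds.headI (diaLines .black i.2.2.headI E)
  else Ds.headI

/-- Adds to a tree with root `r` the first edge that leads to a new vertex. -/
def growStep (Q : List (ℕ × ℕ)) (r : ℕ) (R : List Edge) : List Edge :=
  ((Q.flatMap fun e => [(.white, e.1, e.2), (.black, e.2, e.1)]).filter fun e : Edge =>
    e.2.1 ∈ verts r R ∧ e.2.2 ∉ verts r R).take 1 ++ R

/-- The given relational atoms as a tree with root `r`. -/
def grow (Q : List (ℕ × ℕ)) (r : ℕ) : List Edge := (growStep Q r)^[Q.length] []

/-- The environment for the end sequent. -/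
def init (S : LSeq) (x : ℕ) : Env :=
  ⟨x, grow S.rel x, S.fml, (grow S.rel x).flatMap edgeEntries⟩

/-- The nested derivation, read off at `x`, for a labeled derivation. -/
def translate (D : Deriv LRule LSeq) (x : ℕ) : Deriv NRule NSeq :=
  D.paramRec next build (init D.concl x)

section Primrec

variable {α : Type} [Primcodable α]

@[fun_prop]
theorem primrec_verts {r : α → ℕ} {R : α → List Edge} (hr : Primrec r) (hR : Primrec R) :
    Primrec fun a => verts (r a) (R a) := by
  unfold verts
  fun_prop

@[fun_prop]
theorem primrec_idPick {E : α → Env} (hE : Primrec E) : Primrec fun a => idPick (E a) := by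
  unfold idPick
  fun_prop

@[fun_prop]
theorem primrec_idDeriv {E : α → Env} (hE : Primrec E) : Primrec fun a => idDeriv (E a) := by
  unfold idDeriv
  fun_prop

@[fun_prop]
theorem primrec_orPick {t : α → LSeq} {E : α → Env} (ht : Primrec t) (hE : Primrec E) :
    Primrec fun a => orPick (t a) (E a) := by
  unfold orPick
  fun_prop

@[fun_prop]
theorem primrec_orEnv {t : α → LSeq} {E : α → Env} (ht : Primrec t) (hE : Primrec E) :
    Primrec fun a => orEnv (t a) (E a) := by
  unfold orEnv
  fun_prop

@[fun_prop]
theorem primrec_orLines {t : α → LSeq} {E : α → Env} (ht : Primrec t) (hE : Primrec E) :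
    Primrec fun a => orLines (t a) (E a) := by
  unfold orLines
  fun_prop

@[fun_prop]
theorem primrec_andPick {t₁ t₂ : α → LSeq} {E : α → Env} (ht₁ : Primrec t₁) (ht₂ : Primrec t₂)
    (hE : Primrec E) : Primrec fun a => andPick (t₁ a) (t₂ a) (E a) := by
  unfold andPick
  fun_prop

@[fun_prop]
theorem primrec_andEnv₁ {t₁ t₂ : α → LSeq} {E : α → Env} (ht₁ : Primrec t₁) (ht₂ : Primrec t₂)
    (hE : Primrec E) : Primrec fun a => andEnv₁ (t₁ a) (t₂ a) (E a) := by
  unfold andEnv₁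
  fun_prop

@[fun_prop]
theorem primrec_andEnv₂ {t₁ t₂ : α → LSeq} {E : α → Env} (ht₁ : Primrec t₁) (ht₂ : Primrec t₂)
    (hE : Primrec E) : Primrec fun a => andEnv₂ (t₁ a) (t₂ a) (E a) := by
  unfold andEnv₂
  fun_prop

@[fun_prop]
theorem primrec_andDeriv {t₁ t₂ : α → LSeq} {E : α → Env} {D₁ D₂ : α → Deriv NRule NSeq}
    (ht₁ : Primrec t₁) (ht₂ : Primrec t₂) (hE : Primrec E) (h₁ : Primrec D₁) (h₂ : Primrec D₂) :
    Primrec fun a => andDeriv (t₁ a) (t₂ a) (E a) (D₁ a) (D₂ a) := by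
  unfold andDeriv
  fun_prop

@[fun_prop]
theorem primrec_boxPick (d : Dia) {s t : α → LSeq} {E : α → Env} (hs : Primrec s)
    (ht : Primrec t) (hE : Primrec E) : Primrec fun a => boxPick d (s a) (t a) (E a) := by
  unfold boxPick
  fun_prop

@[fun_prop]
theorem primrec_boxEnv (d : Dia) {s t : α → LSeq} {E : α → Env} (hs : Primrec s)
    (ht : Primrec t) (hE : Primrec E) : Primrec fun a => boxEnv d (s a) (t a) (E a) := by
  unfold boxEnv
  fun_prop

@[fun_prop]
theorem primrec_boxLines (d : Dia) {s t : α → LSeq} {E : α → Env} (hs : Primrec s)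
    (ht : Primrec t) (hE : Primrec E) : Primrec fun a => boxLines d (s a) (t a) (E a) := by
  unfold boxLines
  fun_prop

@[fun_prop]
theorem primrec_diaPick (d : Dia) {t : α → LSeq} {E : α → Env} (ht : Primrec t)
    (hE : Primrec E) : Primrec fun a => diaPick d (t a) (E a) := by
  unfold diaPick
  fun_prop

@[fun_prop]
theorem primrec_diaEnv (d : Dia) {t : α → LSeq} {E : α → Env} (ht : Primrec t)
    (hE : Primrec E) : Primrec fun a => diaEnv d (t a) (E a) := by
  unfold diaEnv
  fun_prop

@[fun_prop]
theorem primrec_diaLines (d : Dia) {t : α → LSeq} {E : α → Env} (ht : Primrec t)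
    (hE : Primrec E) : Primrec fun a => diaLines d (t a) (E a) := by
  unfold diaLines
  fun_prop

@[fun_prop]
theorem primrec_pathEnv {F : α → PathAxiom} {E : α → Env} (hF : Primrec F) (hE : Primrec E) :
    Primrec fun a => pathEnv (F a) (E a) := by
  unfold pathEnv
  fun_prop

theorem primrec_next : Primrec fun p : ((LRule × LSeq × List LSeq) × Env) × ℕ =>
    next p.1.1 p.1.2 p.2 := by
  unfold next
  fun_prop

theorem primrec_build :
    Primrec fun p : ((LRule × LSeq × List LSeq) × Env) × List (Deriv NRule NSeq) =>
      build p.1.1 p.1.2 p.2 := by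
  unfold build
  fun_prop

@[fun_prop]
theorem primrec_grow {Q : α → List (ℕ × ℕ)} {r : α → ℕ} (hQ : Primrec Q) (hr : Primrec r) :
    Primrec fun a => grow (Q a) (r a) := by
  unfold grow
  refine primrec_iterate (g := fun a => growStep (Q a) (r a)) (by fun_prop) (by fun_prop) ?_
  unfold growStep
  fun_prop

theorem primrec_translate : Primrec fun p : Deriv LRule LSeq × ℕ => translate p.1 p.2 := by
  have h : Primrec fun p : Deriv LRule LSeq × ℕ => init p.1.concl p.2 := by
    unfold init
    fun_prop
  exact (Deriv.primrec_paramRec primrec_next primrec_build).comp Primrec.fst h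

end Primrec

/-! ### Nested sequents up to associativity and commutativity -/

instance NSeq.setoid : Setoid NSeq := ⟨NSeq.Eqv, .refl, .symm, .trans⟩

/-- Nested sequents up to the identification `NSeq.Eqv`; comma is the addition of a commutative
monoid. -/
def NQuot : Type := Quotient NSeq.setoid

/-- The class of a nested sequent. -/
def NSeq.cls (X : NSeq) : NQuot := Quotient.mk _ X

namespace NQuot

instance : Add NQuot := ⟨Quotient.map₂ NSeq.comma fun _ _ h _ _ h' => .comma_congr h h'⟩

instance : Zero NQuot := ⟨NSeq.empty.cls⟩

instance : AddCommMonoid NQuot where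
  add_assoc := by
    rintro ⟨X⟩ ⟨Y⟩ ⟨Z⟩
    exact Quotient.sound (.comma_assoc X Y Z)
  add_comm := by
    rintro ⟨X⟩ ⟨Y⟩
    exact Quotient.sound (.comma_comm X Y)
  zero_add := by
    rintro ⟨X⟩
    exact Quotient.sound ((NSeq.Eqv.comma_comm _ _).trans (.comma_empty X))
  add_zero := by
    rintro ⟨X⟩
    exact Quotient.sound (.comma_empty X)
  nsmul := nsmulRec

/-- The nesting that belongs to a diamond. -/
def nest (d : Dia) : NQuot → NQuot :=
  Quotient.map (NSeq.nest d) fun _ _ h => by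
    cases d
    exacts [.circ_congr h, .bull_congr h]

/-- Iterated nesting. -/
def nests (w : List Dia) (a : NQuot) : NQuot := w.foldr nest a

theorem exists_cls (a : NQuot) : ∃ X : NSeq, X.cls = a := Quotient.exists_rep a

@[simp]
theorem nests_nil (a : NQuot) : nests [] a = a := rfl

@[simp]
theorem nests_cons (d : Dia) (w : List Dia) (a : NQuot) :
    nests (d :: w) a = nest d (nests w a) := rfl

@[simp]
theorem nests_append (v w : List Dia) (a : NQuot) :
    nests (v ++ w) a = nests v (nests w a) := by
  simp [nests]

end NQuot

namespace NSeq

theorem cls_eq {X Y : NSeq} : X.cls = Y.cls ↔ Eqv X Y := Quotient.eq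

@[simp]
theorem cls_comma (X Y : NSeq) : (comma X Y).cls = X.cls + Y.cls := rfl

@[simp]
theorem cls_nest (d : Dia) (X : NSeq) : (nest d X).cls = .nest d X.cls := rfl

@[simp]
theorem cls_nests (w : List Dia) (X : NSeq) : (nests w X).cls = .nests w X.cls := by
  induction w with
  | nil => rfl
  | cons d w ih => exact congrArg (NQuot.nest d) ih

@[simp]
theorem cls_ofList (l : List NSeq) : (ofList l).cls = (l.map cls).sum := by
  induction l with
  | nil => rfl
  | cons X l ih =>
    change X.cls + (ofList l).cls = _
    rw [ih, List.map_cons, List.sum_cons]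

end NSeq

@[simp]
theorem Dia.dual_dual (d : Dia) : d.dual.dual = d := by cases d <;> rfl

@[simp]
theorem Edge.flip_flip (e : Edge) : e.flip.flip = e := by simp [Edge.flip]

/-! ### Derived unary inferences -/

/-- `D` is a derivation of the nested sequents in the class `a`. -/
def Der (P : Set PathAxiom) (D : Deriv NRule NSeq) (a : NQuot) : Prop :=
  D.Valid NSeq.Eqv (NInst P) ∧ D.concl.cls = a

section Rules

variable {P : Set PathAxiom} {D : Deriv NRule NSeq} {c : NQuot} {Y : NSeq}

theorem Der.node₁ {r : NRule} {X' Y' : NSeq} (hD : Der P D c) (h : NInst P r [X'] Y')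
    (hc : c = X'.cls) (hY : Y.cls = Y'.cls) : Der P (.node₁ r Y D) Y.cls :=
  ⟨⟨⟨[X'], Y', .cons (NSeq.cls_eq.1 (hD.2.trans hc)) .nil, NSeq.cls_eq.1 hY, h⟩, hD.1⟩, rfl⟩

theorem Der.disp (hD : Der P D c) {d : Dia} (a b : NQuot) (hc : c = a + .nest d b)
    (hY : Y.cls = .nest d.dual a + b) : Der P (.node₁ (disp d) Y D) Y.cls := by
  obtain ⟨X, rfl⟩ := a.exists_cls
  obtain ⟨Z, rfl⟩ := b.exists_cls
  cases d
  exacts [hD.node₁ (.rf X Z) hc hY, hD.node₁ (.rp X Z) hc hY]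

theorem Der.wk (hD : Der P D c) (b : NQuot) (hY : Y.cls = c + b) :
    Der P (.node₁ .wk Y D) Y.cls := by
  obtain ⟨Z, rfl⟩ := b.exists_cls
  obtain ⟨X, rfl⟩ := c.exists_cls
  exact hD.node₁ (.wk X Z) rfl hY

theorem Der.ctr (hD : Der P D c) (a b : NQuot) (hc : c = a + (b + b)) (hY : Y.cls = a + b) :
    Der P (.node₁ .ctr Y D) Y.cls := by
  obtain ⟨X, rfl⟩ := a.exists_cls
  obtain ⟨Z, rfl⟩ := b.exists_cls
  exact hD.node₁ (.ctr X Z) hc hY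

theorem Der.or (hD : Der P D c) (a : NQuot) (A B : Fml)
    (hc : c = a + ((NSeq.fml A).cls + (NSeq.fml B).cls))
    (hY : Y.cls = a + (NSeq.fml (.or A B)).cls) : Der P (.node₁ .or Y D) Y.cls := by
  obtain ⟨X, rfl⟩ := a.exists_cls
  exact hD.node₁ (.or X A B) hc hY

/-- The formula `□A` or `■A`. -/
def boxFml (d : Dia) (A : Fml) : Fml := if d = .white then .box A else .bbox A

/-- The formula `◇A` or `◆A`. -/
def diaFml (d : Dia) (A : Fml) : Fml := if d = .white then .dia A else .bdia A

theorem Der.box (hD : Der P D c) (d : Dia) (a : NQuot) (A : Fml)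
    (hc : c = a + .nest d (NSeq.fml A).cls)
    (hY : Y.cls = a + (NSeq.fml (boxFml d A)).cls) : Der P (.node₁ (boxRule d) Y D) Y.cls := by
  obtain ⟨X, rfl⟩ := a.exists_cls
  cases d
  exacts [hD.node₁ (.box X A) hc hY, hD.node₁ (.bbox X A) hc hY]

theorem Der.dia (hD : Der P D c) (d : Dia) (b : NQuot) (A : Fml)
    (hc : c = .nest d (b + (NSeq.fml A).cls) + (NSeq.fml (diaFml d A)).cls)
    (hY : Y.cls = .nest d b + (NSeq.fml (diaFml d A)).cls) :
    Der P (.node₁ (diaRule d) Y D) Y.cls := by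
  obtain ⟨Z, rfl⟩ := b.exists_cls
  rw [← zero_add (NQuot.nest d _), add_assoc] at hc hY
  cases d
  exacts [hD.node₁ (.dia .empty Z A) hc hY, hD.node₁ (.bdia .empty Z A) hc hY]

theorem Der.path (hD : Der P D c) {F : PathAxiom} (hF : F ∈ P) (a b : NQuot)
    (hc : c = a + .nest F.con b) (hY : Y.cls = a + .nests F.ant b) :
    Der P (.node₁ (.path F) Y D) Y.cls := by
  obtain ⟨X, rfl⟩ := a.exists_cls
  obtain ⟨Z, rfl⟩ := b.exists_cls
  refine hD.node₁ (.path F hF X Z) hc ?_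
  simpa using hY

@[simp]
theorem extend_nil (D : Deriv NRule NSeq) : extend D [] = D := rfl

@[simp]
theorem extend_cons (D : Deriv NRule NSeq) (a : Line) (l : List Line) :
    extend D (a :: l) = extend (.node₁ a.1 a.2 D) l := rfl

@[simp]
theorem extend_append (D : Deriv NRule NSeq) (l l' : List Line) :
    extend D (l ++ l') = extend (extend D l) l' := by
  simp [extend]

end Rules

/-! ### Reading off nested sequents from trees -/

/-- The list describes a tree with root `r`: every edge leads from a vertex of the rest of the list
to a new vertex. -/
def IsBuilt (r : ℕ) : List Edge → Prop
  | [] => True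
  | e :: R => e.2.1 ∈ verts r R ∧ e.2.2 ∉ verts r R ∧ IsBuilt r R

theorem mem_verts_cons {r x : ℕ} {e : Edge} {R : List Edge} :
    x ∈ verts r (e :: R) ↔ x = e.2.2 ∨ x ∈ verts r R := by
  simp only [verts, List.map_cons, List.mem_cons]
  tauto

theorem IsBuilt.mem_verts {r : ℕ} {R : List Edge} (h : IsBuilt r R) {e : Edge} (he : e ∈ R) :
    e.2.1 ∈ verts r R ∧ e.2.2 ∈ verts r R := by
  induction R with
  | nil => simp at he
  | cons f R ih =>
    rw [mem_verts_cons, mem_verts_cons]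
    rcases List.mem_cons.1 he with rfl | he
    · exact ⟨.inr h.1, .inl rfl⟩
    · exact ⟨.inr (ih h.2.2 he).1, .inr (ih h.2.2 he).2⟩

theorem cls_itemsAt (Δ : List (ℕ × NSeq)) (u : ℕ) :
    (itemsAt Δ u).cls = ((Δ.filter fun a => a.1 = u).map fun a => a.2.cls).sum := by
  simp [itemsAt, Function.comp_def]

/-- An item at the label at which the nested sequent is read off is one of its components. -/
theorem cls_nestedAt_insert (R : List Edge) : ∀ (u : ℕ) (X : NSeq) (Δ Δ' : List (ℕ × NSeq)),
    (nestedAt R u (Δ ++ (u, X) :: Δ')).cls = (nestedAt R u (Δ ++ Δ')).cls + X.cls := by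
  induction R with
  | nil =>
    intro u X Δ Δ'
    simp only [nestedAt, cls_itemsAt]
    simp
    abel
  | cons e R ih =>
    intro u X Δ Δ'
    by_cases h : u = e.2.2
    · subst h
      simp only [nestedAt, if_true, NSeq.cls_comma, cls_itemsAt, itemsAway]
      simp
      abel
    · simp only [nestedAt, if_neg h]
      have h1 : itemsAway (Δ ++ (u, X) :: Δ') e.2.2 =
          itemsAway Δ e.2.2 ++ (u, X) :: itemsAway Δ' e.2.2 := by simp [itemsAway, h]
      have h2 : itemsAt (Δ ++ (u, X) :: Δ') e.2.2 = itemsAt (Δ ++ Δ') e.2.2 := by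
        simp [itemsAt, h]
      have h3 : itemsAway (Δ ++ Δ') e.2.2 = itemsAway Δ e.2.2 ++ itemsAway Δ' e.2.2 := by
        simp [itemsAway]
      rw [h1, h2, h3, List.append_assoc, List.cons_append, ih, List.append_assoc]

theorem itemsAt_itemsAway {u c : ℕ} (h : u ≠ c) (Δ : List (ℕ × NSeq)) :
    itemsAt (itemsAway Δ c) u = itemsAt Δ u := by
  have : ∀ a : ℕ × NSeq, (decide (a.1 = u) && decide (a.1 ≠ c)) = decide (a.1 = u) := fun a => by
    by_cases ha : a.1 = u <;> simp [ha, h]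
  simp only [itemsAt, itemsAway, List.filter_filter, this]

theorem itemsAway_comm (u c : ℕ) (Δ : List (ℕ × NSeq)) :
    itemsAway (itemsAway Δ c) u = itemsAway (itemsAway Δ u) c := by
  simp only [itemsAway, List.filter_filter, Bool.and_comm]

/-- Items at labels outside of the tree are irrelevant. -/
theorem nestedAt_itemsAway {r c : ℕ} {R : List Edge} (hR : IsBuilt r R) (hc : c ∉ verts r R) :
    ∀ u ∈ verts r R, ∀ Δ, nestedAt R u (itemsAway Δ c) = nestedAt R u Δ := by
  induction R with
  | nil =>
    intro u hu Δ
    refine itemsAt_itemsAway ?_ Δ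
    rintro rfl
    exact hc hu
  | cons e R ih =>
    intro u hu Δ
    rw [mem_verts_cons, not_or] at hc
    rw [mem_verts_cons] at hu
    have h1 : e.2.1 ≠ c := fun h => hc.2 (h ▸ hR.1)
    by_cases h : u = e.2.2
    · simp only [nestedAt, if_pos h]
      rw [itemsAt_itemsAway (Ne.symm hc.1), itemsAway_comm, ih hR.2.2 hc.2 _ hR.1]
    · simp only [nestedAt, if_neg h]
      rw [itemsAt_itemsAway (Ne.symm hc.1), itemsAway_comm]
      have h2 : itemsAway (itemsAway Δ e.2.2) c ++ [(e.2.1, NSeq.nest e.1 (itemsAt Δ e.2.2))] =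
          itemsAway (itemsAway Δ e.2.2 ++ [(e.2.1, NSeq.nest e.1 (itemsAt Δ e.2.2))]) c := by
        simp [itemsAway, h1]
      rw [h2, ih hR.2.2 hc.2 _ (hu.resolve_left h)]

/-- A label outside of the tree is an isolated vertex. -/
theorem nestedAt_of_notMem {r c : ℕ} {R : List Edge} (hR : IsBuilt r R) (hc : c ∉ verts r R) :
    ∀ Δ, nestedAt R c Δ = itemsAt Δ c := by
  induction R with
  | nil => intro Δ; rfl
  | cons e R ih =>
    intro Δ
    rw [mem_verts_cons, not_or] at hc
    have h1 : e.2.1 ≠ c := fun h => hc.2 (h ▸ hR.1)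
    simp only [nestedAt, if_neg hc.1]
    rw [ih hR.2.2 hc.2, ← itemsAt_itemsAway hc.1 Δ]
    simp [itemsAt, h1]

theorem cut_flip (R : List Edge) (e : Edge) : cut R e.flip = cut R e := by
  simp only [cut, Edge.flip_flip, and_comm]

theorem cut_cons_self {r : ℕ} {e : Edge} {R : List Edge} (h : IsBuilt r (e :: R)) :
    cut (e :: R) e = R := by
  have h1 : ∀ f ∈ R, f ≠ e ∧ f ≠ e.flip := fun f hf =>
    ⟨fun hfe => h.2.1 (hfe ▸ (h.2.2.mem_verts hf).2),
      fun hfe => h.2.1 (by simpa [hfe, Edge.flip] using (h.2.2.mem_verts hf).1)⟩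
  simp only [cut]
  rw [List.filter_cons_of_neg (by simp), List.filter_eq_self]
  simpa using h1

theorem cut_cons_of_mem {r : ℕ} {e f : Edge} {R : List Edge} (h : IsBuilt r (f :: R))
    (he : e ∈ R) : cut (f :: R) e = f :: cut R e := by
  have h1 : f ≠ e ∧ f ≠ e.flip :=
    ⟨fun hfe => h.2.1 (hfe ▸ (h.2.2.mem_verts he).2),
      fun hfe => h.2.1 (by simpa [hfe, Edge.flip] using (h.2.2.mem_verts he).1)⟩
  simp [cut, h1]

/-- Removing an edge splits the tree into two parts, each of which is a component of what is read off
at the end of the edge in the other part. -/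
theorem cls_nestedAt_of_mem {r : ℕ} {R : List Edge} (hR : IsBuilt r R) {e : Edge} (he : e ∈ R) :
    ∀ Δ, (nestedAt R e.2.1 Δ).cls =
        (nestedAt (cut R e) e.2.1 Δ).cls + .nest e.1 (nestedAt (cut R e) e.2.2 Δ).cls ∧
      (nestedAt R e.2.2 Δ).cls =
        (nestedAt (cut R e) e.2.2 Δ).cls + .nest e.1.dual (nestedAt (cut R e) e.2.1 Δ).cls := by
  induction R with
  | nil => simp at he
  | cons f R ih =>
    intro Δ
    rcases List.mem_cons.1 he with rfl | he
    · have h1 : e.2.1 ≠ e.2.2 := fun h => hR.2.1 (h ▸ hR.1)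
      rw [cut_cons_self hR]
      simp only [nestedAt, if_neg h1, if_true, NSeq.cls_comma, NSeq.cls_nest]
      rw [nestedAt_of_notMem hR.2.2 hR.2.1, nestedAt_itemsAway hR.2.2 hR.2.1 _ hR.1]
      refine ⟨?_, rfl⟩
      have := cls_nestedAt_insert R e.2.1 (.nest e.1 (itemsAt Δ e.2.2)) (itemsAway Δ e.2.2) []
      rw [this, List.append_nil, nestedAt_itemsAway hR.2.2 hR.2.1 _ hR.1, NSeq.cls_nest]
    · have h1 : e.2.1 ≠ f.2.2 := fun h => hR.2.1 (h ▸ (hR.2.2.mem_verts he).1)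
      have h2 : e.2.2 ≠ f.2.2 := fun h => hR.2.1 (h ▸ (hR.2.2.mem_verts he).2)
      rw [cut_cons_of_mem hR he]
      simp only [nestedAt, if_neg h1, if_neg h2]
      exact ih hR.2.2 he _

/-- `e` is an edge of the tree, traversed in either direction. -/
def Adj (R : List Edge) (e : Edge) : Prop := e ∈ R ∨ e.flip ∈ R

theorem Adj.flip {R : List Edge} {e : Edge} (h : Adj R e) : Adj R e.flip := by
  rw [Adj, Edge.flip_flip]
  exact h.symm

theorem cls_nestedAt_of_adj {r : ℕ} {R : List Edge} (hR : IsBuilt r R) {e : Edge} (he : Adj R e)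
    (Δ : List (ℕ × NSeq)) : (nestedAt R e.2.1 Δ).cls =
      (nestedAt (cut R e) e.2.1 Δ).cls + .nest e.1 (nestedAt (cut R e) e.2.2 Δ).cls := by
  rcases he with he | he
  · exact (cls_nestedAt_of_mem hR he Δ).1
  · rw [← cut_flip]
    simpa [Edge.flip] using (cls_nestedAt_of_mem hR he Δ).2

theorem cls_nestedAt_of_adj' {r : ℕ} {R : List Edge} (hR : IsBuilt r R) {e : Edge} (he : Adj R e)
    (Δ : List (ℕ × NSeq)) : (nestedAt R e.2.2 Δ).cls =
      (nestedAt (cut R e) e.2.2 Δ).cls + .nest e.1.dual (nestedAt (cut R e) e.2.1 Δ).cls := by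
  have := cls_nestedAt_of_adj hR he.flip Δ
  rwa [cut_flip] at this

theorem cls_view_cons (R : List Edge) (Γ : List (ℕ × Fml)) (u : ℕ) (A : Fml) :
    (view R ((u, A) :: Γ) u).cls = (view R Γ u).cls + (NSeq.fml A).cls :=
  cls_nestedAt_insert R u (.fml A) [] _

theorem exists_cls_view {R : List Edge} {Γ : List (ℕ × Fml)} {u : ℕ} {A : Fml}
    (h : (u, A) ∈ Γ) : ∃ a, (view R Γ u).cls = a + (NSeq.fml A).cls := by
  obtain ⟨Γ₁, Γ₂, rfl⟩ := List.append_of_mem h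
  rw [view, List.map_append, List.map_cons]
  exact ⟨_, cls_nestedAt_insert R u (.fml A) _ _⟩

/-- A leaf with a single formula is a nesting at its parent. -/
theorem cls_view_leaf {r : ℕ} {R : List Edge} {Γ : List (ℕ × Fml)} {d : Dia} {x y : ℕ} {A : Fml}
    (hx : x ∈ verts r R) (hy : y ∉ verts r R) (hΓ : ∀ a ∈ Γ, a.1 ∈ verts r R) :
    (view ((d, x, y) :: R) ((y, A) :: Γ) x).cls =
      (view R Γ x).cls + .nest d (NSeq.fml A).cls := by
  have hxy : x ≠ y := fun h => hy (h ▸ hx)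
  have h1 : ∀ a ∈ Γ.map fun a => (a.1, NSeq.fml a.2), a.1 ≠ y := fun a ha h => by
    obtain ⟨b, hb, rfl⟩ := List.mem_map.1 ha
    exact hy (h ▸ hΓ b hb)
  simp only [view, nestedAt, if_neg hxy, List.map_cons]
  have h2 : itemsAway ((y, .fml A) :: Γ.map fun a => (a.1, .fml a.2)) y =
      Γ.map fun a => (a.1, NSeq.fml a.2) := by
    simp only [itemsAway]
    rw [List.filter_cons_of_neg (by simp), List.filter_eq_self]
    exact fun a ha => decide_eq_true (h1 a ha)
  have h3 : (itemsAt ((y, .fml A) :: Γ.map fun a => (a.1, .fml a.2)) y).cls =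
      (NSeq.fml A).cls := by
    rw [cls_itemsAt, List.filter_cons_of_pos (by simp), List.filter_eq_nil_iff.2]
    · simp
    · simpa only [decide_eq_true_eq] using h1
  rw [h2, cls_nestedAt_insert R x _ _ [], List.append_nil, NSeq.cls_nest, h3]

/-! ### Correctness of walks and scripts -/

/-- A sequence of consecutive edges from `u` to `v`, each traversed in either direction. -/
def IsWalk (R : List Edge) : ℕ → List Edge → ℕ → Prop
  | u, [], v => u = v
  | u, e :: es, v => e.2.1 = u ∧ Adj R e ∧ IsWalk R e.2.2 es v

theorem IsWalk.append {R : List Edge} {v w : ℕ} {es' : List Edge} (h' : IsWalk R v es' w) :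
    ∀ {es : List Edge} {u : ℕ}, IsWalk R u es v → IsWalk R u (es ++ es') w
  | [], _, h => by
    obtain rfl : _ = v := h
    exact h'
  | _ :: _, _, h => ⟨h.1, h.2.1, h'.append h.2.2⟩

theorem IsWalk.reverse {R : List Edge} {v : ℕ} : ∀ {es : List Edge} {u : ℕ}, IsWalk R u es v →
    IsWalk R v (es.reverse.map Edge.flip) u
  | [], _, h => Eq.symm h
  | e :: es, u, h => by
    rw [List.reverse_cons, List.map_append]
    exact IsWalk.append (show IsWalk R e.2.2 [e.flip] u from ⟨rfl, h.2.1.flip, h.1⟩) h.2.2.reverse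

theorem isWalk_pathTo {r u : ℕ} {R : List Edge} (hR : IsBuilt r R) (hu : u ∈ verts r R) :
    IsWalk R r (pathTo R u) u := by
  have key : ∀ (S : List Edge), S ⊆ R → IsBuilt r S → ∀ (v : ℕ) (es : List Edge), v ∈ verts r S →
      IsWalk R v es u → IsWalk R r ((S.foldl (fun s e =>
        if s.1 = e.2.2 then (e.2.1, e :: s.2) else s) ((v, es) : ℕ × List Edge)).2) u := by
    intro S
    induction S with
    | nil =>
      intro _ _ v es hv h
      obtain rfl : v = r := by simpa [verts] using hv
      exact h
    | cons e S ih =>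
      intro hS hb v es hv h
      have hS' := (List.cons_subset.1 hS)
      rw [List.foldl_cons]
      by_cases hve : v = e.2.2
      · rw [if_pos hve]
        exact ih hS'.2 hb.2.2 _ _ hb.1 ⟨rfl, .inl hS'.1, hve ▸ h⟩
      · rw [if_neg hve]
        exact ih hS'.2 hb.2.2 _ _ ((mem_verts_cons.1 hv).resolve_left hve) h
  exact key R (fun _ h => h) hR u [] hu rfl

section Walks

variable {P : Set PathAxiom} {r : ℕ} {R : List Edge}

theorem Der.walk (hR : IsBuilt r R) (Γ : List (ℕ × Fml)) {v : ℕ} : ∀ {es : List Edge} {u : ℕ}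
    {D : Deriv NRule NSeq}, IsWalk R u es v → Der P D (view R Γ u).cls →
      Der P (extend D (Tense.walk R Γ es)) (view R Γ v).cls
  | [], _, _, h, hD => by
    obtain rfl : _ = v := h
    exact hD
  | e :: es, u, D, h, hD => by
    obtain ⟨rfl, he, h⟩ := h
    have h1 := hD.disp (Y := view R Γ e.2.2) _ _ (cls_nestedAt_of_adj hR he _)
      ((cls_nestedAt_of_adj' hR he _).trans (add_comm _ _))
    exact (Der.walk hR Γ h h1 :)

theorem Der.descend (hR : IsBuilt r R) {Γ : List (ℕ × Fml)} {u : ℕ} (hu : u ∈ verts r R)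
    {D : Deriv NRule NSeq} (hD : Der P D (view R Γ r).cls) :
    Der P (extend D (descend R Γ u)) (view R Γ u).cls :=
  hD.walk hR Γ (isWalk_pathTo hR hu)

theorem Der.ascend (hR : IsBuilt r R) {Γ : List (ℕ × Fml)} {u : ℕ} (hu : u ∈ verts r R)
    {D : Deriv NRule NSeq} (hD : Der P D (view R Γ u).cls) :
    Der P (extend D (ascend R Γ u)) (view R Γ r).cls :=
  hD.walk hR Γ (isWalk_pathTo hR hu).reverse

/-- Contraction with a formula of the tree, after which the root is moved back. -/
theorem Der.ctr_ascend (hR : IsBuilt r R) {Γ : List (ℕ × Fml)} {u : ℕ} (hu : u ∈ verts r R)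
    {A : Fml} (hA : (u, A) ∈ Γ) {D : Deriv NRule NSeq}
    (hD : Der P D ((view R Γ u).cls + (NSeq.fml A).cls)) :
    Der P (extend D ((.ctr, view R Γ u) :: Tense.ascend R Γ u)) (view R Γ r).cls := by
  obtain ⟨a, ha⟩ := exists_cls_view (R := R) hA
  refine (hD.ctr a _ ?_ ha).ascend hR hu
  rw [ha, add_assoc]

theorem Der.mergeLines (hR : IsBuilt r R) {e : Edge} (he : Adj R e) (Δ : List (ℕ × NSeq))
    (Y : NSeq) {D : Deriv NRule NSeq}
    (hD : Der P D ((nestedAt R e.2.1 Δ).cls + .nest e.1 Y.cls)) :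
    Der P (extend D (mergeLines R Δ e Y)) ((nestedAt R e.2.2 Δ).cls + Y.cls) := by
  have hu := cls_nestedAt_of_adj hR he Δ
  have hv := cls_nestedAt_of_adj' hR he Δ
  simp only [Tense.mergeLines]
  generalize nestedAt R e.2.1 Δ = N at *
  generalize nestedAt R e.2.2 Δ = N' at *
  generalize nestedAt (cut R e) e.2.1 Δ = M at *
  generalize nestedAt (cut R e) e.2.2 Δ = K at *
  have h1 := hD.disp (Y := .comma (.nest e.1.dual N) Y) _ _ rfl (by simp)
  have h2 := h1.wk (Y := .comma (.comma (.nest e.1.dual N) Y) K) K.cls (by simp)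
  have h3 := h2.disp (d := e.1.dual) (Y := .comma (.nest e.1 (.comma Y K)) N)
    (Y.cls + K.cls) N.cls (by simp; abel) (by simp)
  have h4 := h3.disp (d := e.1)
    (Y := .comma (.nest e.1.dual (.comma M (.nest e.1 (.comma Y K)))) K)
    (M.cls + .nest e.1 (Y.cls + K.cls)) K.cls (by simp [hu]; abel) (by simp)
  have h5 := h4.wk
    (Y := .comma (.comma (.nest e.1.dual (.comma M (.nest e.1 (.comma Y K)))) K) Y)
    Y.cls (by simp)
  have h6 := h5.disp (d := e.1.dual)
    (Y := .comma (.nest e.1 (.comma Y K)) (.comma M (.nest e.1 (.comma Y K))))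
    (Y.cls + K.cls) (M.cls + .nest e.1 (Y.cls + K.cls)) (by simp; abel) (by simp)
  have h7 := h6.ctr (Y := .comma M (.nest e.1 (.comma Y K))) M.cls
    (.nest e.1 (Y.cls + K.cls)) (by simp; abel) (by simp)
  have h8 := h7.disp (d := e.1) (Y := .comma (.nest e.1.dual M) (.comma Y K))
    M.cls (Y.cls + K.cls) (by simp) (by simp)
  have h9 : N'.cls + Y.cls = (NSeq.comma (.nest e.1.dual M) (.comma Y K)).cls := by
    simp [hv]; abel
  rw [h9]
  exact h8

end Walks

/-- The script leads from `N_u, w{Y}` to `N_v, Y`, in the given tree and in every larger one. -/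
def Leads (P : Set PathAxiom) (r : ℕ) (R : List Edge) (u : ℕ) (w : List Dia) (v : ℕ)
    (s : List Instr) : Prop :=
  ∀ R', IsBuilt r R' → R ⊆ R' → ∀ (Δ : List (ℕ × NSeq)) (Y : NSeq) (D : Deriv NRule NSeq),
    Der P D ((nestedAt R' u Δ).cls + .nests w Y.cls) →
      Der P (extend D (s.flatMap (Instr.lines R' Δ Y))) ((nestedAt R' v Δ).cls + Y.cls)

theorem Instr.lines_weave (R : List Edge) (Δ : List (ℕ × NSeq)) (Y : NSeq) (w : List Dia)
    (i : Instr) : (i.weave w).lines R Δ Y = i.lines R Δ (.nests w Y) := by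
  rcases i with i | i <;> simp [Instr.weave, Instr.lines, NSeq.nests]

section Scripts

variable {P : Set PathAxiom} {r : ℕ} {R : List Edge}

theorem Leads.mono {R' : List Edge} {u v : ℕ} {w : List Dia} {s : List Instr}
    (h : Leads P r R u w v s) (hR : R ⊆ R') : Leads P r R' u w v s :=
  fun R'' h1 h2 => h R'' h1 fun _ he => h2 (hR he)

theorem Leads.nil (u : ℕ) : Leads P r R u [] u [] := fun _ _ _ _ _ _ hD => hD

theorem Leads.append {u v x : ℕ} {w w' : List Dia} {s s' : List Instr} (h : Leads P r R u w v s)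
    (h' : Leads P r R v w' x s') :
    Leads P r R u (w ++ w') x (s.map (Instr.weave w') ++ s') := by
  intro R' hR' hRR Δ Y D hD
  rw [List.flatMap_append, extend_append, List.flatMap_map]
  simp only [Instr.lines_weave]
  refine h' R' hR' hRR Δ Y _ ?_
  have := h R' hR' hRR Δ (.nests w' Y) D (by simpa using hD)
  simpa using this

theorem leads_edge {e : Edge} (he : Adj R e) : Leads P r R e.2.1 [e.1] e.2.2 [.inr (e, [])] := by
  intro R' hR' hRR Δ Y D hD
  have he' : Adj R' e := he.imp (hRR ·) (hRR ·)
  simpa [Instr.lines, NSeq.nests] using Der.mergeLines hR' he' Δ Y hD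

theorem Leads.pathForth {F : PathAxiom} (hF : F ∈ P) {u v : ℕ} {s : List Instr}
    (h : Leads P r R u F.ant v s) : Leads P r R u [F.con] v (pathForth F u ++ s) := by
  intro R' hR' hRR Δ Y D hD
  rw [List.flatMap_append, extend_append]
  refine h R' hR' hRR Δ Y _ ?_
  have := hD.path (Y := .comma (.nests F.ant Y) (nestedAt R' u Δ)) hF
    (nestedAt R' u Δ).cls Y.cls rfl (by simp [add_comm])
  rw [NSeq.cls_comma, NSeq.cls_nests, add_comm] at this
  exact this

theorem shift_eq (u : ℕ) (w : List Dia) : ∀ (a : List Dia) (acc : List Instr),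
    (w.foldl (fun s d => (d.dual :: s.1, s.2.1.tail,
      s.2.2 ++ [.inl (disp d, u, d.dual :: s.1, s.2.1.tail)]))
      ((a, w, acc) : List Dia × List Dia × List Instr)).2.2 =
    acc ++ (w.foldl (fun s d => (d.dual :: s.1, s.2.1.tail,
      s.2.2 ++ [.inl (disp d, u, d.dual :: s.1, s.2.1.tail)]))
      ((a, w, []) : List Dia × List Dia × List Instr)).2.2 := by
  induction w with
  | nil => intro a acc; simp
  | cons d w ih =>
    intro a acc
    simp only [List.foldl_cons, List.tail_cons, List.nil_append]
    rw [ih, ih _ [_], List.append_assoc]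

theorem Der.shift (Δ : List (ℕ × NSeq)) (Y : NSeq) (u : ℕ) (w : List Dia) :
    ∀ {D : Deriv NRule NSeq}, Der P D (Y.cls + .nests w (nestedAt R u Δ).cls) →
      Der P (extend D ((Tense.shift u w).flatMap (Instr.lines R Δ Y)))
        (.nests (revWord w) Y.cls + (nestedAt R u Δ).cls) := by
  have key : ∀ (w a : List Dia) (D : Deriv NRule NSeq),
      Der P D (.nests a Y.cls + .nests w (nestedAt R u Δ).cls) →
      Der P (extend D (((w.foldl (fun s d => (d.dual :: s.1, s.2.1.tail,
        s.2.2 ++ [.inl (Tense.disp d, u, d.dual :: s.1, s.2.1.tail)]))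
        ((a, w, []) : List Dia × List Dia × List Instr)).2.2).flatMap (Instr.lines R Δ Y)))
        (.nests (revWord w ++ a) Y.cls + (nestedAt R u Δ).cls) := by
    intro w
    induction w with
    | nil => intro a D hD; exact hD
    | cons d w ih =>
      intro a D hD
      simp only [List.foldl_cons, List.tail_cons, List.nil_append]
      rw [shift_eq, List.flatMap_append, extend_append]
      have h1 := hD.disp (d := d) (Y := .comma (.nests (d.dual :: a) Y) (.nests w (nestedAt R u Δ)))
        (.nests a Y.cls) (.nests w (nestedAt R u Δ).cls) rfl (by simp)
      have h2 := ih (d.dual :: a) _ (by simpa [-NQuot.nests_cons] using h1)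
      simpa [Instr.lines, revWord] using h2
  intro D hD
  simpa [Tense.shift] using key w [] D hD

theorem Leads.pathBack {F : PathAxiom} (hF : F ∈ P) {u v : ℕ} {s : List Instr}
    (h : Leads P r R u (revWord F.ant) v s) :
    Leads P r R u [F.con.dual] v (pathBack F u ++ s) := by
  intro R' hR' hRR Δ Y D hD
  rw [List.flatMap_append, extend_append]
  refine h R' hR' hRR Δ Y _ ?_
  have h1 := hD.disp (Y := .comma Y (.nest F.con (nestedAt R' u Δ)))
    (nestedAt R' u Δ).cls Y.cls rfl (by simp [add_comm])
  have h2 := h1.path (Y := .comma Y (.nests F.ant (nestedAt R' u Δ))) hF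
    Y.cls (nestedAt R' u Δ).cls (by simp) (by simp)
  rw [NSeq.cls_comma, NSeq.cls_nests] at h2
  have h3 := Der.shift Δ Y u F.ant h2
  rw [add_comm]
  exact h3

end Scripts

/-- The directed atom has a script. -/
def Linked (T : List Entry) (d : Dia) (u v : ℕ) : Prop := ∃ s, ((d, u, v), s) ∈ T

/-- There is a chain of directed atoms with scripts that spells the word. -/
def Spells (T : List Entry) : List Dia → ℕ → ℕ → Prop
  | [], x, y => x = y
  | d :: w, x, y => ∃ z, Linked T d x z ∧ Spells T w z y

theorem spells_append {T : List Entry} {w w' : List Dia} {x y : ℕ} :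
    Spells T (w ++ w') x y ↔ ∃ z, Spells T w x z ∧ Spells T w' z y := by
  induction w generalizing x with
  | nil => simp [Spells]
  | cons d w ih =>
    simp only [List.cons_append, Spells, ih]
    constructor
    · rintro ⟨z, h, z', h', h''⟩
      exact ⟨z', ⟨z, h, h'⟩, h''⟩
    · rintro ⟨z', ⟨z, h, h'⟩, h''⟩
      exact ⟨z, h, z', h', h''⟩

theorem Spells.reverse {T : List Entry} (hT : ∀ d u v, Linked T d u v → Linked T d.dual v u)
    {w : List Dia} {x y : ℕ} (h : Spells T w x y) : Spells T (revWord w) y x := by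
  induction w generalizing x with
  | nil => exact Eq.symm h
  | cons d w ih =>
    obtain ⟨z, h, h'⟩ := h
    have h1 : revWord (d :: w) = revWord w ++ [d.dual] := by simp [revWord]
    rw [h1, spells_append]
    exact ⟨z, ih h', x, hT _ _ _ h, rfl⟩

theorem chains_concat (T : List Entry) (V : List ℕ) (w : List Dia) (d : Dia) :
    chains T V (w ++ [d]) = (chains T V w).flatMap fun c =>
      (T.filter fun t => t.1.1 = d ∧ t.1.2.1 = c.2.1).map fun t =>
        (c.1, t.1.2.2, c.2.2.map (Instr.weave [d]) ++ t.2) := by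
  simp [chains]

theorem exists_mem_chains {T : List Entry} {V : List ℕ} {w : List Dia} {x y : ℕ} (hx : x ∈ V)
    (h : Spells T w x y) : ∃ s, (x, y, s) ∈ chains T V w := by
  induction w using List.reverseRecOn generalizing y with
  | nil =>
    obtain rfl : x = y := h
    exact ⟨[], by simp [chains, hx]⟩
  | append_singleton w d ih =>
    obtain ⟨z, h₁, z', ⟨s', hs'⟩, h₂⟩ := spells_append.1 h
    obtain rfl : z' = y := h₂
    obtain ⟨s, hs⟩ := ih h₁
    refine ⟨s.map (Instr.weave [d]) ++ s', ?_⟩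
    rw [chains_concat, List.mem_flatMap]
    exact ⟨_, hs, List.mem_map.2 ⟨((d, z, z'), s'), by simp [hs'], rfl⟩⟩

/-- All entries are correct and stay inside of the tree. -/
def Sound (P : Set PathAxiom) (r : ℕ) (R : List Edge) (T : List Entry) : Prop :=
  ∀ t ∈ T, t.1.2.1 ∈ verts r R ∧ t.1.2.2 ∈ verts r R ∧
    Leads P r R t.1.2.1 [t.1.1] t.1.2.2 t.2

theorem leads_of_mem_chains {P : Set PathAxiom} {r : ℕ} {R : List Edge} {T : List Entry}
    (hT : Sound P r R T) {w : List Dia} :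
    ∀ c ∈ chains T (verts r R) w, c.1 ∈ verts r R ∧ c.2.1 ∈ verts r R ∧
      Leads P r R c.1 w c.2.1 c.2.2 := by
  induction w using List.reverseRecOn with
  | nil =>
    intro c hc
    obtain ⟨x, hx, rfl⟩ := List.mem_map.1 hc
    exact ⟨hx, hx, .nil x⟩
  | append_singleton w d ih =>
    intro c hc
    rw [chains_concat, List.mem_flatMap] at hc
    obtain ⟨c', hc', hc⟩ := hc
    obtain ⟨t, ht, rfl⟩ := List.mem_map.1 hc
    simp only [List.mem_filter, decide_eq_true_eq] at ht
    obtain ⟨ht, rfl, htc⟩ := ht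
    obtain ⟨h1, -, h2⟩ := ih c' hc'
    obtain ⟨-, h3, h4⟩ := hT t ht
    exact ⟨h1, h3, h2.append (htc ▸ h4)⟩

theorem Sound.pathEntries {P : Set PathAxiom} {r : ℕ} {R : List Edge} {T : List Entry}
    (hT : Sound P r R T) {F : PathAxiom} (hF : F ∈ P) :
    Sound P r R (pathEntries F T (verts r R)) := by
  intro t ht
  rcases List.mem_append.1 ht with ht | ht <;> obtain ⟨c, hc, rfl⟩ := List.mem_map.1 ht <;>
    obtain ⟨h1, h2, h3⟩ := leads_of_mem_chains hT c hc
  · exact ⟨h1, h2, h3.pathForth hF⟩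
  · exact ⟨h1, h2, h3.pathBack hF⟩

theorem linked_pathEntries {T : List Entry} (hT : ∀ d u v, Linked T d u v → Linked T d.dual v u)
    {V : List ℕ} {F : PathAxiom} {x y : ℕ} (hx : x ∈ V) (hy : y ∈ V) (h : Spells T F.ant x y) :
    Linked (pathEntries F T V) F.con x y ∧ Linked (pathEntries F T V) F.con.dual y x := by
  obtain ⟨s, hs⟩ := exists_mem_chains hx h
  obtain ⟨s', hs'⟩ := exists_mem_chains hy (h.reverse hT)
  exact ⟨⟨_, List.mem_append_left _ (List.mem_map.2 ⟨_, hs, rfl⟩)⟩,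
    ⟨_, List.mem_append_right _ (List.mem_map.2 ⟨_, hs', rfl⟩)⟩⟩

theorem Sound.append {P : Set PathAxiom} {r : ℕ} {R : List Edge} {T T' : List Entry}
    (h : Sound P r R T) (h' : Sound P r R T') : Sound P r R (T ++ T') := fun t ht =>
  (List.mem_append.1 ht).elim (h t) (h' t)

theorem sound_edgeEntries {P : Set PathAxiom} {r : ℕ} {R : List Edge} (hR : IsBuilt r R) {e : Edge}
    (he : e ∈ R) : Sound P r R (edgeEntries e) := by
  intro t ht
  have h := hR.mem_verts he
  simp only [edgeEntries, List.mem_cons, List.not_mem_nil, or_false] at ht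
  rcases ht with rfl | rfl
  · exact ⟨h.1, h.2, leads_edge (.inl he)⟩
  · exact ⟨h.2, h.1, leads_edge (Adj.flip (.inl he))⟩

/-! ### The invariant of the transformation -/

/-- The environment `E` describes the labeled sequent `S`. Relational atoms without a vertex of the
tree can be present: an axiom `A → ⟨?⟩A` permits the addition of an atom `Rzz` for any new `z`. They
are never connected to the rest and need no script. -/
structure Inv (P : Set PathAxiom) (S : LSeq) (E : Env) : Prop where
  built : IsBuilt E.root E.tree
  verts_sub : ∀ x ∈ verts E.root E.tree, x ∈ S.labels
  fml_sub : S.fml ⊆ E.fmls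
  fml_mem : ∀ a ∈ E.fmls, a.1 ∈ verts E.root E.tree
  sound : Sound P E.root E.tree E.paths
  symm : ∀ d u v, Linked E.paths d u v → Linked E.paths d.dual v u
  linked : ∀ e ∈ S.rel, e.1 ∈ verts E.root E.tree ∨ e.2 ∈ verts E.root E.tree →
    Linked E.paths .white e.1 e.2

theorem headI_filter {α : Type} [Inhabited α] {l : List α} {p : α → Prop} [DecidablePred p]
    (h : ∃ a ∈ l, p a) :
    (l.filter fun a => p a).headI ∈ l ∧ p (l.filter fun a => p a).headI := by
  obtain ⟨a, ha, hp⟩ := h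
  have h1 : a ∈ l.filter fun a => p a := List.mem_filter.2 ⟨ha, decide_eq_true hp⟩
  have h2 : (l.filter fun a => p a).headI ∈ l.filter fun a => p a := by
    cases hl : l.filter fun a => p a with
    | nil => simp [hl] at h1
    | cons b l' => exact List.mem_cons_self
  rw [List.mem_filter] at h2
  exact ⟨h2.1, of_decide_eq_true h2.2⟩

theorem headI_mem {α : Type} [Inhabited α] {l : List α} {a : α} (h : a ∈ l) : l.headI ∈ l := by
  cases l with
  | nil => simp at h
  | cons b l => exact List.mem_cons_self

theorem LSeq.labels_mono {S T : LSeq} (hr : S.rel ⊆ T.rel) (hf : ∀ a ∈ S.fml, a.1 ∈ T.labels) :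
    S.labels ⊆ T.labels := by
  rintro x (⟨y, h⟩ | ⟨A, h⟩)
  · exact .inl ⟨y, h.imp (hr ·) (hr ·)⟩
  · exact hf _ h

theorem LSeq.mem_labels_of_fml {S : LSeq} {a : ℕ × Fml} (h : a ∈ S.fml) : a.1 ∈ S.labels :=
  .inr ⟨a.2, h⟩

namespace LSeq.Eqv

variable {S T : LSeq}

theorem symm (h : Eqv S T) : Eqv T S := ⟨fun e => (h.1 e).symm, h.2.symm⟩

theorem rel_sub (h : Eqv S T) : S.rel ⊆ T.rel := fun e => (h.1 e).1

theorem fml_sub (h : Eqv S T) : S.fml ⊆ T.fml := h.2.subset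

theorem labels_sub (h : Eqv S T) : S.labels ⊆ T.labels :=
  labels_mono h.rel_sub fun _ ha => mem_labels_of_fml (h.fml_sub ha)

end LSeq.Eqv

section Cases

variable {P : Set PathAxiom} {S T : LSeq} {E : Env}

theorem Inv.congr (h : Inv P S E) (hST : S.Eqv T) : Inv P T E :=
  { h with
    verts_sub := fun x hx => hST.labels_sub (h.verts_sub x hx)
    fml_sub := fun _ ha => h.fml_sub (hST.symm.fml_sub ha)
    linked := fun e he => h.linked e (hST.symm.rel_sub he) }

theorem Inv.addFml (h : Inv P S E) (hl : S.labels ⊆ T.labels) (hr : T.rel ⊆ S.rel)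
    {Γ : List (ℕ × Fml)} (hf : T.fml ⊆ Γ) (hΓ : ∀ a ∈ Γ, a.1 ∈ verts E.root E.tree) :
    Inv P T ⟨E.root, E.tree, Γ, E.paths⟩ where
  built := h.built
  verts_sub x hx := hl (h.verts_sub x hx)
  fml_sub := hf
  fml_mem := hΓ
  sound := h.sound
  symm := h.symm
  linked e he := h.linked e (hr he)

theorem Inv.mem_of_linked (h : Inv P S E) {d : Dia} {u v : ℕ} (hl : Linked E.paths d u v) :
    u ∈ verts E.root E.tree ∧ v ∈ verts E.root E.tree := by
  obtain ⟨s, hs⟩ := hl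
  exact ⟨(h.sound _ hs).1, (h.sound _ hs).2.1⟩

theorem Inv.linked_relAtom (h : Inv P S E) {d : Dia} {u v : ℕ} (hr : relAtom d u v ∈ S.rel)
    (huv : u ∈ verts E.root E.tree ∨ v ∈ verts E.root E.tree) : Linked E.paths d u v := by
  cases d
  · exact h.linked _ hr huv
  · exact h.symm _ _ _ (h.linked _ hr huv.symm)

theorem Inv.idDeriv (h : Inv P S E) {x p : ℕ} (h1 : (x, .pos p) ∈ S.fml)
    (h2 : (x, .neg p) ∈ S.fml) : Der P (idDeriv E) E.seq.cls := by
  have hp := headI_filter (l := E.fmls)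
    (p := fun a => a.2.tag = 0 ∧ (a.1, a.2.compl) ∈ E.fmls)
    ⟨(x, .pos p), h.fml_sub h1, rfl, h.fml_sub h2⟩
  change idPick E ∈ E.fmls ∧ (idPick E).2.tag = 0 ∧ ((idPick E).1, (idPick E).2.compl) ∈ E.fmls
    at hp
  obtain ⟨ha, ht, hc⟩ := hp
  simp only [Tense.idDeriv]
  generalize idPick E = a at *
  obtain ⟨x, A⟩ := a
  cases A <;> simp [Fml.tag] at ht
  rename_i p
  obtain ⟨b, hb⟩ : ∃ b, (view E.tree E.fmls x).cls = b + (NSeq.fml (.neg p)).cls :=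
    exists_cls_view hc
  have h0 : Der P (.node₀ .id (.comma (view E.tree E.fmls x)
      (.comma (.fml (.pos p)) (.fml (.neg p)))))
      ((view E.tree E.fmls x).cls + ((NSeq.fml (.pos p)).cls + (NSeq.fml (.neg p)).cls)) :=
    ⟨⟨[], _, .nil, .refl _, .id _ _⟩, rfl⟩
  have h3 := h0.ctr (Y := .comma (view E.tree E.fmls x) (.fml (.pos p)))
    (b + (NSeq.fml (.pos p)).cls) (NSeq.fml (.neg p)).cls
    (by simp [hb]; abel) (by simp [hb]; abel)
  exact h3.ctr_ascend h.built (h.fml_mem _ ha) ha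

theorem Inv.or (h : Inv P S E) {t : LSeq} {R : List (ℕ × ℕ)} {Γ : List (ℕ × Fml)} {x : ℕ}
    {A B : Fml} (hS : S = ⟨R, (x, .or A B) :: Γ⟩)
    (ht : t.Eqv ⟨R, (x, A) :: (x, B) :: Γ⟩) :
    Inv P t (orEnv t E) ∧ ∀ D, Der P D (orEnv t E).seq.cls →
      Der P (extend D (orLines t E)) E.seq.cls := by
  subst hS
  have hp := headI_filter (l := E.fmls)
    (p := fun a => a.2.tag = 3 ∧ t.fml ⊆ (a.1, a.2.left) :: (a.1, a.2.right) :: E.fmls)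
    ⟨(x, .or A B), h.fml_sub (by simp), rfl, fun a ha => by
      have h1 := ht.fml_sub ha
      have h2 : a ∈ Γ → a ∈ E.fmls := fun h3 => h.fml_sub (by simp [h3])
      simp only [List.mem_cons, Fml.left, Fml.right] at h1 ⊢
      tauto⟩
  change orPick t E ∈ E.fmls ∧ (orPick t E).2.tag = 3 ∧ _ at hp
  simp only [orLines, orEnv]
  change _ ∧ _ ∧ t.fml ⊆ ((orPick t E).1, (orPick t E).2.left) ::
    ((orPick t E).1, (orPick t E).2.right) :: E.fmls at hp
  generalize orPick t E = a at *
  obtain ⟨z, C⟩ := a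
  obtain ⟨ha, htag, hf⟩ := hp
  cases C <;> simp [Fml.tag] at htag
  rename_i A' B'
  have hz := h.fml_mem _ ha
  refine ⟨h.addFml ?_ ht.rel_sub hf ?_, fun D hD => ?_⟩
  · refine fun y hy => ht.symm.labels_sub (LSeq.labels_mono
      (S := ⟨R, (x, .or A B) :: Γ⟩)
      (T := ⟨R, (x, A) :: (x, B) :: Γ⟩) (fun _ h => h) (fun a ha => ?_) hy)
    rcases List.mem_cons.1 ha with rfl | ha
    · exact .inr ⟨A, by simp⟩
    · exact .inr ⟨a.2, by simp [ha]⟩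
  · intro a ha
    rcases List.mem_cons.1 ha with rfl | ha
    · exact hz
    rcases List.mem_cons.1 ha with rfl | ha
    · exact hz
    · exact h.fml_mem a ha
  · rw [extend_append, extend_cons]
    refine Der.ctr_ascend h.built hz ha ?_
    refine (Der.descend h.built hz hD).or
      (Y := .comma (view E.tree E.fmls z) (.fml (.or A' B'))) (view E.tree E.fmls z).cls A' B' ?_ rfl
    rw [cls_view_cons, cls_view_cons, add_assoc, add_comm (NSeq.cls _) (NSeq.cls _)]
    rfl

theorem Inv.and (h : Inv P S E) {t₁ t₂ : LSeq} {R : List (ℕ × ℕ)} {Γ : List (ℕ × Fml)} {x : ℕ}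
    {A B : Fml} (hS : S = ⟨R, (x, .and A B) :: Γ⟩)
    (ht₁ : t₁.Eqv ⟨R, (x, A) :: Γ⟩) (ht₂ : t₂.Eqv ⟨R, (x, B) :: Γ⟩) :
    Inv P t₁ (andEnv₁ t₁ t₂ E) ∧ Inv P t₂ (andEnv₂ t₁ t₂ E) ∧
      ∀ D₁ D₂, Der P D₁ (andEnv₁ t₁ t₂ E).seq.cls → Der P D₂ (andEnv₂ t₁ t₂ E).seq.cls →
        Der P (andDeriv t₁ t₂ E D₁ D₂) E.seq.cls := by
  subst hS
  have hs : ∀ {t : LSeq} {C : Fml}, t.Eqv ⟨R, (x, C) :: Γ⟩ → t.fml ⊆ (x, C) :: E.fmls := by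
    intro t C ht a ha
    rcases List.mem_cons.1 (ht.fml_sub ha) with rfl | h1
    · exact List.mem_cons_self
    · exact List.mem_cons_of_mem _ (h.fml_sub (List.mem_cons_of_mem _ h1))
  have hp := headI_filter (l := E.fmls)
    (p := fun a => a.2.tag = 2 ∧ t₁.fml ⊆ (a.1, a.2.left) :: E.fmls ∧
      t₂.fml ⊆ (a.1, a.2.right) :: E.fmls)
    ⟨(x, .and A B), h.fml_sub (by simp), rfl, hs ht₁, hs ht₂⟩
  change andPick t₁ t₂ E ∈ E.fmls ∧ (andPick t₁ t₂ E).2.tag = 2 ∧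
    t₁.fml ⊆ ((andPick t₁ t₂ E).1, (andPick t₁ t₂ E).2.left) :: E.fmls ∧
    t₂.fml ⊆ ((andPick t₁ t₂ E).1, (andPick t₁ t₂ E).2.right) :: E.fmls at hp
  simp only [andDeriv, andEnv₁, andEnv₂]
  generalize andPick t₁ t₂ E = a at *
  obtain ⟨z, C⟩ := a
  obtain ⟨ha, htag, hf₁, hf₂⟩ := hp
  cases C <;> simp [Fml.tag] at htag
  rename_i A' B'
  have hz := h.fml_mem _ ha
  have hl : ∀ {t : LSeq} {C : Fml}, t.Eqv ⟨R, (x, C) :: Γ⟩ →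
      LSeq.labels ⟨R, (x, .and A B) :: Γ⟩ ⊆ t.labels := by
    intro t C ht y hy
    refine ht.symm.labels_sub (LSeq.labels_mono
      (S := ⟨R, (x, .and A B) :: Γ⟩)
      (T := ⟨R, (x, C) :: Γ⟩) (fun _ h => h) (fun a ha => ?_) hy)
    rcases List.mem_cons.1 ha with rfl | ha
    · exact .inr ⟨C, by simp⟩
    · exact .inr ⟨a.2, by simp [ha]⟩
  have hm : ∀ C : Fml, ∀ a ∈ (z, C) :: E.fmls, a.1 ∈ verts E.root E.tree := by
    intro C a ha
    rcases List.mem_cons.1 ha with rfl | ha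
    exacts [hz, h.fml_mem a ha]
  refine ⟨h.addFml (hl ht₁) ht₁.rel_sub hf₁ (hm _), h.addFml (hl ht₂) ht₂.rel_sub hf₂ (hm _),
    fun D₁ D₂ hD₁ hD₂ => ?_⟩
  refine Der.ctr_ascend h.built hz ha ?_
  have h₁ := Der.descend h.built hz hD₁
  have h₂ := Der.descend h.built hz hD₂
  rw [cls_view_cons] at h₁ h₂
  exact ⟨⟨⟨[.comma _ (.fml A'), .comma _ (.fml B')], _,
    .cons (NSeq.cls_eq.1 h₁.2) (.cons (NSeq.cls_eq.1 h₂.2) .nil), .refl _, .and _ _ _⟩,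
    h₁.1, h₂.1⟩, rfl⟩

theorem exists_boxFml {d : Dia} {C : Fml} (h : C.tag = boxTag d) : C = boxFml d C.left := by
  cases d <;> cases C <;> simp [Fml.tag, boxTag, boxFml, Fml.left] at h ⊢

theorem exists_diaFml {d : Dia} {C : Fml} (h : C.tag = diaTag d) : C = diaFml d C.left := by
  cases d <;> cases C <;> simp [Fml.tag, diaTag, diaFml, Fml.left] at h ⊢

theorem tag_boxFml (d : Dia) (A : Fml) :
    (boxFml d A).tag = boxTag d ∧ (boxFml d A).left = A := by
  cases d <;> simp [boxTag, boxFml, Fml.tag, Fml.left]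

theorem tag_diaFml (d : Dia) (A : Fml) :
    (diaFml d A).tag = diaTag d ∧ (diaFml d A).left = A := by
  cases d <;> simp [diaTag, diaFml, Fml.tag, Fml.left]

theorem relAtom_eq (d : Dia) (x y : ℕ) :
    (if d = .white then (x, y) else (y, x)) = relAtom d x y := by
  cases d <;> simp [relAtom]

theorem mem_labels_relAtom {d : Dia} {x y : ℕ} (h : relAtom d x y ∈ S.rel) :
    x ∈ S.labels ∧ y ∈ S.labels := by
  cases d
  exacts [⟨.inl ⟨y, .inl h⟩, .inl ⟨x, .inr h⟩⟩, ⟨.inl ⟨y, .inr h⟩, .inl ⟨x, .inl h⟩⟩]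

theorem boxPick_spec (h : Inv P S E) {d : Dia} {s t : LSeq} {R : List (ℕ × ℕ)}
    {Γ : List (ℕ × Fml)} {x y : ℕ} {A : Fml} (hS : S = ⟨R, (x, boxFml d A) :: Γ⟩)
    (hs : s.Eqv S) (hy : y ∉ S.labels) (ht : t.Eqv ⟨relAtom d x y :: R, (y, A) :: Γ⟩) :
    ∃ z C v, boxPick d s t E = ((z, boxFml d C), v) ∧ (z, boxFml d C) ∈ E.fmls ∧ v ∈ t.labels ∧
      t.fml ⊆ (v, C) :: E.fmls ∧ t.rel ⊆ relAtom d z v :: s.rel ∧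
      v ∉ verts E.root E.tree ∧ ∀ e ∈ s.rel, v ≠ e.1 ∧ v ≠ e.2 := by
  have hmem : boxPick d s t E ∈ E.fmls.flatMap fun a =>
      ((t.rel.map fun e => if d = .white then e.2 else e.1).filter fun y =>
      a.2.tag = boxTag d ∧ t.fml ⊆ (y, a.2.left) :: E.fmls ∧
        t.rel ⊆ (if d = .white then (a.1, y) else (y, a.1)) :: s.rel ∧
        y ∉ verts E.root E.tree ∧ y ∉ s.rel.map (fun e => e.1) ∧ y ∉ s.rel.map (fun e => e.2)).map
      fun y => (a, y) := by
    refine headI_mem (a := ((x, boxFml d A), y)) ?_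
    rw [List.mem_flatMap]
    refine ⟨_, h.fml_sub (by simp [hS]), List.mem_map.2 ⟨y, List.mem_filter.2 ⟨?_, ?_⟩, rfl⟩⟩
    · refine List.mem_map.2 ⟨relAtom d x y, ht.symm.rel_sub (by simp), ?_⟩
      cases d <;> simp [relAtom]
    · have hy' : ∀ e ∈ s.rel, y ≠ e.1 ∧ y ≠ e.2 := fun e he =>
        ⟨fun hye => hy (hs.labels_sub (.inl ⟨e.2, .inl (hye ▸ he)⟩)),
          fun hye => hy (hs.labels_sub (.inl ⟨e.1, .inr (hye ▸ he)⟩))⟩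
      refine decide_eq_true ⟨(tag_boxFml d A).1, ?_, ?_, fun hv => hy (h.verts_sub y hv), ?_, ?_⟩
      · rw [(tag_boxFml d A).2]
        intro a ha
        rcases List.mem_cons.1 (ht.fml_sub ha) with rfl | h1
        · exact List.mem_cons_self
        · exact List.mem_cons_of_mem _ (h.fml_sub (by simp [hS, h1]))
      · rw [relAtom_eq]
        intro e he
        rcases List.mem_cons.1 (ht.rel_sub he) with rfl | h1
        · exact List.mem_cons_self
        · exact List.mem_cons_of_mem _ (hs.symm.rel_sub (by simpa [hS] using h1))
      · rw [List.mem_map]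
        rintro ⟨e, he, rfl⟩
        exact (hy' e he).1 rfl
      · rw [List.mem_map]
        rintro ⟨e, he, rfl⟩
        exact (hy' e he).2 rfl
  rw [List.mem_flatMap] at hmem
  obtain ⟨⟨z, C⟩, ha, hmem⟩ := hmem
  obtain ⟨v, hv, hpick⟩ := List.mem_map.1 hmem
  rw [List.mem_filter] at hv
  obtain ⟨hv1, hv2⟩ := hv
  obtain ⟨htag, hf, hr, hv3, hv4, hv5⟩ := of_decide_eq_true hv2
  rw [relAtom_eq] at hr
  have hC := exists_boxFml htag
  refine ⟨z, C.left, v, ?_, hC ▸ ha, ?_, hf, hr, hv3, fun e he => ⟨?_, ?_⟩⟩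
  · rw [← hC, hpick]
  · obtain ⟨e, he, rfl⟩ := List.mem_map.1 hv1
    cases d
    · exact .inl ⟨e.1, .inr (by simpa using he)⟩
    · exact .inl ⟨e.2, .inl (by simpa using he)⟩
  · rintro rfl
    exact hv4 (List.mem_map.2 ⟨e, he, rfl⟩)
  · rintro rfl
    exact hv5 (List.mem_map.2 ⟨e, he, rfl⟩)

theorem Sound.mono {r : ℕ} {R R' : List Edge} {T : List Entry} (h : Sound P r R T)
    (hR : R ⊆ R') (hv : verts r R ⊆ verts r R') : Sound P r R' T := fun t ht =>
  ⟨hv (h t ht).1, hv (h t ht).2.1, (h t ht).2.2.mono hR⟩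

theorem linked_append {T T' : List Entry} {d : Dia} {u v : ℕ} :
    Linked (T ++ T') d u v ↔ Linked T d u v ∨ Linked T' d u v := by
  simp only [Linked, List.mem_append, exists_or]

theorem linked_edgeEntries {e : Edge} {d : Dia} {u v : ℕ} :
    Linked (edgeEntries e) d u v ↔ (d, u, v) = e ∨ (d, u, v) = e.flip := by
  simp [Linked, edgeEntries, exists_or]

theorem flip_eq_iff {d : Dia} {u v : ℕ} {e : Edge} : (d, u, v) = e.flip ↔ (d.dual, v, u) = e := by
  constructor
  · intro h
    rw [← Edge.flip_flip e, ← h]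
    rfl
  · rintro rfl
    simp [Edge.flip]

theorem linked_edgeEntries_symm {e : Edge} {d : Dia} {u v : ℕ} (h : Linked (edgeEntries e) d u v) :
    Linked (edgeEntries e) d.dual v u := by
  rw [linked_edgeEntries, flip_eq_iff] at h ⊢
  rw [Dia.dual_dual]
  exact h.symm

theorem linked_edgeEntries_relAtom (d : Dia) (u v : ℕ) :
    Linked (edgeEntries (d, u, v)) .white (relAtom d u v).1 (relAtom d u v).2 := by
  rw [linked_edgeEntries]
  cases d
  exacts [.inl rfl, .inr rfl]

theorem Inv.box (h : Inv P S E) {d : Dia} {s t : LSeq} {R : List (ℕ × ℕ)}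
    {Γ : List (ℕ × Fml)} {x y : ℕ} {A : Fml} (hS : S = ⟨R, (x, boxFml d A) :: Γ⟩)
    (hs : s.Eqv S) (hy : y ∉ S.labels) (ht : t.Eqv ⟨relAtom d x y :: R, (y, A) :: Γ⟩) :
    Inv P t (boxEnv d s t E) ∧ ∀ D, Der P D (boxEnv d s t E).seq.cls →
      Der P (extend D (boxLines d s t E)) E.seq.cls := by
  obtain ⟨z, C, v, hpick, ha, hvt, hf, hr, hv, hv'⟩ := boxPick_spec h hS hs hy ht
  have hz := h.fml_mem _ ha
  have hlab : S.labels ⊆ t.labels := fun u hu => by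
    refine ht.symm.labels_sub (LSeq.labels_mono ?_ ?_ hu)
    · simp [hS]
    · intro a ha
      rw [hS] at ha
      rcases List.mem_cons.1 ha with rfl | ha
      · exact (mem_labels_relAtom (d := d) (y := y) (by simp)).1
      · exact .inr ⟨a.2, by simp [ha]⟩
  have hvs : verts E.root E.tree ⊆ verts E.root ((d, z, v) :: E.tree) := fun u hu =>
    mem_verts_cons.2 (.inr hu)
  simp only [boxLines, boxEnv, hpick]
  rw [(tag_boxFml d C).2]
  have hb : IsBuilt E.root ((d, z, v) :: E.tree) := ⟨hz, hv, h.built⟩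
  refine ⟨⟨hb, fun u hu => ?_, hf, fun a ha => ?_, ?_, fun d' u u' hl => ?_, fun e he hev => ?_⟩,
    fun D hD => ?_⟩
  · rcases mem_verts_cons.1 hu with rfl | hu
    exacts [hvt, hlab (h.verts_sub u hu)]
  · rcases List.mem_cons.1 ha with rfl | ha
    exacts [mem_verts_cons.2 (.inl rfl), hvs (h.fml_mem a ha)]
  · exact (h.sound.mono (List.subset_cons_self _ _) hvs).append
      (sound_edgeEntries hb List.mem_cons_self)
  · rw [linked_append] at hl ⊢
    exact hl.imp (h.symm _ _ _) linked_edgeEntries_symm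
  · rw [linked_append]
    rcases List.mem_cons.1 (hr he) with rfl | he
    · exact .inr (linked_edgeEntries_relAtom d z v)
    · left
      have hne := hv' e he
      refine h.linked e (hs.rel_sub he) (hev.imp ?_ ?_) <;> intro he'
      · exact (mem_verts_cons.1 he').resolve_left (Ne.symm hne.1)
      · exact (mem_verts_cons.1 he').resolve_left (Ne.symm hne.2)
  · rw [extend_append, extend_cons]
    refine Der.ctr_ascend h.built hz ha ?_
    exact (Der.descend hb (hvs hz) hD).box (Y := .comma _ _) d _ C
      (cls_view_leaf hz hv h.fml_mem) rfl

theorem diaPick_spec (h : Inv P S E) {d : Dia} {t : LSeq} {R : List (ℕ × ℕ)}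
    {Γ : List (ℕ × Fml)} {x y : ℕ} {A : Fml}
    (hS : S = ⟨relAtom d x y :: R, (x, diaFml d A) :: Γ⟩)
    (ht : t.Eqv ⟨relAtom d x y :: R, (y, A) :: (x, diaFml d A) :: Γ⟩) :
    ∃ z C v i, diaPick d t E = ((z, diaFml d C), (d.dual, v, z), i) ∧
      (z, diaFml d C) ∈ E.fmls ∧ ((d.dual, v, z), i) ∈ E.paths ∧
      t.fml ⊆ (v, C) :: E.fmls := by
  have hmem : diaPick d t E ∈ E.fmls.flatMap fun a =>
      (E.paths.filter fun p => a.2.tag = diaTag d ∧ p.1.1 = d.dual ∧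
      p.1.2.2 = a.1 ∧ t.fml ⊆ (p.1.2.1, a.2.left) :: E.fmls).map fun p => (a, p) := by
    have hA : (x, diaFml d A) ∈ E.fmls := h.fml_sub (by simp [hS])
    obtain ⟨i, hi⟩ := h.symm _ _ _
      (h.linked_relAtom (d := d) (u := x) (v := y) (by simp [hS]) (.inl (h.fml_mem _ hA)))
    refine headI_mem (a := ((x, diaFml d A), (d.dual, y, x), i)) ?_
    rw [List.mem_flatMap]
    refine ⟨_, hA, List.mem_map.2 ⟨_, List.mem_filter.2 ⟨hi, ?_⟩, rfl⟩⟩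
    refine decide_eq_true ⟨(tag_diaFml d A).1, rfl, rfl, ?_⟩
    rw [(tag_diaFml d A).2]
    intro a ha
    rcases List.mem_cons.1 (ht.fml_sub ha) with rfl | h1
    · exact List.mem_cons_self
    · exact List.mem_cons_of_mem _ (h.fml_sub (by simpa [hS] using h1))
  rw [List.mem_flatMap] at hmem
  obtain ⟨⟨z, C⟩, ha, hmem⟩ := hmem
  obtain ⟨⟨⟨d', v, z'⟩, i⟩, hv, hpick⟩ := List.mem_map.1 hmem
  rw [List.mem_filter] at hv
  obtain ⟨hv1, hv2⟩ := hv
  obtain ⟨htag, hd, hz, hf⟩ := of_decide_eq_true hv2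
  obtain rfl : d' = d.dual := hd
  obtain rfl : z' = z := hz
  have hC := exists_diaFml htag
  exact ⟨z', C.left, v, i, by rw [← hC, hpick], hC ▸ ha, hv1, hf⟩

theorem Inv.dia (h : Inv P S E) {d : Dia} {t : LSeq} {R : List (ℕ × ℕ)}
    {Γ : List (ℕ × Fml)} {x y : ℕ} {A : Fml}
    (hS : S = ⟨relAtom d x y :: R, (x, diaFml d A) :: Γ⟩)
    (ht : t.Eqv ⟨relAtom d x y :: R, (y, A) :: (x, diaFml d A) :: Γ⟩) :
    Inv P t (diaEnv d t E) ∧ ∀ D, Der P D (diaEnv d t E).seq.cls →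
      Der P (extend D (diaLines d t E)) E.seq.cls := by
  obtain ⟨z, C, v, i, hpick, ha, hi, hf⟩ := diaPick_spec h hS ht
  have hz := h.fml_mem _ ha
  obtain ⟨hv, -, hlead⟩ := h.sound _ hi
  simp only [diaLines, diaEnv, hpick]
  rw [(tag_diaFml d C).2]
  refine ⟨h.addFml ?_ ?_ hf ?_, fun D hD => ?_⟩
  · refine fun u hu => ht.symm.labels_sub (LSeq.labels_mono ?_ (fun a ha => ?_) hu)
    · simp [hS]
    · rw [hS] at ha
      exact .inr ⟨a.2, List.mem_cons_of_mem _ ha⟩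
  · rw [hS]
    exact ht.rel_sub
  · intro a ha
    rcases List.mem_cons.1 ha with rfl | ha
    exacts [hv, h.fml_mem a ha]
  · rw [extend_append, extend_append, extend_append]
    refine Der.ctr_ascend h.built hz ha ?_
    refine hlead E.tree h.built (fun _ h => h) _ _ _ ?_
    have h0 := Der.descend h.built hv hD
    have h1 := h0.wk
      (Y := .comma (view E.tree ((v, C) :: E.fmls) v) (.nest d.dual (.fml (diaFml d C))))
      (.nest d.dual (NSeq.fml (diaFml d C)).cls) rfl
    have h2 := h1.disp (d := d.dual)
      (Y := .comma (.nest d (view E.tree ((v, C) :: E.fmls) v)) (.fml (diaFml d C)))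
      (view E.tree ((v, C) :: E.fmls) v).cls (NSeq.fml (diaFml d C)).cls rfl (by simp)
    have h3 := h2.dia (Y := .comma (.nest d (view E.tree E.fmls v)) (.fml (diaFml d C))) d
      (view E.tree E.fmls v).cls C (by simp [cls_view_cons]) (by simp)
    have h4 := h3.disp (d := d)
      (Y := .comma (.nest d.dual (.fml (diaFml d C))) (view E.tree E.fmls v))
      (NSeq.fml (diaFml d C)).cls (view E.tree E.fmls v).cls (by simp [add_comm]) (by simp)
    rw [NSeq.cls_comma, add_comm] at h4
    exact h4

theorem spells_of_mem_chains {T : List Entry} {V : List ℕ} {w : List Dia} :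
    ∀ c ∈ chains T V w, Spells T w c.1 c.2.1 := by
  induction w using List.reverseRecOn with
  | nil =>
    intro c hc
    obtain ⟨x, hx, rfl⟩ := List.mem_map.1 hc
    rfl
  | append_singleton w d ih =>
    intro c hc
    rw [chains_concat, List.mem_flatMap] at hc
    obtain ⟨c', hc', hc⟩ := hc
    obtain ⟨t, ht, rfl⟩ := List.mem_map.1 hc
    simp only [List.mem_filter, decide_eq_true_eq] at ht
    obtain ⟨ht, rfl, htc⟩ := ht
    exact spells_append.2 ⟨_, ih c' hc', t.1.2.2, ⟨t.2, htc ▸ ht⟩, rfl⟩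

theorem revWord_revWord (w : List Dia) : revWord (revWord w) = w := by
  simp [revWord, Function.comp_def]

theorem linked_pathEntries_symm (h : Inv P S E) {F : PathAxiom} (hF : F ∈ P) {d : Dia} {u v : ℕ}
    (hl : Linked (pathEntries F E.paths (verts E.root E.tree)) d u v) :
    Linked (pathEntries F E.paths (verts E.root E.tree)) d.dual v u := by
  obtain ⟨s, hs⟩ := hl
  have hmem := h.sound.pathEntries hF _ hs
  rcases List.mem_append.1 hs with hs | hs <;> obtain ⟨c, hc, hcs⟩ := List.mem_map.1 hs <;>
    simp only [Prod.mk.injEq] at hcs <;> obtain ⟨⟨rfl, rfl, rfl⟩, -⟩ := hcs <;>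
    have hsp := spells_of_mem_chains c hc
  · exact (linked_pathEntries h.symm hmem.1 hmem.2.1 hsp).2
  · have := hsp.reverse h.symm
    rw [revWord_revWord] at this
    rw [Dia.dual_dual]
    exact (linked_pathEntries h.symm hmem.2.1 hmem.1 this).1

theorem Inv.spells_of_isRelPath (h : Inv P S E) {w : List Dia} {x y : ℕ} {Q : List (ℕ × ℕ)}
    (hQ : IsRelPath w x y Q) (hQS : Q ⊆ S.rel)
    (hxy : x ∈ verts E.root E.tree ∨ y ∈ verts E.root E.tree) :
    x ∈ verts E.root E.tree ∧ y ∈ verts E.root E.tree ∧ Spells E.paths w x y := by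
  induction hQ with
  | nil x => exact ⟨hxy.elim id id, hxy.elim id id, rfl⟩
  | @cons d w x z y Q hQ ih =>
    have hQS' := List.cons_subset.1 hQS
    have hz : z ∈ verts E.root E.tree := by
      rcases hxy with hx | hy
      · exact (h.mem_of_linked (h.linked_relAtom hQS'.1 (.inl hx))).2
      · exact (ih hQS'.2 (.inr hy)).1
    have hl := h.linked_relAtom hQS'.1 (.inr hz)
    obtain ⟨-, h2, h3⟩ := ih hQS'.2 (.inl hz)
    exact ⟨(h.mem_of_linked hl).1, h2, z, hl, h3⟩

theorem Inv.path (h : Inv P S E) {F : PathAxiom} (hF : F ∈ P) {t : LSeq} {R Q : List (ℕ × ℕ)}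
    {Γ : List (ℕ × Fml)} {x y : ℕ} (hQ : IsRelPath F.ant x y Q) (hS : S = ⟨Q ++ R, Γ⟩)
    (ht : t.Eqv ⟨relAtom F.con x y :: (Q ++ R), Γ⟩) : Inv P t (pathEnv F E) where
  built := h.built
  verts_sub u hu := by
    refine ht.symm.labels_sub (LSeq.labels_mono ?_ (fun a ha => ?_) (h.verts_sub u hu))
    · simp [hS]
    · rw [hS] at ha
      exact .inr ⟨a.2, ha⟩
  fml_sub a ha := h.fml_sub (by rw [hS]; exact ht.fml_sub ha)
  fml_mem := h.fml_mem
  sound := h.sound.append (h.sound.pathEntries hF)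
  symm d u v hl := by
    simp only [pathEnv, linked_append] at hl ⊢
    exact hl.imp (h.symm _ _ _) (linked_pathEntries_symm h hF)
  linked e he hev := by
    simp only [pathEnv, linked_append]
    rcases List.mem_cons.1 (ht.rel_sub he) with rfl | he
    · right
      have hxy : x ∈ verts E.root E.tree ∨ y ∈ verts E.root E.tree := by
        cases hc : F.con <;> rw [hc] at hev
        exacts [hev, hev.symm]
      obtain ⟨hx, hy, hsp⟩ := h.spells_of_isRelPath hQ (by simp [hS]) hxy
      have hl := linked_pathEntries h.symm hx hy hsp
      cases hc : F.con <;> rw [hc] at hl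
      exacts [hl.1, hl.2]
    · exact .inl (h.linked e (by rw [hS]; exact he) hev)

/-- The transformation is correct under the invariant. -/
theorem der_paramRec {D : Deriv LRule LSeq} (hD : D.Valid LSeq.Eqv (LInst P)) :
    ∀ E, Inv P D.concl E → Der P (D.paramRec next build E) E.seq.cls := by
  induction D with
  | node₀ r s =>
    intro E hE
    obtain ⟨ps, s', hps, hs, hi⟩ := hD
    obtain rfl : ps = [] := by simpa using hps
    cases hi
    exact (hE.congr hs).idDeriv (List.mem_cons_self) (List.mem_cons_of_mem _ List.mem_cons_self)
  | node₁ r s d ih =>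
    intro E hE
    obtain ⟨⟨ps, s', hps, hs, hi⟩, hd⟩ := hD
    have hE' := hE.congr hs
    cases hps with
    | cons ht hps =>
    cases hps
    cases hi with
    | or R Γ x A B =>
      have h1 := hE'.or rfl ht
      exact h1.2 _ (ih hd _ h1.1)
    | box R Γ x y A hy =>
      have h1 := hE'.box (d := .white) rfl hs hy ht
      exact h1.2 _ (ih hd _ h1.1)
    | dia R Γ x y A =>
      have h1 := hE'.dia (d := .white) rfl ht
      exact h1.2 _ (ih hd _ h1.1)
    | bbox R Γ x y A hy =>
      have h1 := hE'.box (d := .black) rfl hs hy ht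
      exact h1.2 _ (ih hd _ h1.1)
    | bdia R Γ x y A =>
      have h1 := hE'.dia (d := .black) rfl ht
      exact h1.2 _ (ih hd _ h1.1)
    | path F hF R Q Γ x y hQ => exact ih hd _ (hE'.path hF hQ rfl ht)
  | node₂ r s d d' ih ih' =>
    intro E hE
    obtain ⟨⟨ps, s', hps, hs, hi⟩, hd, hd'⟩ := hD
    have hE' := hE.congr hs
    cases hps with
    | cons ht hps =>
    cases hps with
    | cons ht' hps =>
    cases hps
    cases hi with
    | and R Γ x A B =>
      have h1 := hE'.and rfl ht ht'
      exact h1.2.2 _ _ (ih hd _ h1.1) (ih' hd' _ h1.2.1)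

end Cases

/-! ### Polytrees as lists of edges -/

/-- The relational atom of an edge. -/
def Edge.atom (e : Edge) : ℕ × ℕ := relAtom e.1 e.2.1 e.2.2

theorem mem_verts_of_atom {r : ℕ} {R : List Edge} (hR : IsBuilt r R) {e : Edge} (he : e ∈ R) :
    e.atom.1 ∈ verts r R ∧ e.atom.2 ∈ verts r R := by
  obtain ⟨h1, h2⟩ := hR.mem_verts he
  obtain ⟨d, u, v⟩ := e
  cases d
  exacts [⟨h1, h2⟩, ⟨h2, h1⟩]

theorem Edge.atom_touches (e : Edge) : e.atom.1 = e.2.2 ∨ e.atom.2 = e.2.2 := by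
  obtain ⟨d, u, v⟩ := e
  cases d
  exacts [.inr rfl, .inl rfl]

/-- No atom occurs twice in a tree, since every edge leads to a new vertex. -/
theorem nodup_map_atom {r : ℕ} : ∀ {R : List Edge}, IsBuilt r R → (R.map Edge.atom).Nodup
  | [], _ => List.nodup_nil
  | e :: R, h => by
    rw [List.map_cons, List.nodup_cons]
    refine ⟨fun he => ?_, nodup_map_atom h.2.2⟩
    obtain ⟨f, hf, hfe⟩ := List.mem_map.1 he
    have h1 := mem_verts_of_atom h.2.2 hf
    rw [hfe] at h1
    rcases e.atom_touches with h2 | h2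
    · exact h.2.1 (h2 ▸ h1.1)
    · exact h.2.1 (h2 ▸ h1.2)

theorem ne_of_mem_map_atom {r : ℕ} : ∀ {R : List Edge}, IsBuilt r R →
    ∀ a ∈ R.map Edge.atom, a.1 ≠ a.2
  | [], _, a, ha => by simp at ha
  | (d, p, c) :: R, h, a, ha => by
    rcases List.mem_cons.1 ha with rfl | ha
    · have hpc : p ≠ c := fun hpc => h.2.1 (hpc ▸ h.1)
      cases d
      exacts [hpc, hpc.symm]
    · exact ne_of_mem_map_atom h.2.2 a ha

/-- No relational atom leads out of the tree. -/
def IsClosed (Q : List (ℕ × ℕ)) (r : ℕ) (R : List Edge) : Prop :=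
  ∀ e ∈ Q, e.1 ∈ verts r R ↔ e.2 ∈ verts r R

theorem growStep_cases (Q : List (ℕ × ℕ)) (r : ℕ) (R : List Edge) :
    (growStep Q r R = R ∧ IsClosed Q r R) ∨
      ∃ e : Edge, growStep Q r R = e :: R ∧ e.atom ∈ Q ∧ e.2.1 ∈ verts r R ∧
        e.2.2 ∉ verts r R := by
  unfold growStep
  generalize hl : ((Q.flatMap fun e => [(Dia.white, e.1, e.2), (.black, e.2, e.1)]).filter
    fun e : Edge => e.2.1 ∈ verts r R ∧ e.2.2 ∉ verts r R) = l
  cases l with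
  | nil =>
    refine .inl ⟨rfl, fun e he => ?_⟩
    rw [List.filter_eq_nil_iff] at hl
    have h1 := hl (.white, e.1, e.2) (List.mem_flatMap.2 ⟨e, he, by simp⟩)
    have h2 := hl (.black, e.2, e.1) (List.mem_flatMap.2 ⟨e, he, by simp⟩)
    simp only [decide_eq_true_eq] at h1 h2
    tauto
  | cons e l =>
    have he : e ∈ ((Q.flatMap fun e => [(Dia.white, e.1, e.2), (.black, e.2, e.1)]).filter
      fun e : Edge => e.2.1 ∈ verts r R ∧ e.2.2 ∉ verts r R) := hl ▸ List.mem_cons_self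
    rw [List.mem_filter, List.mem_flatMap] at he
    obtain ⟨⟨q, hq, heq⟩, he⟩ := he
    refine .inr ⟨e, rfl, ?_, of_decide_eq_true he⟩
    simp only [List.mem_cons, List.not_mem_nil, or_false] at heq
    rcases heq with rfl | rfl <;> exact hq

/-- As many rounds as there are atoms suffice for a tree that no atom leads out of. -/
theorem grow_spec (Q : List (ℕ × ℕ)) (r : ℕ) :
    IsBuilt r (grow Q r) ∧ (∀ e ∈ grow Q r, e.atom ∈ Q) ∧ IsClosed Q r (grow Q r) := by
  have key : ∀ n, IsBuilt r ((growStep Q r)^[n] []) ∧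
      (∀ e ∈ (growStep Q r)^[n] [], e.atom ∈ Q) ∧
      (IsClosed Q r ((growStep Q r)^[n] []) ∨ ((growStep Q r)^[n] []).length = n) := by
    intro n
    induction n with
    | zero => exact ⟨trivial, by simp, .inr rfl⟩
    | succ n ih =>
      rw [Function.iterate_succ_apply']
      generalize (growStep Q r)^[n] [] = R at *
      rcases growStep_cases Q r R with ⟨h1, h2⟩ | ⟨e, h1, h2, h3, h4⟩
      · rw [h1]
        exact ⟨ih.1, ih.2.1, .inl h2⟩
      · rw [h1]
        refine ⟨⟨h3, h4, ih.1⟩, ?_, ?_⟩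
        · intro f hf
          rcases List.mem_cons.1 hf with rfl | hf
          exacts [h2, ih.2.1 f hf]
        · rcases ih.2.2 with h5 | h5
          · obtain ⟨d, u, v⟩ := e
            cases d
            · exact absurd ((h5 _ h2).1 h3) h4
            · exact absurd ((h5 _ h2).2 h3) h4
          · exact .inr (by simp [h5])
  obtain ⟨h1, h2, h3⟩ := key Q.length
  refine ⟨h1, h2, h3.elim id fun h3 => ?_⟩
  -- All atoms have been used, by counting.
  have h4 : List.Subperm ((grow Q r).map Edge.atom) Q := by
    refine (nodup_map_atom h1).subperm fun a ha => ?_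
    obtain ⟨e, he, rfl⟩ := List.mem_map.1 ha
    exact h2 e he
  have h5 := h4.perm_of_length_le (by rw [List.length_map]; exact h3.ge)
  intro a ha
  obtain ⟨e, he, rfl⟩ := List.mem_map.1 (h5.mem_iff.2 ha)
  have := mem_verts_of_atom h1 he
  exact ⟨fun _ => this.2, fun _ => this.1⟩

theorem LSeq.IsPolytree.ne_of_mem_rel {S : LSeq} (hS : S.IsPolytree) {a : ℕ × ℕ}
    (ha : a ∈ S.rel) : a.1 ≠ a.2 := by
  obtain ⟨u, v⟩ := a
  rintro (rfl : u = v)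
  exact hS.1 u u ha ha

section Polytree

variable {S : LSeq} {r : ℕ} {R : List Edge}

theorem verts_subset_labels (hr : r ∈ S.labels) (hR : ∀ e ∈ R, e.atom ∈ S.rel) :
    ∀ x ∈ verts r R, x ∈ S.labels := by
  intro x hx
  rcases List.mem_cons.1 hx with rfl | hx
  · exact hr
  · obtain ⟨e, he, rfl⟩ := List.mem_map.1 hx
    exact (mem_labels_relAtom (hR e he)).2

/-- A tree that no relational atom leads out of contains all labels of a connected sequent. -/
theorem labels_subset_verts (hS : S.IsPolytree) (hr : r ∈ S.labels)
    (hQ : IsClosed S.rel r R) : ∀ x ∈ S.labels, x ∈ verts r R := by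
  intro x hx
  obtain ⟨w⟩ := hS.2.connected.preconnected ⟨r, hr⟩ ⟨x, hx⟩
  have key : ∀ {u v : S.labels}, S.graph.Walk u v → u.1 ∈ verts r R → v.1 ∈ verts r R := by
    intro u v w
    induction w with
    | nil => exact id
    | cons h _ ih =>
      intro hu
      exact ih (h.2.elim (fun h => (hQ _ h).1 hu) fun h => (hQ _ h).2 hu)
  exact key w List.mem_cons_self

/-- A tree in the graph of a polytree sequent that contains all labels contains all relational
atoms: an atom that is left out would not be a bridge. -/
theorem exists_atom_eq (hS : S.IsPolytree) (hr : r ∈ S.labels) (hb : IsBuilt r R)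
    (hR : ∀ e ∈ R, e.atom ∈ S.rel) (hV : ∀ x ∈ S.labels, x ∈ verts r R) :
    ∀ a ∈ S.rel, ∃ e ∈ R, e.atom = a := by
  intro a ha
  by_contra hne
  push Not at hne
  have h1 : a.1 ∈ S.labels := .inl ⟨a.2, .inl ha⟩
  have h2 : a.2 ∈ S.labels := .inl ⟨a.1, .inr ha⟩
  have hadj : S.graph.Adj ⟨a.1, h1⟩ ⟨a.2, h2⟩ :=
    ⟨fun h => hS.ne_of_mem_rel ha (congrArg Subtype.val h), .inl ha⟩
  have hbr := SimpleGraph.isAcyclic_iff_forall_adj_isBridge.1 hS.2.isAcyclic hadj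
  rw [SimpleGraph.isBridge_iff] at hbr
  -- The edges of the tree connect both ends of `a` without `a`.
  have hstep : ∀ e : Edge, e.atom ∈ S.rel → e.atom ≠ a →
      ∀ (hu : e.2.1 ∈ S.labels) (hv : e.2.2 ∈ S.labels),
      (S.graph.deleteEdges {s(⟨a.1, h1⟩, ⟨a.2, h2⟩)}).Adj ⟨e.2.1, hu⟩ ⟨e.2.2, hv⟩ := by
    rintro ⟨d, u, v⟩ he hea hu hv
    rw [SimpleGraph.deleteEdges_adj]
    cases d with
    | white =>
      have he' : (u, v) ∈ S.rel := he
      have hea' : (u, v) ≠ a := hea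
      refine ⟨⟨fun h => hS.ne_of_mem_rel he' (congrArg Subtype.val h), .inl he'⟩, ?_⟩
      simp only [Set.mem_singleton_iff, Sym2.eq_iff, Subtype.mk.injEq]
      rintro (⟨rfl, rfl⟩ | ⟨rfl, rfl⟩)
      exacts [hea' rfl, hS.1 _ _ he' ha]
    | black =>
      have he' : (v, u) ∈ S.rel := he
      have hea' : (v, u) ≠ a := hea
      refine ⟨⟨fun h => hS.ne_of_mem_rel he' (congrArg Subtype.val h).symm, .inr he'⟩, ?_⟩
      simp only [Set.mem_singleton_iff, Sym2.eq_iff, Subtype.mk.injEq]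
      rintro (⟨rfl, rfl⟩ | ⟨rfl, rfl⟩)
      exacts [hS.1 _ _ he' ha, hea' rfl]
  have key : ∀ T ⊆ R, IsBuilt r T → ∀ (x : ℕ) (hx : x ∈ S.labels), x ∈ verts r T →
      (S.graph.deleteEdges {s(⟨a.1, h1⟩, ⟨a.2, h2⟩)}).Reachable ⟨r, hr⟩ ⟨x, hx⟩ := by
    intro T
    induction T with
    | nil =>
      intro _ _ x hx hxr
      obtain rfl : x = r := by simpa [verts] using hxr
      exact .rfl
    | cons e T ih =>
      intro hT hbT x hx hxv
      have hT' := List.cons_subset.1 hT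
      rcases mem_verts_cons.1 hxv with rfl | hxv
      · have hu : e.2.1 ∈ S.labels := verts_subset_labels hr hR _ (hb.mem_verts hT'.1).1
        exact (ih hT'.2 hbT.2.2 _ hu hbT.1).trans
          (hstep e (hR e hT'.1) (hne e hT'.1) hu hx).reachable
      · exact ih hT'.2 hbT.2.2 x hx hxv
  exact hbr ((key R (fun _ h => h) hb _ h1 (hV _ h1)).symm.trans
    (key R (fun _ h => h) hb _ h2 (hV _ h2)))

end Polytree

/-! ### Reading off a polytree without a chosen tree structure -/

/-- The sum of the nestings for the edges at `x`, where `f` says what is read off at the other ends. -/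
def nbrs (E : List (ℕ × ℕ)) (x : ℕ) (f : ℕ → NQuot) : NQuot :=
  ((E.filter fun e => e.1 = x).map fun e => NQuot.nest .white (f e.2)).sum +
    ((E.filter fun e => e.2 = x).map fun e => NQuot.nest .black (f e.1)).sum

/-- The edges that do not touch `x`. -/
def edgesAway (E : List (ℕ × ℕ)) (x : ℕ) : List (ℕ × ℕ) := E.filter fun a => a.1 ≠ x ∧ a.2 ≠ x

/-- The recursion of `toNestedAux` up to the identification of nested sequents; `g` gives the part
that is attached to a vertex. -/
def readOff (g : ℕ → NQuot) : ℕ → List (ℕ × ℕ) → ℕ → NQuot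
  | 0, _, x => g x
  | n + 1, E, x => g x + nbrs E x (readOff g n (edgesAway E x))

theorem cls_toNestedAux (Γ : List (ℕ × Fml)) (n : ℕ) : ∀ (E : List (ℕ × ℕ)) (x : ℕ),
    (toNestedAux Γ n E x).cls =
      readOff (fun y => (itemsAt (Γ.map fun a => (a.1, .fml a.2)) y).cls) n E x := by
  have h : ∀ x, (NSeq.ofList ((Γ.filter fun a => a.1 = x).map fun a => .fml a.2)) =
      itemsAt (Γ.map fun a => (a.1, .fml a.2)) x := fun x => by
    simp [itemsAt, List.filter_map, Function.comp_def]
  induction n with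
  | zero => intro E x; simp only [toNestedAux, readOff, h]
  | succ n ih =>
    intro E x
    simp only [toNestedAux, readOff, h, NSeq.cls_comma, NSeq.cls_ofList, List.map_map, nbrs,
      edgesAway, ← ih]
    rfl

theorem mem_edgesAway {E : List (ℕ × ℕ)} {x : ℕ} {a : ℕ × ℕ} :
    a ∈ edgesAway E x ↔ a ∈ E ∧ a.1 ≠ x ∧ a.2 ≠ x := by
  simp [edgesAway]

/-- Taking a vertex away removes at least one edge, if the vertex is not isolated. -/
theorem length_edgesAway_lt {E : List (ℕ × ℕ)} {x : ℕ} {a : ℕ × ℕ} (ha : a ∈ E)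
    (hx : a.1 = x ∨ a.2 = x) : (edgesAway E x).length < E.length := by
  refine List.length_filter_lt_length_iff_exists.2 ⟨a, ha, ?_⟩
  rcases hx with h | h <;> simp [h]

theorem nbrs_perm {E E' : List (ℕ × ℕ)} (h : E.Perm E') (x : ℕ) (f : ℕ → NQuot) :
    nbrs E x f = nbrs E' x f :=
  congrArg₂ (· + ·) ((h.filter _).map _).sum_eq ((h.filter _).map _).sum_eq

theorem nbrs_congr {E : List (ℕ × ℕ)} {x : ℕ} {f f' : ℕ → NQuot}
    (h : ∀ a ∈ E, (a.1 = x → f a.2 = f' a.2) ∧ (a.2 = x → f a.1 = f' a.1)) :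
    nbrs E x f = nbrs E x f' := by
  refine congrArg₂ (· + ·) (congrArg List.sum (List.map_congr_left fun a ha => ?_))
    (congrArg List.sum (List.map_congr_left fun a ha => ?_)) <;>
    obtain ⟨ha, hx⟩ := List.mem_filter.1 ha
  · rw [(h a ha).1 (of_decide_eq_true hx)]
  · rw [(h a ha).2 (of_decide_eq_true hx)]

theorem nbrs_eq_zero {E : List (ℕ × ℕ)} {x : ℕ} (h : ∀ a ∈ E, a.1 ≠ x ∧ a.2 ≠ x)
    (f : ℕ → NQuot) : nbrs E x f = 0 := by
  rw [nbrs, List.filter_eq_nil_iff.2, List.filter_eq_nil_iff.2]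
  · simp
  · simpa using fun a b hab => (h (a, b) hab).2
  · simpa using fun a b hab => (h (a, b) hab).1

theorem nbrs_cons_self {d : Dia} {p c : ℕ} (h : c ≠ p) (E : List (ℕ × ℕ)) (f : ℕ → NQuot) :
    nbrs (relAtom d p c :: E) p f = .nest d (f c) + nbrs E p f := by
  cases d <;> simp [nbrs, relAtom, h] <;> abel

theorem nbrs_cons_of_ne {a : ℕ × ℕ} {x : ℕ} (h : a.1 ≠ x ∧ a.2 ≠ x) (E : List (ℕ × ℕ))
    (f : ℕ → NQuot) : nbrs (a :: E) x f = nbrs E x f := by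
  simp [nbrs, h.1, h.2]

theorem readOff_perm (g : ℕ → NQuot) (n : ℕ) : ∀ {E E' : List (ℕ × ℕ)}, E.Perm E' →
    ∀ x, readOff g n E x = readOff g n E' x := by
  induction n with
  | zero => intro E E' _ x; rfl
  | succ n ih =>
    intro E E' h x
    simp only [readOff]
    have h1 : (edgesAway E x).Perm (edgesAway E' x) := h.filter _
    rw [nbrs_perm h, funext (ih h1)]

/-- What is attached to a vertex outside of the graph is irrelevant. -/
theorem readOff_congr {g g' : ℕ → NQuot} {c : ℕ} (h : ∀ y ≠ c, g y = g' y) (n : ℕ) :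
    ∀ {E : List (ℕ × ℕ)} {x : ℕ}, (∀ a ∈ E, a.1 ≠ c ∧ a.2 ≠ c) → x ≠ c →
      readOff g n E x = readOff g' n E x := by
  induction n with
  | zero => intro E x _ hx; exact h x hx
  | succ n ih =>
    intro E x hE hx
    simp only [readOff]
    have hE' : ∀ a ∈ edgesAway E x, a.1 ≠ c ∧ a.2 ≠ c := fun a ha => hE a (mem_edgesAway.1 ha).1
    rw [h x hx]
    exact congrArg _ (nbrs_congr fun a ha =>
      ⟨fun _ => ih hE' (hE a ha).2, fun _ => ih hE' (hE a ha).1⟩)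

theorem readOff_of_isolated (g : ℕ → NQuot) (n : ℕ) {E : List (ℕ × ℕ)} {x : ℕ}
    (h : ∀ a ∈ E, a.1 ≠ x ∧ a.2 ≠ x) : readOff g n E x = g x := by
  cases n with
  | zero => rfl
  | succ n => simp only [readOff, nbrs_eq_zero h, add_zero]

/-- A leaf `c` can be absorbed into its neighbour `p`. -/
theorem readOff_leaf {d : Dia} {p c : ℕ} (hcp : c ≠ p) (g : ℕ → NQuot) (n : ℕ) :
    ∀ {E : List (ℕ × ℕ)} {x : ℕ}, (∀ a ∈ E, a.1 ≠ c ∧ a.2 ≠ c) → (∀ a ∈ E, a.1 ≠ a.2) → x ≠ c →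
      E.length < n → readOff g n (relAtom d p c :: E) x =
        readOff (Function.update g p (g p + .nest d (g c))) n E x := by
  induction n with
  | zero => intro E x _ _ _ h; simp at h
  | succ n ih =>
    intro E x hE hl hx hn
    simp only [readOff]
    have hE' : ∀ a ∈ edgesAway E x, a.1 ≠ c ∧ a.2 ≠ c := fun a ha => hE a (mem_edgesAway.1 ha).1
    by_cases hxp : x = p
    · subst hxp
      have h1 : edgesAway (relAtom d x c :: E) x = edgesAway E x := by
        refine List.filter_cons_of_neg ?_
        cases d <;> simp [relAtom]
      rw [h1, nbrs_cons_self hcp, readOff_of_isolated g n hE', Function.update_self, add_assoc]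
      refine congrArg _ (congrArg _ (nbrs_congr fun a ha => ?_))
      have h2 : ∀ y ≠ x, readOff g n (edgesAway E x) y =
          readOff (Function.update g x (g x + .nest d (g c))) n (edgesAway E x) y := fun y hy =>
        readOff_congr (fun z hz => (Function.update_of_ne hz _ _).symm) n
          (fun a ha => (mem_edgesAway.1 ha).2) hy
      exact ⟨fun h => h2 _ fun h' => hl a ha (h.trans h'.symm),
        fun h => h2 _ fun h' => hl a ha (h'.trans h.symm)⟩
    · have h0 : (relAtom d p c).1 ≠ x ∧ (relAtom d p c).2 ≠ x := by
        cases d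
        exacts [⟨Ne.symm hxp, Ne.symm hx⟩, ⟨Ne.symm hx, Ne.symm hxp⟩]
      have h1 : edgesAway (relAtom d p c :: E) x = relAtom d p c :: edgesAway E x :=
        List.filter_cons_of_pos (by simpa using h0)
      rw [h1, nbrs_cons_of_ne h0, Function.update_of_ne hxp]
      refine congrArg _ (nbrs_congr fun a ha => ?_)
      have h2 : ∀ y ≠ c, a.1 = x ∨ a.2 = x → _ := fun y hy h =>
        ih hE' (fun b hb => hl b (mem_edgesAway.1 hb).1) hy
          ((length_edgesAway_lt ha h).trans_le (Nat.le_of_lt_succ hn))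
      exact ⟨fun h => h2 _ (hE a ha).2 (.inl h), fun h => h2 _ (hE a ha).1 (.inr h)⟩

/-- Absorbing the leaves of a tree one by one yields what the recursion from the root reads off. -/
theorem readOff_eq_nestedAt {r : ℕ} (n : ℕ) : ∀ {R : List Edge}, IsBuilt r R → R.length ≤ n →
    ∀ Δ : List (ℕ × NSeq), readOff (fun y => (itemsAt Δ y).cls) n (R.map Edge.atom) r =
      (nestedAt R r Δ).cls
  | [], _, _, Δ => readOff_of_isolated _ n (by simp)
  | (d, p, c) :: R, hR, hn, Δ => by
    have hr : r ≠ c := fun h => hR.2.1 (h ▸ List.mem_cons_self)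
    have hcp : c ≠ p := fun h => hR.2.1 (h ▸ hR.1)
    have hc : ∀ a ∈ R.map Edge.atom, a.1 ≠ c ∧ a.2 ≠ c := fun a ha => by
      obtain ⟨e, he, rfl⟩ := List.mem_map.1 ha
      have := mem_verts_of_atom hR.2.2 he
      exact ⟨fun h => hR.2.1 (h ▸ this.1), fun h => hR.2.1 (h ▸ this.2)⟩
    rw [List.map_cons]
    refine (readOff_leaf hcp _ n hc (ne_of_mem_map_atom hR.2.2) hr (by simpa using hn)).trans ?_
    simp only [nestedAt, if_neg hr]
    rw [← readOff_eq_nestedAt n hR.2.2 ((Nat.le_succ _).trans hn)]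
    refine readOff_congr (fun y hy => ?_) n hc hr
    have h1 : itemsAt (itemsAway Δ c ++ [(p, NSeq.nest d (itemsAt Δ c))]) y =
        .ofList (((itemsAway Δ c).filter fun a => a.1 = y).map (fun a => a.2) ++
          if y = p then [NSeq.nest d (itemsAt Δ c)] else []) := by
      by_cases hyp : y = p
      · simp [itemsAt, hyp]
      · simp [itemsAt, hyp, Ne.symm hyp]
    have h2 : ((((itemsAway Δ c).filter fun a => a.1 = y).map fun a => a.2).map NSeq.cls).sum =
        (itemsAt Δ y).cls := by
      rw [← itemsAt_itemsAway hy, itemsAt, NSeq.cls_ofList]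
    rw [h1, NSeq.cls_ofList, List.map_append, List.sum_append, h2]
    by_cases hyp : y = p
    · subst hyp
      simp
    · simp [hyp]

/-! ### The end sequent -/

section EndSequent

variable {S T : LSeq} {x : ℕ}

/-- The tree for a polytree sequent has exactly its relational atoms. -/
theorem mem_map_atom_grow (hS : S.IsPolytree) (hx : x ∈ S.labels) (h : T.Eqv S) (a : ℕ × ℕ) :
    a ∈ (grow T.rel x).map Edge.atom ↔ a ∈ S.rel := by
  obtain ⟨hb, hm, hc⟩ := grow_spec T.rel x
  have hm' : ∀ e ∈ grow T.rel x, e.atom ∈ S.rel := fun e he => h.rel_sub (hm e he)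
  have hc' : IsClosed S.rel x (grow T.rel x) := fun e he => hc e (h.symm.rel_sub he)
  rw [List.mem_map]
  constructor
  · rintro ⟨e, he, rfl⟩
    exact hm' e he
  · exact exists_atom_eq hS hx hb hm' (labels_subset_verts hS hx hc') a

/-- The environment for the end sequent of a derivation describes it, also if the end sequent is
written differently from `S`. -/
theorem inv_init {P : Set PathAxiom} (hS : S.IsPolytree) (hx : x ∈ S.labels) (h : T.Eqv S) :
    Inv P T (init T x) := by
  obtain ⟨hb, hm, hc⟩ := grow_spec T.rel x
  have hc' : IsClosed S.rel x (grow T.rel x) := fun e he => hc e (h.symm.rel_sub he)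
  refine ⟨hb, verts_subset_labels (h.symm.labels_sub hx) hm, fun _ ha => ha, fun a ha => ?_,
    fun t ht => ?_, ?_, fun e he _ => ?_⟩
  · exact labels_subset_verts hS hx hc' _ (h.labels_sub (LSeq.mem_labels_of_fml ha))
  · obtain ⟨e, he, ht⟩ := List.mem_flatMap.1 ht
    exact sound_edgeEntries hb he t ht
  · rintro d u v ⟨s, hs⟩
    obtain ⟨e, he, hs⟩ := List.mem_flatMap.1 hs
    obtain ⟨s', hs'⟩ := linked_edgeEntries_symm ⟨s, hs⟩
    exact ⟨s', List.mem_flatMap.2 ⟨e, he, hs'⟩⟩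
  · obtain ⟨⟨d, u, v⟩, hf, hfe⟩ :=
      List.mem_map.1 ((mem_map_atom_grow hS hx h e).2 (h.rel_sub he))
    obtain ⟨s, hs⟩ := linked_edgeEntries_relAtom d u v
    subst hfe
    exact ⟨s, List.mem_flatMap.2 ⟨_, hf, hs⟩⟩

theorem cls_seq_init (hS : S.IsPolytree) (hx : x ∈ S.labels) (h : T.Eqv S) :
    (init T x).seq.cls = (S.toNested x).cls := by
  have hb := (grow_spec T.rel x).1
  have hp : S.rel.dedup.Perm ((grow T.rel x).map Edge.atom) :=
    (List.perm_ext_iff_of_nodup (List.nodup_dedup _) (nodup_map_atom hb)).2 fun a => by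
      rw [List.mem_dedup, mem_map_atom_grow hS hx h]
  have hn : (grow T.rel x).length ≤ S.rel.length := by
    rw [← List.length_map (f := Edge.atom), ← hp.length_eq]
    exact (List.dedup_sublist _).length_le
  have hg : ∀ y, (itemsAt (S.fml.map fun a => (a.1, .fml a.2)) y).cls =
      (itemsAt (T.fml.map fun a => (a.1, .fml a.2)) y).cls := fun y => by
    rw [cls_itemsAt, cls_itemsAt]
    exact (((h.2.symm.map _).filter _).map _).sum_eq
  rw [LSeq.toNested, cls_toNestedAux, readOff_perm _ _ hp, funext hg, readOff_eq_nestedAt _ hb hn]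
  rfl

theorem nDerives_translate {P : Set PathAxiom} {D : Deriv LRule LSeq} (hS : S.IsPolytree)
    (hD : LDerives P D S) (hx : x ∈ S.labels) : NDerives P (translate D x) (S.toNested x) := by
  obtain ⟨h1, h2⟩ := der_paramRec hD.1 _ (inv_init hS hx hD.2)
  exact ⟨h1, NSeq.cls_eq.1 (h2.trans (cls_seq_init hS hx hD.2))⟩

end EndSequent

end Tense

theorem theorem5 :
    ∃ f : ℕ → ℕ → ℕ, Primrec₂ f ∧
      ∀ (P : Set Tense.PathAxiom) (D : Tense.Deriv Tense.LRule Tense.LSeq) (S : Tense.LSeq),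
        S.IsPolytree → Tense.LDerives P D S →
          ∀ x ∈ S.labels, ∃ D' : Tense.Deriv Tense.NRule Tense.NSeq,
            f (Tense.lcode D) x = Tense.ncode D' ∧ Tense.NDerives P D' (S.toNested x) := by
  -- Numbers that are not codes of derivations are decoded to an arbitrary one.
  let dec (n : ℕ) : Tense.Deriv Tense.LRule Tense.LSeq :=
    (Encodable.decode n).getD (.node₀ .id default)
  have hdec : Primrec dec := Primrec.option_getD.comp Primrec.decode (Primrec.const _)
  refine ⟨fun n x => Encodable.encode (Tense.translate (dec n) x), ?_, fun P D S hS hD x hx =>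
    ⟨Tense.translate D x, ?_, Tense.nDerives_translate hS hD hx⟩⟩
  · exact Primrec.encode.comp (Tense.primrec_translate.comp
      (Primrec.pair (hdec.comp Primrec.fst) Primrec.snd))
  · simp only [dec, Tense.lcode_eq, Encodable.encodek, Option.getD_some]
    exact (Tense.ncode_eq _).symm
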